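/- Let $\mathcal{O}_n$ ($n\in\mathbb{N}_0$) be the ring of convergent real power series in $X=(X_1,\dots,X_n)$; we have $\mathcal{O}_0=\mathbb{R}$ and regard $\mathcal{O}_n\subset\mathcal{O}_{n+1}$. For $f=\sum_\alpha a_\alpha X^\alpha\in\mathcal{O}_n$ let $\mathcal{D}(f)\subset\mathbb{R}^n$ be the union of all boxes $\prod_{i=1}^n\,]-R_i,R_i[$ with $R_i\in\mathbb{R}_{>0}\cup\{\infty\}$ on which $f$ converges absolutely. For $a\in\mathcal{D}(f)$ let $f(X+a)\in\mathcal{O}_n$ be the Taylor expansion of $f$ at $a$. For $n\ge 1$ put $X'=(X_1,\dots,X_{n-1})$, let $\int f\,dX_n=\sum_\alpha \frac{a_\alpha}{\alpha_n+1}X^{\alpha+\mathbf{e}_n}$ be the formal antiderivative ($\mathbf{e}_n$ the $n$-th unit vector), and let $\Re f_{\mathbb{C}},\Im f_{\mathbb{C}}\in\mathcal{O}_{2n}$ be the power series at $0$ of the real and imaginary parts of $f(X_1+iY_1,\dots,X_n+iY_n)$ in the variables $X_1,Y_1,\dots,X_n,Y_n$. A *collection* is a sequence $\mathcal{S}=(\mathcal{S}_n)_{n\in\mathbb{N}_0}$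 with $\mathcal{S}_n\subset\mathcal{O}_n$; collections are ordered by $\mathcal{S}\le\mathcal{T}$ iff $\mathcal{S}_n\subset\mathcal{T}_n$ for all $n$. It is a *presystem* if, for all $n\in\mathbb{N}_0$, $\mathcal{S}_n$ is a subring of $\mathcal{O}_n$, $\mathcal{S}_n=\mathcal{S}_{n+1}\cap\mathcal{O}_n$, and $\mathcal{S}_n$ is closed under permuting the variables. A presystem is a *convergent system* if $k:=\mathcal{S}_0$ is a subfield of $\mathbb{R}$, for every $n\ge 1$ we have $k[X]\subset\mathcal{S}_n$ and all coefficients of elements of $\mathcal{S}_n$ lie in $k$, and $f(X+a)\in\mathcal{S}_n$ for all $n\ge 0$, $f\in\mathcal{S}_n$ and $a\in\mathcal{D}(f)\cap k^n$. A convergent system is a *convergent Analysis system* if for all $n\ge 1$ and $f\in\mathcal{S}_n$: $1/f\in\mathcal{S}_n$ if $f(0)\neq 0$; $f(X',0)\in\mathcal{S}_{n-1}$; $\partial f/\partial X_n\in\mathcal{S}_n$; $\Re f_{\mathbb{C}},\Im f_{\mathbb{C}}\in\mathcal{S}_{2n}$; and $\int f\,dX_n\in\mathcal{S}_n$. Let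 $\mathcal{A}_n$ be the set of $f\in\mathcal{O}_n$ that are algebraic over $\mathbb{Q}[X_1,\dots,X_n]$. The collection $\mathcal{IA}=(\mathcal{IA}_n)_{n\in\mathbb{N}_0}$ of *integrated algebraic series* is the smallest presystem such that for all $n\in\mathbb{N}_0$ and $f\in\mathcal{IA}_n$: $\mathcal{A}_n\subset\mathcal{IA}_n$; $1/f\in\mathcal{IA}_n$ if $f(0)\ne 0$; $f(h(X))\in\mathcal{IA}_n$ for all $h\in\mathbb{Q}[X]^n$ with $h(0)=0$; $f(X+a)\in\mathcal{IA}_n$ for all $a\in\mathcal{D}(f)\cap\mathbb{Q}^n$; and $\int f\,dX_n\in\mathcal{IA}_n$ if $n\geq 1$. **Corollary 2.12.** $\mathcal{IA}$ is the smallest convergent Analysis system. That is, $\mathcal{IA}$ is a convergent Analysis system, and $\mathcal{IA}\le\mathcal{S}$ for every convergent Analysis system $\mathcal{S}$. -/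

import Mathlib

noncomputable section

namespace ConvergentSeries

open MvPowerSeries

/-- Formal power series over `ℝ` in the variables `X_1, …, X_n` (indexed by `Fin n`). -/
abbrev Series (n : ℕ) : Type := MvPowerSeries (Fin n) ℝ

/-- The term `a_α x^α` of the series `f = ∑ a_α X^α` at the point `x`. -/
def term {n : ℕ} (f : Series n) (x : Fin n → ℝ) (α : Fin n →₀ ℕ) : ℝ :=
  coeff α f * ∏ i, x i ^ α i

/-- The open box `∏ ]-R_i, R_i[` in `ℝ^n`, where `R_i = ∞` is allowed. -/
def box {n : ℕ} (R : Fin n → EReal) : Set (Fin n → ℝ) :=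
  {x | ∀ i, ((|x i| : ℝ) : EReal) < R i}

/-- The set of radii of convergence: all `R ∈ (ℝ_{>0} ∪ {∞})^n` such that `f` converges
absolutely on the open box given by `R`. -/
def radii {n : ℕ} (f : Series n) : Set (Fin n → EReal) :=
  {R | (∀ i, 0 < R i) ∧ ∀ x ∈ box R, Summable fun α => |term f x α|}

/-- The real domain of convergence `𝒟(f)`: the union of the boxes of all radii of convergence. -/
def domain {n : ℕ} (f : Series n) : Set (Fin n → ℝ) :=
  ⋃ R ∈ radii f, box R

/-- A power series is convergent if it has a radius of convergence. -/
def IsConvergent {n : ℕ} (f : Series n) : Prop := (radii f).Nonempty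

/-- The translation `f(X + a)` for `a ∈ 𝒟(f)`. Its coefficient at `X^α` is `(D^α f)(a) / α!`,
that is, `∑_β binom(β + α, α) a_{β + α} a^β`. -/
def translation {n : ℕ} (f : Series n) (a : Fin n → ℝ) : Series n :=
  fun α => ∑' β : Fin n →₀ ℕ,
    (∏ i, ((β i + α i).choose (α i) : ℝ)) * coeff (β + α) f * ∏ i, a i ^ β i

/-- The formal antiderivative `∫ f dX_i = ∑ (a_α / (α_i + 1)) X^(α + e_i)`. -/
def antideriv {n : ℕ} (i : Fin n) (f : Series n) : Series n :=
  fun α => if α i = 0 then 0 else coeff (α - Finsupp.single i 1) f / (α i : ℝ)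

/-- The position of the variable `X_j` in `(X_1, Y_1, …, X_n, Y_n)`. -/
def reIdx {n : ℕ} (j : Fin n) : Fin (2 * n) := ⟨2 * j, by omega⟩

/-- The position of the variable `Y_j` in `(X_1, Y_1, …, X_n, Y_n)`. -/
def imIdx {n : ℕ} (j : Fin n) : Fin (2 * n) := ⟨2 * j + 1, by omega⟩

/-- The complex power series `f(X_1 + i Y_1, …, X_n + i Y_n)` in the `2n` variables
`(X_1, Y_1, …, X_n, Y_n)`. -/
def complexify {n : ℕ} (f : Series n) : MvPowerSeries (Fin (2 * n)) ℂ :=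
  (MvPowerSeries.map Complex.ofRealHom f).subst
    fun j => (X (reIdx j) + C Complex.I * X (imIdx j) : MvPowerSeries (Fin (2 * n)) ℂ)

/-- The real power series of the real part of `(x, y) ↦ f(x + i y)`. -/
def rePart {n : ℕ} (f : Series n) : Series (2 * n) := fun α => (coeff α (complexify f)).re

/-- The real power series of the imaginary part of `(x, y) ↦ f(x + i y)`. -/
def imPart {n : ℕ} (f : Series n) : Series (2 * n) := fun α => (coeff α (complexify f)).im

/-- A sequence of sets of power series, the `n`-th one in `n` variables. Collections are ordered
by inclusion in every number of variables (the pointwise order). -/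
abbrev Collection : Type := ∀ n : ℕ, Set (Series n)

/-- Presystems of convergent power series. A series in `n` variables is identified with the same
series in `n + 1` variables by `rename Fin.castSucc`. -/
structure IsPresystem (S : Collection) : Prop where
  convergent : ∀ n, ∀ f ∈ S n, IsConvergent f
  subring : ∀ n, ∃ A : Subring (Series n), (A : Set (Series n)) = S n
  inter : ∀ n, ∀ f : Series n, IsConvergent f →
    (f ∈ S n ↔ MvPowerSeries.rename (Fin.castSucc : Fin n → Fin (n + 1)) f ∈ S (n + 1))
  perm : ∀ n, ∀ f ∈ S n, ∀ σ : Equiv.Perm (Fin n), MvPowerSeries.rename σ f ∈ S n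

/-- `S_0` as a subset of `ℝ`. -/
def coeffField (S : Collection) : Set ℝ := {c | (C c : Series 0) ∈ S 0}

/-- Systems of convergent power series: `k = S_0` is a subfield of `ℝ`, and
`k[X] ⊆ S_n ⊆ k{X}` for `n ≥ 1`. -/
structure IsSystem (S : Collection) : Prop extends IsPresystem S where
  subfield : ∃ k : Subfield ℝ, (k : Set ℝ) = coeffField S
  polynomial_mem : ∀ n, 1 ≤ n → ∀ p : MvPolynomial (Fin n) ℝ,
    (∀ α, MvPolynomial.coeff α p ∈ coeffField S) → (p : Series n) ∈ S n
  coeff_mem : ∀ n, 1 ≤ n → ∀ f ∈ S n, ∀ α, coeff α f ∈ coeffField S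

/-- Convergent systems: closed under translation to points of the domain of convergence with
coordinates in the coefficient field. -/
structure IsConvergentSystem (S : Collection) : Prop extends IsSystem S where
  translation_mem : ∀ n, ∀ f ∈ S n, ∀ a ∈ domain f, (∀ i, a i ∈ coeffField S) →
    translation f a ∈ S n

/-- Convergent Analysis systems. -/
structure IsConvergentAnalysisSystem (S : Collection) : Prop extends IsConvergentSystem S where
  inv_mem : ∀ n, 1 ≤ n → ∀ f ∈ S n, constantCoeff f ≠ 0 → f⁻¹ ∈ S n
  /-- `f(X', 0) ∈ S_{n-1}` -/
  restrict_mem : ∀ n, ∀ f ∈ S (n + 1),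
    MvPowerSeries.killCompl (Fin.castSuccEmb : Fin n ↪ Fin (n + 1)) f ∈ S n
  pderiv_mem : ∀ n, ∀ f ∈ S (n + 1), MvPowerSeries.pderiv ℝ (Fin.last n) f ∈ S (n + 1)
  rePart_mem : ∀ n, 1 ≤ n → ∀ f ∈ S n, rePart f ∈ S (2 * n)
  imPart_mem : ∀ n, 1 ≤ n → ∀ f ∈ S n, imPart f ∈ S (2 * n)
  antideriv_mem : ∀ n, ∀ f ∈ S (n + 1), antideriv (Fin.last n) f ∈ S (n + 1)

/-- The collection `𝒜` of algebraic power series: the convergent real power series that are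
algebraic over `ℚ[X_1, …, X_n]`. -/
def algebraicSeries : Collection := fun n =>
  {f | IsConvergent f ∧ IsAlgebraic (MvPolynomial (Fin n) ℚ) f}

/-- The closure properties in the definition of integrated algebraic power series. -/
structure IsIntegrationClosed (S : Collection) : Prop where
  algebraic_mem : ∀ n, ∀ f ∈ algebraicSeries n, f ∈ S n
  inv_mem : ∀ n, ∀ f ∈ S n, constantCoeff f ≠ 0 → f⁻¹ ∈ S n
  subst_mem : ∀ n, ∀ f ∈ S n, ∀ h : Fin n → MvPolynomial (Fin n) ℚ,
    (∀ i, MvPolynomial.constantCoeff (h i) = 0) →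
    f.subst (fun i => (MvPolynomial.map (algebraMap ℚ ℝ) (h i) : Series n)) ∈ S n
  translation_mem : ∀ n, ∀ f ∈ S n, ∀ a : Fin n → ℚ, (fun i => (a i : ℝ)) ∈ domain f →
    translation f (fun i => (a i : ℝ)) ∈ S n
  antideriv_mem : ∀ n, ∀ f ∈ S (n + 1), antideriv (Fin.last n) f ∈ S (n + 1)

/-- The collection `ℐ𝒜` of integrated algebraic power series: the smallest presystem with the
closure properties above, formed as the intersection (in every number of variables) of all of
them. -/
def integratedAlgebraic : Collection :=
  sInf {S | IsPresystem S ∧ IsIntegrationClosed S}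

end ConvergentSeries

end

/-! Both halves pass through one intermediate notion, `IsRatAnalysisSystem`: a presystem containing
the variables and closed under inverses, rational translations, restriction to X_n = 0,
antiderivatives, and real and imaginary parts. Every convergent Analysis system is of this kind. It
remains to show that such a system is integration closed (which gives minimality of ℐ𝒜), that it is
a convergent Analysis system, and that ℐ𝒜 is such a system.

The analytic core is `mem_of_fixedPoint`. If E(x, z) is small, then z = E(x, z) has a single, simple
root φ(x) in a disc, and f(x, φ(x)) is the quotient of the integrals of f/(z - E) and 1/(z - E)
along a contour around it. Residues contribute f(x, φ)/(1 - ∂E/∂z) and 1/(1 - ∂E/∂z), so the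
derivative and the factor 2πi cancel; neither has to be available in the system. The contour is a
square with rational corners, each side being cut into two segments. On a segment with rational
midpoint p and direction d (1 or i), the integrand is a power series in X' and the parameter t. It
belongs to the system because f(X', p + dt) arises from f(X', X_n + iY_n) by a rational translation
and a restriction. Its integral is an antiderivative evaluated at two rational points.

Taking E independent of z gives substitution of one series into the last variable, hence composition
with series of small norm (`tsubst_mem`); these may have nonzero constant terms, which gives
translation to points over the coefficient field. Taking E to be a Newton map with rational
coefficients gives an implicit function theorem (`mem_of_implicit`), and from it all algebraic
series: at a rational point near the origin some polynomial relation becomes simple, and one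
translates there and back. Division by a variable works by the same detour through a nearby point
where the variable is invertible; it yields coefficients and derivatives.

For ℐ𝒜 itself, restriction is a polynomial substitution. Real and imaginary parts are handled by
minimality: the members of ℐ𝒜 whose complexification again has both parts in ℐ𝒜 form an integration
closed presystem (`isIntegrationClosed_realImagClosed`). The least formal step there is the
antiderivative, which follows from the Cauchy-Riemann equations. -/

noncomputable section

namespace ConvergentSeries

open MvPowerSeries Filter Topology
open scoped NNReal ENNReal

/-! ### Weighted norms, evaluation and substitution -/

section Norm

variable {σ τ : Type*} [Fintype σ] [Fintype τ] {𝕜 : Type*} [RCLike 𝕜]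

/-- The monomial `x^α = ∏ x_i^(α_i)`. -/
def mon {M : Type*} [CommMonoid M] (x : σ → M) (α : σ →₀ ℕ) : M := ∏ i, x i ^ α i

lemma mon_zero {M : Type*} [CommMonoid M] (x : σ → M) : mon x 0 = 1 := by simp [mon]

lemma mon_add {M : Type*} [CommMonoid M] (x : σ → M) (α β : σ →₀ ℕ) :
    mon x (α + β) = mon x α * mon x β := by
  simp [mon, pow_add, Finset.prod_mul_distrib]

lemma mon_single {M : Type*} [CommMonoid M] (x : σ → M) (i : σ) (k : ℕ) :
    mon x (Finsupp.single i k) = x i ^ k := by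
  classical
  rw [mon, Finset.prod_eq_single i] <;> simp +contextual [eq_comm]

lemma mon_mul {M : Type*} [CommMonoid M] (x y : σ → M) (α : σ →₀ ℕ) :
    mon (fun i => x i * y i) α = mon x α * mon y α := by
  simp [mon, mul_pow, Finset.prod_mul_distrib]

lemma nnnorm_mon (x : σ → 𝕜) (α : σ →₀ ℕ) : ‖mon x α‖₊ = mon (fun i => ‖x i‖₊) α := by
  simp [mon, nnnorm_prod]

lemma mon_mono {r s : σ → ℝ≥0} (h : r ≤ s) (α : σ →₀ ℕ) : mon r α ≤ mon s α :=
  Finset.prod_le_prod' fun i _ => pow_le_pow_left₀ (by simp) (h i) _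

/-- The weighted `ℓ¹`-norm of a power series at a polyradius. -/
def wnorm (f : MvPowerSeries σ 𝕜) (r : σ → ℝ≥0) : ℝ≥0∞ :=
  ∑' α, ((‖coeff α f‖₊ * mon r α : ℝ≥0) : ℝ≥0∞)

/-- The sum of a power series at a point. -/
def ev (f : MvPowerSeries σ 𝕜) (x : σ → 𝕜) : 𝕜 := ∑' α, coeff α f * mon x α

lemma wnorm_mono (f : MvPowerSeries σ 𝕜) {r s : σ → ℝ≥0} (h : r ≤ s) : wnorm f r ≤ wnorm f s :=
  ENNReal.tsum_le_tsum fun α => by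
    gcongr
    exact mon_mono h α

lemma wnorm_le_of_coeff_le {𝕜' : Type*} [RCLike 𝕜'] {f : MvPowerSeries σ 𝕜}
    {g : MvPowerSeries σ 𝕜'} (h : ∀ α, ‖coeff α f‖₊ ≤ ‖coeff α g‖₊) (r : σ → ℝ≥0) :
    wnorm f r ≤ wnorm g r :=
  ENNReal.tsum_le_tsum fun α => by
    gcongr
    exact h α

lemma wnorm_add_le (f g : MvPowerSeries σ 𝕜) (r : σ → ℝ≥0) :
    wnorm (f + g) r ≤ wnorm f r + wnorm g r := by
  rw [wnorm, wnorm, wnorm, ← ENNReal.tsum_add]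
  refine ENNReal.tsum_le_tsum fun α => ?_
  rw [← ENNReal.coe_add, ← add_mul]
  gcongr
  simpa using nnnorm_add_le (coeff α f) (coeff α g)

lemma wnorm_neg (f : MvPowerSeries σ 𝕜) (r : σ → ℝ≥0) : wnorm (-f) r = wnorm f r := by
  simp [wnorm]

lemma wnorm_sub_le (f g : MvPowerSeries σ 𝕜) (r : σ → ℝ≥0) :
    wnorm (f - g) r ≤ wnorm f r + wnorm g r := by
  rw [sub_eq_add_neg, ← wnorm_neg g]
  exact wnorm_add_le _ _ _

lemma wnorm_monomial (α : σ →₀ ℕ) (c : 𝕜) (r : σ → ℝ≥0) :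
    wnorm (monomial α c) r = ((‖c‖₊ * mon r α : ℝ≥0) : ℝ≥0∞) := by
  classical
  rw [wnorm, tsum_eq_single α]
  · simp
  · intro β h
    simp [coeff_monomial, h]

lemma wnorm_C (c : 𝕜) (r : σ → ℝ≥0) : wnorm (C c) r = ‖c‖₊ := by
  rw [← monomial_zero_eq_C_apply, wnorm_monomial, mon_zero, mul_one]

lemma wnorm_zero (r : σ → ℝ≥0) : wnorm (0 : MvPowerSeries σ 𝕜) r = 0 := by simp [wnorm]

lemma wnorm_one (r : σ → ℝ≥0) : wnorm (1 : MvPowerSeries σ 𝕜) r = 1 := by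
  rw [← map_one (C (σ := σ) (R := 𝕜)), wnorm_C]; simp

lemma wnorm_X (i : σ) (r : σ → ℝ≥0) : wnorm (X i : MvPowerSeries σ 𝕜) r = r i := by
  rw [X_def, wnorm_monomial, mon_single]; simp

/-- Both sides add u α * v β over all pairs, the left one grouped by α + β. In `ℝ≥0∞` the regrouping
needs no summability. -/
lemma tsum_antidiagonal_mul {σ : Type*} (u v : (σ →₀ ℕ) → ℝ≥0∞) [DecidableEq σ] :
    ∑' γ, ∑ p ∈ Finset.HasAntidiagonal.antidiagonal γ, u p.1 * v p.2 = (∑' α, u α) * ∑' β, v β := by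
  rw [← ENNReal.tsum_mul_right]
  simp_rw [← ENNReal.tsum_mul_left]
  rw [← ENNReal.tsum_prod (f := fun α β => u α * v β),
    ← Finset.HasAntidiagonal.sigmaAntidiagonalEquivProd.tsum_eq, ENNReal.tsum_sigma']
  refine tsum_congr fun γ => ?_
  rw [tsum_fintype, ← Finset.sum_coe_sort]
  rfl

lemma wnorm_mul_le (f g : MvPowerSeries σ 𝕜) (r : σ → ℝ≥0) :
    wnorm (f * g) r ≤ wnorm f r * wnorm g r := by
  classical
  rw [wnorm, wnorm, wnorm, ← tsum_antidiagonal_mul]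
  refine ENNReal.tsum_le_tsum fun γ => ?_
  rw [coeff_mul]
  calc _ ≤ (((∑ p ∈ Finset.HasAntidiagonal.antidiagonal γ, ‖coeff p.1 f * coeff p.2 g‖₊) * mon r γ : ℝ≥0) : ℝ≥0∞) := by
        gcongr
        exact nnnorm_sum_le _ _
    _ = _ := by
        rw [Finset.sum_mul]
        push_cast
        refine Finset.sum_congr rfl fun p hp => ?_
        rw [← Finset.HasAntidiagonal.mem_antidiagonal.1 hp, mon_add, nnnorm_mul]
        push_cast
        ring

lemma wnorm_pow_le (f : MvPowerSeries σ 𝕜) (r : σ → ℝ≥0) (k : ℕ) :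
    wnorm (f ^ k) r ≤ wnorm f r ^ k := by
  induction k with
  | zero => simp [wnorm_one]
  | succ k ih =>
    rw [pow_succ, pow_succ]
    exact (wnorm_mul_le _ _ _).trans (by gcongr)

lemma wnorm_prod_le {κ : Type*} (s : Finset κ) (f : κ → MvPowerSeries σ 𝕜) (r : σ → ℝ≥0) :
    wnorm (∏ i ∈ s, f i) r ≤ ∏ i ∈ s, wnorm (f i) r := by
  classical
  induction s using Finset.induction_on with
  | empty => simp [wnorm_one]
  | insert a s ha ih =>
    rw [Finset.prod_insert ha, Finset.prod_insert ha]
    exact (wnorm_mul_le _ _ _).trans (by gcongr)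

lemma wnorm_sum_le {κ : Type*} (s : Finset κ) (f : κ → MvPowerSeries σ 𝕜) (r : σ → ℝ≥0) :
    wnorm (∑ i ∈ s, f i) r ≤ ∑ i ∈ s, wnorm (f i) r := by
  classical
  induction s using Finset.induction_on with
  | empty => simp [wnorm_zero]
  | insert a s ha ih =>
    rw [Finset.sum_insert ha, Finset.sum_insert ha]
    exact (wnorm_add_le _ _ _).trans (by gcongr)

variable {f g : MvPowerSeries σ 𝕜} {r : σ → ℝ≥0} {x : σ → 𝕜}

lemma nnnorm_coeff_mul_mon_le (f : MvPowerSeries σ 𝕜) (hx : ∀ i, ‖x i‖₊ ≤ r i) (α : σ →₀ ℕ) :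
    ‖coeff α f * mon x α‖₊ ≤ ‖coeff α f‖₊ * mon r α := by
  rw [nnnorm_mul, nnnorm_mon]
  gcongr
  exact mon_mono hx α

lemma summable_norm_term (hf : wnorm f r ≠ ⊤) (hx : ∀ i, ‖x i‖₊ ≤ r i) :
    Summable fun α => ‖coeff α f * mon x α‖ := by
  have h := ENNReal.tsum_coe_ne_top_iff_summable.1 hf
  have := NNReal.summable_of_le (nnnorm_coeff_mul_mon_le f hx) h
  exact NNReal.summable_coe.2 this

lemma hasSum_ev (hf : wnorm f r ≠ ⊤) (hx : ∀ i, ‖x i‖₊ ≤ r i) :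
    HasSum (fun α => coeff α f * mon x α) (ev f x) :=
  (summable_norm_term hf hx).of_norm.hasSum

lemma nnnorm_ev_le (hx : ∀ i, ‖x i‖₊ ≤ r i) : (‖ev f x‖₊ : ℝ≥0∞) ≤ wnorm f r := by
  by_cases hf : wnorm f r = ⊤
  · simp [hf]
  have h := ENNReal.tsum_coe_ne_top_iff_summable.1 hf
  rw [wnorm, ← ENNReal.coe_tsum h]
  have hs : Summable fun α => ‖coeff α f * mon x α‖₊ :=
    NNReal.summable_of_le (nnnorm_coeff_mul_mon_le f hx) h
  exact ENNReal.coe_le_coe.2 ((nnnorm_tsum_le hs).trans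
    (hs.tsum_le_tsum (nnnorm_coeff_mul_mon_le f hx) h))

lemma ev_add (hf : wnorm f r ≠ ⊤) (hg : wnorm g r ≠ ⊤) (hx : ∀ i, ‖x i‖₊ ≤ r i) :
    ev (f + g) x = ev f x + ev g x := by
  rw [← ((hasSum_ev hf hx).add (hasSum_ev hg hx)).tsum_eq, ev]
  simp [add_mul]

lemma ev_neg (f : MvPowerSeries σ 𝕜) (x : σ → 𝕜) : ev (-f) x = -ev f x := by
  simp [ev, tsum_neg]

lemma ev_sub (hf : wnorm f r ≠ ⊤) (hg : wnorm g r ≠ ⊤) (hx : ∀ i, ‖x i‖₊ ≤ r i) :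
    ev (f - g) x = ev f x - ev g x := by
  rw [sub_eq_add_neg, ev_add hf (by rwa [wnorm_neg]) hx, ev_neg, sub_eq_add_neg]

lemma ev_monomial (α : σ →₀ ℕ) (c : 𝕜) (x : σ → 𝕜) : ev (monomial α c) x = c * mon x α := by
  classical
  rw [ev, tsum_eq_single α]
  · simp
  · intro β h
    simp [coeff_monomial, h]

lemma ev_C (c : 𝕜) (x : σ → 𝕜) : ev (C c) x = c := by
  rw [← monomial_zero_eq_C_apply, ev_monomial, mon_zero, mul_one]

lemma ev_one (x : σ → 𝕜) : ev 1 x = 1 := by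
  rw [← map_one (C (σ := σ) (R := 𝕜)), ev_C]

lemma ev_zero (x : σ → 𝕜) : ev 0 x = 0 := by simp [ev]

lemma ev_X (i : σ) (x : σ → 𝕜) : ev (X i) x = x i := by
  rw [X_def, ev_monomial, mon_single]; simp

lemma ev_mul (hf : wnorm f r ≠ ⊤) (hg : wnorm g r ≠ ⊤) (hx : ∀ i, ‖x i‖₊ ≤ r i) :
    ev (f * g) x = ev f x * ev g x := by
  classical
  have hf' := summable_norm_term hf hx
  have hg' := summable_norm_term hg hx
  let u : (σ →₀ ℕ) → 𝕜 := fun α => coeff α f * mon x α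
  let v : (σ →₀ ℕ) → 𝕜 := fun α => coeff α g * mon x α
  have key : (∑' α, u α) * ∑' α, v α =
      ∑' γ, ∑ p ∈ Finset.HasAntidiagonal.antidiagonal γ, u p.1 * v p.2 :=
    Summable.tsum_mul_tsum_eq_tsum_sum_antidiagonal hf'.of_norm hg'.of_norm
      (summable_mul_of_summable_norm hf' hg')
  refine Eq.trans (tsum_congr fun γ => ?_) key.symm
  rw [coeff_mul, Finset.sum_mul]
  refine Finset.sum_congr rfl fun p hp => ?_
  rw [← Finset.HasAntidiagonal.mem_antidiagonal.1 hp, mon_add]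
  exact mul_mul_mul_comm _ _ _ _

lemma wnorm_pow_ne_top (hf : wnorm f r ≠ ⊤) (k : ℕ) : wnorm (f ^ k) r ≠ ⊤ :=
  ne_top_of_le_ne_top (ENNReal.pow_ne_top hf) (wnorm_pow_le f r k)

lemma wnorm_mul_ne_top (hf : wnorm f r ≠ ⊤) (hg : wnorm g r ≠ ⊤) : wnorm (f * g) r ≠ ⊤ :=
  ne_top_of_le_ne_top (ENNReal.mul_ne_top hf hg) (wnorm_mul_le f g r)

lemma wnorm_add_ne_top (hf : wnorm f r ≠ ⊤) (hg : wnorm g r ≠ ⊤) : wnorm (f + g) r ≠ ⊤ :=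
  ne_top_of_le_ne_top (ENNReal.add_ne_top.2 ⟨hf, hg⟩) (wnorm_add_le f g r)

lemma wnorm_sub_ne_top (hf : wnorm f r ≠ ⊤) (hg : wnorm g r ≠ ⊤) : wnorm (f - g) r ≠ ⊤ :=
  ne_top_of_le_ne_top (ENNReal.add_ne_top.2 ⟨hf, hg⟩) (wnorm_sub_le f g r)

lemma ev_pow (hf : wnorm f r ≠ ⊤) (hx : ∀ i, ‖x i‖₊ ≤ r i) (k : ℕ) :
    ev (f ^ k) x = ev f x ^ k := by
  induction k with
  | zero => simp [ev_one]
  | succ k ih => rw [pow_succ, pow_succ, ev_mul (wnorm_pow_ne_top hf k) hf hx, ih]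

lemma wnorm_prod_ne_top {κ : Type*} (s : Finset κ) {f : κ → MvPowerSeries σ 𝕜}
    (hf : ∀ i ∈ s, wnorm (f i) r ≠ ⊤) : wnorm (∏ i ∈ s, f i) r ≠ ⊤ :=
  ne_top_of_le_ne_top (ENNReal.prod_ne_top hf) (wnorm_prod_le s f r)

lemma ev_prod {κ : Type*} (s : Finset κ) {f : κ → MvPowerSeries σ 𝕜}
    (hf : ∀ i ∈ s, wnorm (f i) r ≠ ⊤) (hx : ∀ i, ‖x i‖₊ ≤ r i) :
    ev (∏ i ∈ s, f i) x = ∏ i ∈ s, ev (f i) x := by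
  classical
  induction s using Finset.induction_on with
  | empty => simp [ev_one]
  | insert a s ha ih =>
    rw [Finset.prod_insert ha, Finset.prod_insert ha,
      ev_mul (hf a (by simp)) (wnorm_prod_ne_top s fun i hi => hf i (by simp [hi])) hx,
      ih fun i hi => hf i (by simp [hi])]

/-- Substitution of power series that need not vanish at the origin. -/
def tsubst (f : MvPowerSeries σ 𝕜) (g : σ → MvPowerSeries τ 𝕜) : MvPowerSeries τ 𝕜 :=
  fun e => ∑' d, coeff d f * coeff e (mon g d)

lemma wnorm_mon_le {g : σ → MvPowerSeries τ 𝕜} {s : τ → ℝ≥0} (hg : ∀ i, wnorm (g i) s ≤ r i)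
    (d : σ →₀ ℕ) : wnorm (mon g d) s ≤ (mon r d : ℝ≥0) := by
  refine (wnorm_prod_le _ _ _).trans ?_
  rw [mon, ENNReal.ofNNReal_finsetProd]
  refine Finset.prod_le_prod' fun i _ => (wnorm_pow_le _ _ _).trans ?_
  rw [ENNReal.coe_pow]
  gcongr
  exact hg i

/-- This is the absolute estimate behind every rearrangement for substitution: since the weighted
norm is submultiplicative, g^d has norm at most r^d, so the expanded double series is dominated by
the series for f at r. -/
lemma tsum_tsum_tsubst_le (f : MvPowerSeries σ 𝕜) {g : σ → MvPowerSeries τ 𝕜} {s : τ → ℝ≥0}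
    (hg : ∀ i, wnorm (g i) s ≤ r i) :
    ∑' (d) (e), ((‖coeff d f * coeff e (mon g d)‖₊ * mon s e : ℝ≥0) : ℝ≥0∞) ≤ wnorm f r := by
  refine ENNReal.tsum_le_tsum fun d => ?_
  simp_rw [nnnorm_mul, mul_assoc]
  push_cast
  rw [ENNReal.tsum_mul_left]
  gcongr
  refine le_trans (le_of_eq ?_) (wnorm_mon_le hg d)
  simp [wnorm]

lemma enorm_tsum_le {κ : Type*} (u : κ → 𝕜) : (‖∑' k, u k‖₊ : ℝ≥0∞) ≤ ∑' k, (‖u k‖₊ : ℝ≥0∞) := by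
  by_cases h : ∑' k, (‖u k‖₊ : ℝ≥0∞) = ⊤
  · simp [h]
  have h' := ENNReal.tsum_coe_ne_top_iff_summable.1 h
  rw [← ENNReal.coe_tsum h']
  exact ENNReal.coe_le_coe.2 (nnnorm_tsum_le h')

lemma wnorm_tsubst_le (f : MvPowerSeries σ 𝕜) {g : σ → MvPowerSeries τ 𝕜} {s : τ → ℝ≥0}
    (hg : ∀ i, wnorm (g i) s ≤ r i) : wnorm (tsubst f g) s ≤ wnorm f r := by
  refine le_trans ?_ (tsum_tsum_tsubst_le f hg)
  rw [ENNReal.tsum_comm]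
  refine ENNReal.tsum_le_tsum fun e => ?_
  push_cast
  rw [ENNReal.tsum_mul_right]
  gcongr
  exact enorm_tsum_le _

/-- Fubini for the absolutely convergent double series indexed by the exponents of f and of the
result. No condition on the constant terms of g is needed, only that its norms stay below the
polyradius r. -/
lemma ev_tsubst (hf : wnorm f r ≠ ⊤) {g : σ → MvPowerSeries τ 𝕜} {s : τ → ℝ≥0}
    (hg : ∀ i, wnorm (g i) s ≤ r i) {x : τ → 𝕜} (hx : ∀ i, ‖x i‖₊ ≤ s i) :
    ev (tsubst f g) x = ev f (fun i => ev (g i) x) := by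
  have hg' : ∀ i, wnorm (g i) s ≠ ⊤ := fun i => ne_top_of_le_ne_top ENNReal.coe_ne_top (hg i)
  have hmon : ∀ d, wnorm (mon g d) s ≠ ⊤ := fun d =>
    ne_top_of_le_ne_top ENNReal.coe_ne_top (wnorm_mon_le hg d)
  have hsum : Summable fun p : (σ →₀ ℕ) × (τ →₀ ℕ) =>
      coeff p.1 f * coeff p.2 (mon g p.1) * mon x p.2 := by
    have h1 : Summable fun p : (σ →₀ ℕ) × (τ →₀ ℕ) =>
        ‖coeff p.1 f * coeff p.2 (mon g p.1)‖₊ * mon s p.2 := by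
      rw [← ENNReal.tsum_coe_ne_top_iff_summable]
      rw [ENNReal.tsum_prod (f := fun d e =>
        ((‖coeff d f * coeff e (mon g d)‖₊ * mon s e : ℝ≥0) : ℝ≥0∞))]
      exact ne_top_of_le_ne_top hf (tsum_tsum_tsubst_le f hg)
    refine Summable.of_nnnorm (NNReal.summable_of_le (fun p => ?_) h1)
    rw [nnnorm_mul _ (mon x p.2), nnnorm_mon]
    gcongr
    exact mon_mono hx _
  have key := hsum.tsum_comm' (f := fun d e => coeff d f * coeff e (mon g d) * mon x e)
    (fun d => ?_) (fun e => ?_)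
  · rw [ev, ev]
    convert key using 1
    · refine tsum_congr fun e => ?_
      rw [tsum_mul_right]
      rfl
    · refine tsum_congr fun d => ?_
      simp_rw [mul_assoc, tsum_mul_left]
      congr 1
      change _ = ev (mon g d) x
      rw [mon, mon, ev_prod _ (fun i _ => wnorm_pow_ne_top (hg' i) _) hx]
      exact Finset.prod_congr rfl fun i _ => (ev_pow (hg' i) hx _).symm
  · exact hsum.prod_factor d
  · exact (hsum.prod_symm).prod_factor e

end Norm

/-- Under `HasSubst` only finitely many terms meet a given exponent, so the infinite sum is the
finite sum of formal substitution. -/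
lemma subst_eq_tsubst {σ τ : Type*} [Fintype σ] {𝕜 : Type*} [RCLike 𝕜] (f : MvPowerSeries σ 𝕜) {g : σ → MvPowerSeries τ 𝕜} (hg : HasSubst g) :
    f.subst g = tsubst f g := by
  ext e
  rw [coeff_subst hg]
  change _ = ∑' d, coeff d f * coeff e (mon g d)
  have h := coeff_subst_finite hg f e
  rw [tsum_eq_finsum]
  · refine finsum_congr fun d => ?_
    rw [smul_eq_mul, Finsupp.prod_fintype _ _ (by simp)]
    rfl
  · refine h.subset fun d hd => ?_
    rw [Function.mem_support, smul_eq_mul, Finsupp.prod_fintype _ _ (by simp)]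
    exact hd

/-! ### Inverses and shrinking of radii -/

section Operations

variable {σ τ : Type*} [Fintype σ] [Fintype τ] {𝕜 : Type*} [RCLike 𝕜]
variable {f g : MvPowerSeries σ 𝕜} {r : σ → ℝ≥0} {x : σ → 𝕜}

lemma wnorm_eq_constantCoeff_add (f : MvPowerSeries σ 𝕜) (r : σ → ℝ≥0) :
    wnorm f r = ‖constantCoeff f‖₊ + wnorm (f - C (constantCoeff f)) r := by
  classical
  rw [wnorm, wnorm, ENNReal.tsum_eq_add_tsum_ite 0]
  congr 1
  · simp [mon_zero]
  · refine tsum_congr fun α => ?_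
    split_ifs with h
    · simp [h]
    · simp [coeff_C, h]

/-- The geometric series, without a limit of power series: on a finite set of exponents the inverse
agrees with a truncated geometric sum, because u^d has order at least d. These sums are bounded
uniformly by 1 / (1 - ‖u‖). -/
lemma wnorm_inv_one_sub_ne_top {u : MvPowerSeries σ 𝕜} (hu : constantCoeff u = 0)
    (h : wnorm u r < 1) : wnorm (1 - u)⁻¹ r ≠ ⊤ := by
  have h1 : constantCoeff (1 - u) ≠ 0 := by simp [hu]
  have hS : ∀ d, wnorm (∑ k ∈ Finset.range d, u ^ k) r ≤ (1 - wnorm u r)⁻¹ := fun d => by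
    refine (wnorm_sum_le _ _ _).trans ?_
    rw [← ENNReal.tsum_geometric]
    exact (Finset.sum_le_sum fun k _ => wnorm_pow_le u r k).trans (ENNReal.sum_le_tsum _)
  refine ne_top_of_le_ne_top (b := (1 - wnorm u r)⁻¹)
    (ENNReal.inv_ne_top.2 (tsub_pos_of_lt h).ne') ?_
  rw [wnorm, ENNReal.tsum_eq_iSup_sum]
  refine iSup_le fun s => ?_
  set d := s.sup Finsupp.degree + 1 with hd
  have hid : (1 - u)⁻¹ = ∑ k ∈ Finset.range d, u ^ k + u ^ d * (1 - u)⁻¹ := by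
    have h2 : (1 - u)⁻¹ * (1 - u) = 1 := MvPowerSeries.inv_mul_cancel _ h1
    have h3 : (∑ k ∈ Finset.range d, u ^ k) * (1 - u) = 1 - u ^ d := by
      rw [mul_comm]; exact mul_neg_geom_sum u d
    have h4 : (∑ k ∈ Finset.range d, u ^ k) = (1 - u ^ d) * (1 - u)⁻¹ := by
      rw [← h3, mul_assoc, mul_comm (1 - u), h2, mul_one]
    rw [h4]; ring
  have hc : ∀ α ∈ s, coeff α (1 - u)⁻¹ = coeff α (∑ k ∈ Finset.range d, u ^ k) := fun α hα => by
    rw [hid, map_add, coeff_of_lt_order (f := u ^ d * _), add_zero]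
    have h5 : ((α.degree : ℕ) : ℕ∞) < d := by
      exact_mod_cast Nat.lt_succ_of_le (Finset.le_sup (f := Finsupp.degree) hα)
    exact h5.trans_le ((le_order_pow_of_constantCoeff_eq_zero d hu).trans
      ((le_add_right le_rfl).trans le_order_mul))
  calc _ = ∑ α ∈ s, ((‖coeff α (∑ k ∈ Finset.range d, u ^ k)‖₊ * mon r α : ℝ≥0) : ℝ≥0∞) :=
        Finset.sum_congr rfl fun α hα => by rw [hc α hα]
    _ ≤ wnorm (∑ k ∈ Finset.range d, u ^ k) r := ENNReal.sum_le_tsum _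
    _ ≤ _ := hS d

/-- Write f = c(1 - u) with c the constant term; the hypothesis says exactly that u has norm below
1. -/
lemma wnorm_inv_ne_top (h : wnorm (f - C (constantCoeff f)) r < ‖constantCoeff f‖₊) :
    wnorm f⁻¹ r ≠ ⊤ := by
  set c := constantCoeff f with hc
  have hc0 : c ≠ 0 := by
    rintro h0
    simp [h0] at h
  set u : MvPowerSeries σ 𝕜 := -(C c⁻¹ * (f - C c)) with hu
  have hu0 : constantCoeff u = 0 := by simp [hu, ← hc]
  have hcc : (C c⁻¹ : MvPowerSeries σ 𝕜) * C c = 1 := by rw [← map_mul, inv_mul_cancel₀ hc0, map_one]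
  have hf : f = C c * (1 - u) := by
    rw [hu]
    linear_combination (C c - f) * hcc
  have hun : wnorm u r < 1 := by
    rw [hu, wnorm_neg]
    refine (wnorm_mul_le _ _ _).trans_lt ?_
    rw [wnorm_C, nnnorm_inv, ENNReal.coe_inv (by simpa using hc0), mul_comm, ← div_eq_mul_inv]
    exact ENNReal.div_lt_of_lt_mul (by simpa using h)
  have hfi : f⁻¹ = (1 - u)⁻¹ * C c⁻¹ := by
    conv_lhs => rw [hf]
    rw [MvPowerSeries.mul_inv_rev, C_inv]
  rw [hfi]
  exact wnorm_mul_ne_top (wnorm_inv_one_sub_ne_top hu0 hun) (by rw [wnorm_C]; simp)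

lemma ev_inv (h0 : constantCoeff f ≠ 0) (hf : wnorm f r ≠ ⊤) (hi : wnorm f⁻¹ r ≠ ⊤)
    (hx : ∀ i, ‖x i‖₊ ≤ r i) : ev f⁻¹ x = (ev f x)⁻¹ := by
  refine eq_inv_of_mul_eq_one_left ?_
  rw [← ev_mul hi hf hx, MvPowerSeries.inv_mul_cancel _ h0, ev_one]

lemma wnorm_le_mul_of_mon_le {s : σ → ℝ≥0} {c : ℝ≥0}
    (h : ∀ α, coeff α f ≠ 0 → mon s α ≤ c * mon r α) : wnorm f s ≤ c * wnorm f r := by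
  rw [wnorm, wnorm, ← ENNReal.tsum_mul_left]
  refine ENNReal.tsum_le_tsum fun α => ?_
  rw [← ENNReal.coe_mul]
  refine ENNReal.coe_le_coe.2 ?_
  by_cases h0 : coeff α f = 0
  · simp [h0]
  · rw [mul_left_comm]
    gcongr
    exact h α h0

lemma mon_const_mul {M : Type*} [CommMonoid M] (t : M) (y : σ → M) (α : σ →₀ ℕ) :
    mon (fun i => t * y i) α = t ^ α.degree * mon y α := by
  rw [mon_mul, mon, Finset.prod_pow_eq_pow_sum, Finsupp.degree_eq_sum]

lemma wnorm_smul_radius_le {t : ℝ≥0} (ht : t ≤ 1) (h0 : constantCoeff f = 0) :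
    wnorm f (fun i => t * r i) ≤ t * wnorm f r := by
  refine wnorm_le_mul_of_mon_le fun α hα => ?_
  rw [mon_const_mul]
  gcongr
  have : α.degree ≠ 0 := by
    intro h
    rw [Finsupp.degree_eq_zero_iff] at h
    simp [h, h0] at hα
  exact pow_le_of_le_one (by simp) ht this

/-- A power series without constant term has small norm at small polyradii. -/
lemma exists_wnorm_lt (hf : wnorm f r ≠ ⊤) (h0 : constantCoeff f = 0) {ε : ℝ≥0∞} (hε : 0 < ε) :
    ∃ t : ℝ≥0, 0 < t ∧ t ≤ 1 ∧ wnorm f (fun i => t * r i) < ε := by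
  have : Tendsto (fun t : ℝ≥0 => (t : ℝ≥0∞) * wnorm f r) (𝓝 0) (𝓝 0) := by
    have h := ENNReal.Tendsto.mul_const (a := 0) (b := wnorm f r) (f := 𝓝 (0 : ℝ≥0))
      (m := fun t : ℝ≥0 => (t : ℝ≥0∞)) (by simpa using ENNReal.continuous_coe.tendsto (0 : ℝ≥0))
      (Or.inr hf)
    simpa using h
  have h1 : ∀ᶠ t : ℝ≥0 in 𝓝[>] 0, (t : ℝ≥0∞) * wnorm f r < ε :=
    (this.eventually (gt_mem_nhds hε)).filter_mono nhdsWithin_le_nhds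
  have h2 : ∀ᶠ t : ℝ≥0 in 𝓝[>] 0, t < 1 :=
    (gt_mem_nhds one_pos : ∀ᶠ t : ℝ≥0 in 𝓝 0, t < 1).filter_mono nhdsWithin_le_nhds
  obtain ⟨t, ⟨h3, h4⟩, h5⟩ := ((h1.and h2).and self_mem_nhdsWithin).exists
  exact ⟨t, h5, h4.le, (wnorm_smul_radius_le h4.le h0).trans_lt h3⟩

/-! ### Change of variables -/

lemma rename_eq_tsubst {τ : Type*} (e : σ → τ) (f : MvPowerSeries σ 𝕜) :
    rename e f = tsubst f (fun i => X (e i)) := by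
  rw [rename_eq_subst, subst_eq_tsubst _ (HasSubst.X_comp e)]
  rfl

lemma wnorm_rename_le (e : σ → τ) (f : MvPowerSeries σ 𝕜) {s : τ → ℝ≥0} :
    wnorm (rename e f) s ≤ wnorm f (fun i => s (e i)) := by
  rw [rename_eq_tsubst]
  exact wnorm_tsubst_le f fun i => (wnorm_X _ _).le

lemma ev_rename (e : σ → τ) {s : τ → ℝ≥0} (hf : wnorm f (fun i => s (e i)) ≠ ⊤) {y : τ → 𝕜}
    (hy : ∀ i, ‖y i‖₊ ≤ s i) : ev (rename e f) y = ev f (fun i => y (e i)) := by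
  rw [rename_eq_tsubst, ev_tsubst hf (fun i => (wnorm_X _ _).le) hy]
  simp_rw [ev_X]

lemma mon_embDomain {M : Type*} [CommMonoid M] (e : σ ↪ τ) (y : τ → M) (α : σ →₀ ℕ) :
    mon y (α.embDomain e) = mon (fun i => y (e i)) α := by
  classical
  rw [mon, mon, ← Finset.prod_subset (Finset.subset_univ (Finset.univ.map e)), Finset.prod_map]
  · simp
  · intro t _ ht
    rw [Finsupp.embDomain_of_notMem_range, pow_zero]
    simpa using ht

lemma wnorm_killCompl_le (e : σ ↪ τ) (f : MvPowerSeries τ 𝕜) (s : τ → ℝ≥0) :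
    wnorm (killCompl e f) (fun i => s (e i)) ≤ wnorm f s := by
  rw [wnorm]
  simp_rw [coeff_killCompl, ← mon_embDomain e s]
  exact ENNReal.tsum_comp_le_tsum_of_injective (Finsupp.embDomain_injective e)
    fun α => ((‖coeff α f‖₊ * mon s α : ℝ≥0) : ℝ≥0∞)

lemma ev_killCompl (e : σ ↪ τ) (f : MvPowerSeries τ 𝕜) (y : τ → 𝕜)
    (hy : ∀ t ∉ Set.range e, y t = 0) : ev (killCompl e f) (fun i => y (e i)) = ev f y := by
  rw [ev]
  simp_rw [coeff_killCompl, ← mon_embDomain e y]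
  refine (Finsupp.embDomain_injective e).tsum_eq (f := fun α => coeff α f * mon y α) fun α hα => ?_
  rw [Finsupp.mem_range_embDomain_iff]
  intro t ht
  by_contra h
  refine hα ?_
  change _ * mon y α = 0
  rw [mon, Finset.prod_eq_zero (Finset.mem_univ t), mul_zero]
  rw [hy t h, zero_pow]
  simpa using ht

/-! ### Antiderivatives and derivatives -/

/-- The formal antiderivative with respect to an arbitrary variable. -/
def antid (i : σ) (f : MvPowerSeries σ 𝕜) : MvPowerSeries σ 𝕜 :=
  fun α => if α i = 0 then 0 else coeff (α - Finsupp.single i 1) f / (α i : 𝕜)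

end Operations

section Antiderivative

variable {σ : Type*} {𝕜 : Type*} [RCLike 𝕜]

lemma coeff_antid_add_single (i : σ) (f : MvPowerSeries σ 𝕜) (β : σ →₀ ℕ) :
    coeff (β + Finsupp.single i 1) (antid i f) = coeff β f / (β i + 1 : ℕ) := by
  change (if _ then _ else _) = _
  simp

lemma coeff_antid_of_eq_zero (i : σ) (f : MvPowerSeries σ 𝕜) {β : σ →₀ ℕ} (h : β i = 0) :
    coeff β (antid i f) = 0 := by
  change (if _ then _ else _) = _
  simp [h]

lemma mem_range_add_single {i : σ} {α : σ →₀ ℕ} (h : α i ≠ 0) :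
    α ∈ Set.range fun β : σ →₀ ℕ => β + Finsupp.single i 1 :=
  ⟨α - Finsupp.single i 1, tsub_add_cancel_of_le (by
    rw [Finsupp.single_le_iff]; omega)⟩

lemma add_single_injective (i : σ) :
    Function.Injective fun β : σ →₀ ℕ => β + Finsupp.single i 1 :=
  add_left_injective _

end Antiderivative

section Operations

variable {σ τ : Type*} [Fintype σ] [Fintype τ] {𝕜 : Type*} [RCLike 𝕜]
variable {f g : MvPowerSeries σ 𝕜} {r : σ → ℝ≥0} {x : σ → 𝕜}

lemma wnorm_antid_le (i : σ) (f : MvPowerSeries σ 𝕜) (r : σ → ℝ≥0) :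
    wnorm (antid i f) r ≤ r i * wnorm f r := by
  rw [wnorm, ← (add_single_injective i).tsum_eq, wnorm, ← ENNReal.tsum_mul_left]
  · refine ENNReal.tsum_le_tsum fun β => ?_
    rw [← ENNReal.coe_mul]
    refine ENNReal.coe_le_coe.2 ?_
    rw [coeff_antid_add_single, mon_add, mon_single, pow_one, nnnorm_div]
    calc _ ≤ ‖coeff β f‖₊ * (mon r β * r i) := by
          gcongr
          refine div_le_self (by simp) ?_
          rw [RCLike.nnnorm_natCast]
          simp
      _ = _ := by ring
  · intro α hα
    refine mem_range_add_single fun h => hα ?_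
    simp [coeff_antid_of_eq_zero i f h]

lemma ev_antid (i : σ) (f : MvPowerSeries σ 𝕜) (x : σ → 𝕜) :
    ev (antid i f) x = ∑' β, coeff β f / (β i + 1 : ℕ) * (mon x β * x i) := by
  rw [ev, ← (add_single_injective i).tsum_eq]
  · refine tsum_congr fun β => ?_
    rw [coeff_antid_add_single, mon_add, mon_single, pow_one]
  · intro α hα
    refine mem_range_add_single fun h => hα ?_
    simp [coeff_antid_of_eq_zero i f h]

lemma mon_update [DecidableEq σ] {M : Type*} [CommMonoid M] (y : σ → M) (i : σ) (t : M)
    (α : σ →₀ ℕ) : mon (Function.update y i t) α =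
      t ^ α i * ∏ j ∈ Finset.univ.erase i, y j ^ α j := by
  rw [mon, ← Finset.mul_prod_erase _ _ (Finset.mem_univ i)]
  congr 1
  · simp
  · refine Finset.prod_congr rfl fun j hj => ?_
    rw [Function.update_of_ne (Finset.ne_of_mem_erase hj)]

/-- Termwise differentiation of the integrated series returns the terms of f, and these are
dominated by the convergent majorant `wnorm f r` on the whole disc. Starting from the antiderivative
therefore costs no radius. -/
lemma hasDerivAt_ev_antid [DecidableEq σ] (hf : wnorm f r ≠ ⊤) (i : σ)
    (hx : ∀ j, j ≠ i → ‖x j‖₊ ≤ r j) {t : 𝕜} (ht : ‖t‖₊ < r i) :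
    HasDerivAt (fun t => ev (antid i f) (Function.update x i t))
      (ev f (Function.update x i t)) t := by
  have hle : ∀ y : 𝕜, ‖y‖₊ ≤ r i → ∀ j, ‖Function.update x i y j‖₊ ≤ r j := fun y hy j => by
    by_cases h : j = i
    · subst h; simpa using hy
    · rw [Function.update_of_ne h]; exact hx j h
  have hu : Summable fun β => ((‖coeff β f‖₊ * mon r β : ℝ≥0) : ℝ) :=
    NNReal.summable_coe.2 (ENNReal.tsum_coe_ne_top_iff_summable.1 hf)
  have hball : ∀ y ∈ Metric.ball (0 : 𝕜) (r i), ‖y‖₊ ≤ r i := fun y hy => by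
    rw [mem_ball_zero_iff] at hy
    exact_mod_cast hy.le
  have key := hasDerivAt_tsum_of_isPreconnected (𝕜 := 𝕜) (F := 𝕜) (t := Metric.ball (0 : 𝕜) (r i))
    (u := fun β => ((‖coeff β f‖₊ * mon r β : ℝ≥0) : ℝ)) (y₀ := 0) (y := t)
    (g := fun β y => coeff β f / (β i + 1 : ℕ) * (mon (Function.update x i y) β * y))
    (g' := fun β y => coeff β f * mon (Function.update x i y) β)
    hu Metric.isOpen_ball (convex_ball _ _).isPreconnected ?_ ?_ ?_ ?_ ?_
  · simp_rw [ev_antid, Function.update_self]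
    exact key
  · intro β y _
    simp_rw [mon_update]
    have h1 := ((hasDerivAt_pow (β i + 1) y).const_mul
      ((∏ j ∈ Finset.univ.erase i, x j ^ β j) * (coeff β f / (β i + 1 : ℕ))))
    have h2 : ((β i + 1 : ℕ) : 𝕜) ≠ 0 := Nat.cast_ne_zero.2 (Nat.succ_ne_zero _)
    refine (h1.congr_deriv ?_).congr_of_eventuallyEq (Eventually.of_forall fun z => ?_)
    · simp only [Nat.add_sub_cancel]
      field_simp
    · simp only [pow_succ]
      ring
  · intro β y hy
    rw [← coe_nnnorm]
    exact NNReal.coe_le_coe.2 (nnnorm_coeff_mul_mon_le f (hle y (hball y hy)) β)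
  · simpa using (lt_of_le_of_lt (by simp) ht : (0 : ℝ≥0) < r i)
  · simp
  · rw [mem_ball_zero_iff]; exact_mod_cast ht

end Operations

section Operations

variable {σ τ : Type*} [Fintype σ] [Fintype τ] {𝕜 : Type*} [RCLike 𝕜]
variable {f g : MvPowerSeries σ 𝕜} {r : σ → ℝ≥0} {x : σ → 𝕜}

/-- An elementary replacement for Cauchy's estimate: it trades the factor from differentiation for
an increase δ of the radius. -/
lemma add_one_mul_pow_mul_le (n : ℕ) (a δ : ℝ≥0) : (n + 1) * a ^ n * δ ≤ (a + δ) ^ (n + 1) := by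
  induction n with
  | zero => simp
  | succ n ih =>
    calc ((n + 1 : ℕ) + 1) * a ^ (n + 1) * δ = (n + 1) * a ^ n * δ * a + a ^ (n + 1) * δ := by
          push_cast; ring
      _ ≤ (a + δ) ^ (n + 1) * a + (a + δ) ^ (n + 1) * δ := by
          gcongr
          exact le_self_add
      _ = _ := by ring

lemma wnorm_pderiv_mul_le [DecidableEq σ] (i : σ) (f : MvPowerSeries σ 𝕜) (r : σ → ℝ≥0) (δ : ℝ≥0) :
    wnorm (pderiv 𝕜 i f) r * δ ≤ wnorm f (Function.update r i (r i + δ)) := by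
  rw [wnorm, ← ENNReal.tsum_mul_right]
  refine le_trans (ENNReal.tsum_le_tsum fun β => ?_) (ENNReal.tsum_comp_le_tsum_of_injective
    (add_single_injective i)
    fun α => ((‖coeff α f‖₊ * mon (Function.update r i (r i + δ)) α : ℝ≥0) : ℝ≥0∞))
  rw [← ENNReal.coe_mul]
  refine ENNReal.coe_le_coe.2 ?_
  have h1 : mon r β = r i ^ β i * ∏ j ∈ Finset.univ.erase i, r j ^ β j := by
    conv_lhs => rw [← Function.update_eq_self i r]
    rw [mon_update]
  have h2 : ‖((β i : 𝕜) + 1)‖₊ = β i + 1 := by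
    rw [← Nat.cast_succ, RCLike.nnnorm_natCast]; simp
  have h3 : ∏ j ∈ Finset.univ.erase i, r j ^ (β + Finsupp.single i 1 : σ →₀ ℕ) j =
      ∏ j ∈ Finset.univ.erase i, r j ^ β j := by
    refine Finset.prod_congr rfl fun j hj => ?_
    rw [Finsupp.add_apply, Finsupp.single_eq_of_ne (Finset.ne_of_mem_erase hj), add_zero]
  rw [coeff_pderiv, nnnorm_mul, h2, mon_update, h1, h3]
  have := add_one_mul_pow_mul_le (β i) (r i) δ
  calc _ = ‖coeff (β + Finsupp.single i 1) f‖₊ * (((β i + 1) * r i ^ β i * δ) *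
        ∏ j ∈ Finset.univ.erase i, r j ^ β j) := by ring
    _ ≤ _ := by
        gcongr
        simpa using this

lemma ev_update_of_coeff_eq_zero [DecidableEq σ] {i : σ} {h : MvPowerSeries σ 𝕜}
    (hh : ∀ α, α i ≠ 0 → coeff α h = 0) (x : σ → 𝕜) (s t : 𝕜) :
    ev h (Function.update x i s) = ev h (Function.update x i t) := by
  refine tsum_congr fun α => ?_
  by_cases h0 : α i = 0
  · simp [mon_update, h0]
  · simp [hh α h0]

lemma wnorm_update_ne_top_pderiv [DecidableEq σ] (hf : wnorm f r ≠ ⊤) (i : σ) {s : ℝ≥0}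
    (hs : s < r i) : wnorm (pderiv 𝕜 i f) (Function.update r i s) ≠ ⊤ := by
  have h := wnorm_pderiv_mul_le i f (Function.update r i s) (r i - s)
  rw [Function.update_idem, Function.update_self, add_tsub_cancel_of_le hs.le,
    Function.update_eq_self] at h
  intro htop
  rw [htop, ENNReal.top_mul (ENNReal.coe_ne_zero.2 (tsub_pos_of_lt hs).ne')] at h
  exact hf (top_le_iff.1 h)

/-- The difference of f and the antiderivative of ∂f/∂X_i does not involve X_i, so the derivative is
given by `hasDerivAt_ev_antid`, on a slightly smaller disc where ∂f/∂X_i has finite norm. -/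
lemma hasDerivAt_ev_update [DecidableEq σ] (hf : wnorm f r ≠ ⊤) (i : σ)
    (hx : ∀ j, j ≠ i → ‖x j‖₊ ≤ r j) {t : 𝕜} (ht : ‖t‖₊ < r i) :
    HasDerivAt (fun t => ev f (Function.update x i t))
      (ev (pderiv 𝕜 i f) (Function.update x i t)) t := by
  obtain ⟨s, hts, hs⟩ := exists_between ht
  set r' := Function.update r i s with hr'
  have hr'r : r' ≤ r := by
    intro j
    by_cases h : j = i
    · subst h; simpa [hr'] using hs.le
    · simp [hr', h]
  have hd : wnorm (pderiv 𝕜 i f) r' ≠ ⊤ := wnorm_update_ne_top_pderiv hf i hs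
  have hx' : ∀ j, j ≠ i → ‖x j‖₊ ≤ r' j := fun j hj => by
    rw [hr', Function.update_of_ne hj]; exact hx j hj
  have hd' := hasDerivAt_ev_antid hd i hx' (t := t) (by simpa [hr'] using hts)
  have ha : wnorm (antid i (pderiv 𝕜 i f)) r' ≠ ⊤ :=
    ne_top_of_le_ne_top (ENNReal.mul_ne_top ENNReal.coe_ne_top hd) (wnorm_antid_le _ _ _)
  have hf' : wnorm f r' ≠ ⊤ := ne_top_of_le_ne_top hf (wnorm_mono f hr'r)
  have hc : ∀ α, α i ≠ 0 → coeff α (f - antid i (pderiv 𝕜 i f)) = 0 := by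
    intro α hα
    obtain ⟨β, rfl⟩ := mem_range_add_single hα
    have h2 : ((β i + 1 : ℕ) : 𝕜) ≠ 0 := Nat.cast_ne_zero.2 (Nat.succ_ne_zero _)
    simp only [map_sub, coeff_antid_add_single, coeff_pderiv]
    push_cast at h2 ⊢
    field_simp
    ring
  refine (hd'.add_const (ev (f - antid i (pderiv 𝕜 i f)) (Function.update x i 0))).congr_of_eventuallyEq ?_
  have : ∀ᶠ y in 𝓝 t, ‖y‖₊ < s := (continuous_nnnorm.tendsto t).eventually (gt_mem_nhds hts)
  filter_upwards [this] with y hy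
  have hy' : ∀ j, ‖Function.update x i y j‖₊ ≤ r' j := fun j => by
    by_cases h : j = i
    · subst h; simpa [hr'] using hy.le
    · rw [Function.update_of_ne h]; exact hx' j h
  rw [ev_update_of_coeff_eq_zero hc x 0 y, ev_sub hf' ha hy']
  ring

lemma continuousOn_ev (hf : wnorm f r ≠ ⊤) : ContinuousOn (ev f) {x | ∀ i, ‖x i‖₊ ≤ r i} := by
  refine continuousOn_tsum (u := fun β => ((‖coeff β f‖₊ * mon r β : ℝ≥0) : ℝ)) (fun α => ?_)
    (NNReal.summable_coe.2 (ENNReal.tsum_coe_ne_top_iff_summable.1 hf)) fun α x hx => ?_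
  · unfold mon
    fun_prop
  · rw [← coe_nnnorm]
    exact NNReal.coe_le_coe.2 (nnnorm_coeff_mul_mon_le f hx α)

/-! ### Translations -/

/-- The translation of a power series in arbitrary variables. -/
def transl (a : σ → 𝕜) (f : MvPowerSeries σ 𝕜) : MvPowerSeries σ 𝕜 :=
  fun α => ∑' β : σ →₀ ℕ,
    (∏ i, ((β i + α i).choose (α i) : 𝕜)) * coeff (β + α) f * ∏ i, a i ^ β i

lemma coeff_mon_X_add_C (a : σ → 𝕜) (α γ : σ →₀ ℕ) :
    coeff α (mon (fun i => (X i + C (a i) : MvPowerSeries σ 𝕜)) γ) =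
      if α ≤ γ then (∏ i, ((γ i).choose (α i) : 𝕜)) * mon a (γ - α) else 0 := by
  classical
  have h1 : mon (fun i => (X i + C (a i) : MvPowerSeries σ 𝕜)) γ =
      ∑ p ∈ Fintype.piFinset fun i => Finset.range (γ i + 1),
        monomial (Finsupp.equivFunOnFinite.symm p)
          (∏ i, (a i ^ (γ i - p i) * ((γ i).choose (p i) : 𝕜))) := by
    simp_rw [mon, add_pow]
    rw [Finset.prod_univ_sum]
    refine Finset.sum_congr rfl fun p _ => ?_
    rw [Finset.prod_congr rfl fun i _ => show (X i : MvPowerSeries σ 𝕜) ^ p i *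
      C (a i) ^ (γ i - p i) * ((γ i).choose (p i) : MvPowerSeries σ 𝕜) =
      monomial (Finsupp.single i (p i)) (a i ^ (γ i - p i) * ((γ i).choose (p i) : 𝕜)) by
        rw [X_pow_eq, mul_assoc, ← map_pow, ← map_natCast (C (σ := σ) (R := 𝕜)), ← map_mul,
          ← monomial_zero_eq_C_apply, monomial_mul_monomial, add_zero, one_mul]]
    rw [prod_monomial]
    congr 1
    congr 1
    ext j
    simp [Finsupp.finsetSum_apply, Finsupp.single_apply]
  rw [h1, map_sum]
  simp_rw [coeff_monomial]
  split_ifs with h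
  · rw [Finset.sum_eq_single (⇑α)]
    · rw [if_pos (by ext; simp), Finset.prod_mul_distrib, mul_comm]
      rfl
    · intro p _ hp
      rw [if_neg]
      rintro rfl
      exact hp (by ext; simp)
    · intro hα
      exact absurd (Fintype.mem_piFinset.2 fun i => Finset.mem_range.2
        (Nat.lt_succ_of_le (h i))) hα
  · refine Finset.sum_eq_zero fun p hp => ?_
    rw [if_neg]
    rintro rfl
    exact h fun i => Nat.le_of_lt_succ (Finset.mem_range.1 (Fintype.mem_piFinset.1 hp i))

/-- The binomial theorem for (X + a)^γ, with γ = β + α as the change of summation index. -/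
lemma transl_eq_tsubst (a : σ → 𝕜) (f : MvPowerSeries σ 𝕜) :
    transl a f = tsubst f (fun i => X i + C (a i)) := by
  ext α
  change ∑' β : σ →₀ ℕ, (∏ i, ((β i + α i).choose (α i) : 𝕜)) * coeff (β + α) f * mon a β =
    ∑' γ, coeff γ f * coeff α (mon _ γ)
  rw [← (add_left_injective α).tsum_eq (f := fun γ => coeff γ f * coeff α (mon _ γ))]
  · refine tsum_congr fun β => ?_
    rw [coeff_mon_X_add_C, if_pos (by simp)]
    simp only [add_tsub_cancel_right, Finsupp.add_apply]
    ring
  · intro γ hγ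
    rw [Function.mem_support, coeff_mon_X_add_C] at hγ
    split_ifs at hγ with h
    · exact ⟨γ - α, tsub_add_cancel_of_le h⟩
    · simp at hγ

lemma wnorm_X_add_C_le (a : σ → 𝕜) {s : σ → ℝ≥0} (h : ∀ i, s i + ‖a i‖₊ ≤ r i) (i : σ) :
    wnorm (X i + C (a i) : MvPowerSeries σ 𝕜) s ≤ r i := by
  refine (wnorm_add_le _ _ _).trans ?_
  rw [wnorm_X, wnorm_C]
  exact_mod_cast h i

lemma wnorm_transl_le (a : σ → 𝕜) (f : MvPowerSeries σ 𝕜) {s : σ → ℝ≥0}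
    (h : ∀ i, s i + ‖a i‖₊ ≤ r i) : wnorm (transl a f) s ≤ wnorm f r := by
  rw [transl_eq_tsubst]
  exact wnorm_tsubst_le f (wnorm_X_add_C_le a h)

lemma ev_transl (a : σ → 𝕜) (hf : wnorm f r ≠ ⊤) {s : σ → ℝ≥0}
    (h : ∀ i, s i + ‖a i‖₊ ≤ r i) (hx : ∀ i, ‖x i‖₊ ≤ s i) :
    ev (transl a f) x = ev f (fun i => x i + a i) := by
  rw [transl_eq_tsubst, ev_tsubst hf (wnorm_X_add_C_le a h) hx]
  congr 1
  ext i
  rw [ev_add (r := s) (by rw [wnorm_X]; simp) (by rw [wnorm_C]; simp) hx, ev_X, ev_C]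

end Operations

/-! ### The identity theorem at real points -/

section Identity

variable {σ : Type*} [Fintype σ] {𝕜 : Type*} [RCLike 𝕜]
variable {f g : MvPowerSeries σ 𝕜} {r : σ → ℝ≥0}

lemma eq_zero_of_forall_hasSum_pow {c : ℕ → 𝕜} {R : ℝ≥0} (hR : 0 < R)
    (hc : Summable fun d => ‖c d‖ * (R : ℝ) ^ d)
    (h : ∀ t : ℝ, |t| < R → HasSum (fun d => (t : 𝕜) ^ d * c d) 0) : c = 0 := by
  let p : FormalMultilinearSeries ℝ ℝ 𝕜 := fun d => ContinuousMultilinearMap.mkPiRing ℝ (Fin d) (c d)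
  have hp : HasFPowerSeriesOnBall (0 : ℝ → 𝕜) p 0 R := by
    refine ⟨p.le_radius_of_summable_norm ?_, by exact_mod_cast hR, fun {y} hy => ?_⟩
    · simpa [p, ContinuousMultilinearMap.norm_mkPiRing] using hc
    · have hy' : |y| < R := by simpa using hy
      simpa [p, RCLike.real_smul_eq_coe_mul] using h y hy'
  have := hp.hasFPowerSeriesAt.eq_zero
  ext d
  have h1 : p d = 0 := by rw [this]; rfl
  have h2 := congrArg (fun q => q fun _ => (1 : ℝ)) h1
  simpa [p] using h2

/-- The identity theorem: a convergent power series that vanishes at all real points near the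
origin is zero. -/
lemma eq_zero_of_eventually_ev_eq_zero (hr : ∀ i, 0 < r i) (hf : wnorm f r ≠ ⊤)
    (h : ∀ᶠ x : σ → ℝ in 𝓝 0, ev f (fun i => (x i : 𝕜)) = 0) : f = 0 := by
  classical
  obtain ⟨ε, hε, hball⟩ := Metric.eventually_nhds_iff.1 h
  obtain ⟨δ, hδ, hδε, hδr⟩ : ∃ δ : ℝ, 0 < δ ∧ δ < ε ∧ ∀ i, δ ≤ r i := by
    have h1 : ∀ᶠ δ : ℝ in 𝓝[>] 0, δ < ε := nhdsWithin_le_nhds (gt_mem_nhds hε)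
    have h2 : ∀ᶠ δ : ℝ in 𝓝[>] 0, ∀ i, δ ≤ r i :=
      eventually_all.2 fun i => nhdsWithin_le_nhds
        ((gt_mem_nhds (NNReal.coe_pos.2 (hr i))).mono fun _ => le_of_lt)
    obtain ⟨δ, ⟨h3, h4⟩, h5⟩ := ((h1.and h2).and self_mem_nhdsWithin).exists
    exact ⟨δ, h5, h3, h4⟩
  -- On the line t ↦ tx the series becomes a power series in t whose coefficients are the
  -- homogeneous parts of f at x; the identity theorem in one variable kills each of them.
  have key : ∀ x : σ → ℝ, (∀ i, |x i| ≤ δ) → ∀ d : ℕ,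
      ∑ α ∈ Finset.finsuppAntidiag Finset.univ d, coeff α f * mon (fun i => (x i : 𝕜)) α = 0 := by
    intro x hx
    have hx' : ∀ i, ‖((x i : ℝ) : 𝕜)‖₊ ≤ r i := fun i => by
      rw [← NNReal.coe_le_coe, coe_nnnorm, RCLike.norm_ofReal]
      exact (hx i).trans (hδr i)
    have hsum := summable_norm_term hf hx'
    have hfib : ∀ (u : (σ →₀ ℕ) → 𝕜) (d : ℕ),
        ∑' b : (Finsupp.degree ⁻¹' {d} : Set (σ →₀ ℕ)), u b =
          ∑ α ∈ Finset.finsuppAntidiag Finset.univ d, u α := fun u d => by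
      rw [← Finset.tsum_subtype]
      have : (Finsupp.degree ⁻¹' {d} : Set (σ →₀ ℕ)) =
          ↑(Finset.finsuppAntidiag (Finset.univ : Finset σ) d) := by
        ext α
        simp [Finset.mem_finsuppAntidiag, Finsupp.degree_eq_sum]
      rw [this]
      rfl
    refine congrFun (eq_zero_of_forall_hasSum_pow (R := 1) one_pos
      (c := fun d => ∑ α ∈ Finset.finsuppAntidiag Finset.univ d,
        coeff α f * mon (fun i => (x i : 𝕜)) α) ?_ ?_)
    · have h1 := (hsum.hasSum.tsum_fiberwise Finsupp.degree).summable
      refine h1.of_nonneg_of_le (fun d => by positivity) fun d => ?_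
      rw [NNReal.coe_one, one_pow, mul_one, ← hfib]
      exact norm_tsum_le_tsum_norm (hsum.subtype _)
    · intro t ht
      rw [NNReal.coe_one] at ht
      have htx : ∀ i, ‖((t : 𝕜) * (x i : 𝕜))‖₊ ≤ r i := fun i => by
        rw [nnnorm_mul]
        refine (mul_le_of_le_one_left (by simp) ?_).trans (hx' i)
        rw [← NNReal.coe_le_coe, coe_nnnorm, RCLike.norm_ofReal]
        exact ht.le
      have h0 : ev f (fun i => (t : 𝕜) * (x i : 𝕜)) = 0 := by
        have := hball (y := fun i => t * x i) (by
          rw [dist_zero_right]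
          refine ((pi_norm_le_iff_of_nonneg hδ.le).2 fun i => ?_).trans_lt hδε
          rw [norm_mul]
          exact (mul_le_of_le_one_left (norm_nonneg _) ht.le).trans (hx i))
        simpa using this
      have h1 := (hasSum_ev hf htx).tsum_fiberwise Finsupp.degree
      rw [h0] at h1
      refine h1.congr_fun fun d => ?_
      rw [hfib (fun α => coeff α f * mon (fun i => (t : 𝕜) * (x i : 𝕜)) α), Finset.mul_sum]
      refine Finset.sum_congr rfl fun α hα => ?_
      rw [mon_const_mul]
      have : α.degree = d := by
        rw [Finsupp.degree_eq_sum]; exact (Finset.mem_finsuppAntidiag.1 hα).1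
      rw [this]
      ring
  ext α
  -- The homogeneous part of degree |α| vanishes on a product of infinite sets, hence is the zero
  -- polynomial.
  set P : MvPolynomial σ 𝕜 :=
    ∑ β ∈ Finset.finsuppAntidiag Finset.univ α.degree, MvPolynomial.monomial β (coeff β f) with hP
  have hP0 : P = 0 := by
    refine MvPolynomial.funext_set (fun _ => (fun t : ℝ => (t : 𝕜)) '' Set.Icc (-δ) δ)
      (fun i => (Set.Icc_infinite (by linarith)).image RCLike.ofReal_injective.injOn) fun y hy => ?_
    choose x hx hxy using fun i => hy i (Set.mem_univ i)
    obtain rfl : (fun i => (x i : 𝕜)) = y := funext hxy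
    rw [hP, map_sum, map_zero, ← key x (fun i => abs_le.2 (hx i)) α.degree]
    refine Finset.sum_congr rfl fun β _ => ?_
    rw [MvPolynomial.eval_monomial, Finsupp.prod_fintype _ _ (by simp)]
    rfl
  have := congrArg (MvPolynomial.coeff α) hP0
  rw [hP, MvPolynomial.coeff_sum, Finset.sum_eq_single α] at this
  · simpa using this
  · intro β _ hβ
    rw [MvPolynomial.coeff_monomial, if_neg hβ]
  · intro hα
    exact absurd (Finset.mem_finsuppAntidiag.2 ⟨(Finsupp.degree_eq_sum α).symm, Finset.subset_univ _⟩) hα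

end Identity

/-! ### Real and imaginary parts of complex series -/

section Complex

variable {σ τ : Type*} [Fintype σ] [Fintype τ]

/-- A real power series viewed as a complex one. -/
abbrev toC (f : MvPowerSeries σ ℝ) : MvPowerSeries σ ℂ := MvPowerSeries.map Complex.ofRealHom f

/-- The power series of the real parts of the coefficients. -/
def reS (f : MvPowerSeries σ ℂ) : MvPowerSeries σ ℝ := fun α => (coeff α f).re

/-- The power series of the imaginary parts of the coefficients. -/
def imS (f : MvPowerSeries σ ℂ) : MvPowerSeries σ ℝ := fun α => (coeff α f).im

end Complex

section Complex

variable {σ : Type*}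

lemma coeff_reS (f : MvPowerSeries σ ℂ) (α : σ →₀ ℕ) : coeff α (reS f) = (coeff α f).re := rfl

lemma coeff_imS (f : MvPowerSeries σ ℂ) (α : σ →₀ ℕ) : coeff α (imS f) = (coeff α f).im := rfl

lemma toC_add_I_mul (u v : MvPowerSeries σ ℝ) (α : σ →₀ ℕ) :
    coeff α (toC u + C Complex.I * toC v) = ⟨coeff α u, coeff α v⟩ := by
  rw [map_add, coeff_C_mul, coeff_map, coeff_map]
  apply Complex.ext <;> simp

lemma eq_toC_add (f : MvPowerSeries σ ℂ) : f = toC (reS f) + C Complex.I * toC (imS f) := by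
  ext α
  rw [toC_add_I_mul]
  rfl

lemma reS_toC_add (u v : MvPowerSeries σ ℝ) : reS (toC u + C Complex.I * toC v) = u := by
  ext α; rw [coeff_reS, toC_add_I_mul]

lemma imS_toC_add (u v : MvPowerSeries σ ℝ) : imS (toC u + C Complex.I * toC v) = v := by
  ext α; rw [coeff_imS, toC_add_I_mul]

lemma reS_add (f g : MvPowerSeries σ ℂ) : reS (f + g) = reS f + reS g := by
  ext α; simp [coeff_reS]

lemma imS_add (f g : MvPowerSeries σ ℂ) : imS (f + g) = imS f + imS g := by
  ext α; simp [coeff_imS]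

lemma reS_neg (f : MvPowerSeries σ ℂ) : reS (-f) = -reS f := by
  ext α; simp [coeff_reS]

lemma imS_neg (f : MvPowerSeries σ ℂ) : imS (-f) = -imS f := by
  ext α; simp [coeff_imS]

lemma C_I_mul_C_I : (C Complex.I : MvPowerSeries σ ℂ) * C Complex.I = -1 := by
  rw [← map_mul, Complex.I_mul_I, map_neg, map_one]

lemma mul_eq_toC_add (f g : MvPowerSeries σ ℂ) :
    f * g = toC (reS f * reS g - imS f * imS g) +
      C Complex.I * toC (reS f * imS g + imS f * reS g) := by
  conv_lhs => rw [eq_toC_add f, eq_toC_add g]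
  simp only [map_add, map_sub, map_mul]
  linear_combination (toC (imS f) * toC (imS g)) * C_I_mul_C_I (σ := σ)

lemma reS_mul (f g : MvPowerSeries σ ℂ) : reS (f * g) = reS f * reS g - imS f * imS g := by
  rw [mul_eq_toC_add, reS_toC_add]

lemma imS_mul (f g : MvPowerSeries σ ℂ) : imS (f * g) = reS f * imS g + imS f * reS g := by
  rw [mul_eq_toC_add, imS_toC_add]

lemma reS_toC (f : MvPowerSeries σ ℝ) : reS (toC f) = f := by
  ext α; simp [coeff_reS]

lemma imS_toC (f : MvPowerSeries σ ℝ) : imS (toC f) = 0 := by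
  ext α; simp [coeff_imS]

lemma reS_C (c : ℂ) : reS (C c : MvPowerSeries σ ℂ) = C c.re := by
  classical
  ext α; simp only [coeff_reS, coeff_C]; split_ifs <;> simp

lemma imS_C (c : ℂ) : imS (C c : MvPowerSeries σ ℂ) = C c.im := by
  classical
  ext α; simp only [coeff_imS, coeff_C]; split_ifs <;> simp

lemma constantCoeff_reS (f : MvPowerSeries σ ℂ) : constantCoeff (reS f) = (constantCoeff f).re := rfl

lemma constantCoeff_imS (f : MvPowerSeries σ ℂ) : constantCoeff (imS f) = (constantCoeff f).im := rfl

/-- This is 1/(u + iv) = (u - iv)/(u² + v²): inverting complex series needs only the inverse of a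
real series with positive constant term. -/
lemma inv_eq_toC_add {f : MvPowerSeries σ ℂ} (h : constantCoeff f ≠ 0) :
    constantCoeff (reS f * reS f + imS f * imS f) ≠ 0 ∧
    f⁻¹ = toC (reS f * (reS f * reS f + imS f * imS f)⁻¹) +
      C Complex.I * toC (-(imS f * (reS f * reS f + imS f * imS f)⁻¹)) := by
  set q := reS f * reS f + imS f * imS f with hq
  have hq0 : constantCoeff q ≠ 0 := by
    rw [hq, map_add, map_mul, map_mul, constantCoeff_reS, constantCoeff_imS]
    rw [← Complex.normSq_apply]
    exact (Complex.normSq_pos.2 h).ne'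
  refine ⟨hq0, ?_⟩
  rw [MvPowerSeries.inv_eq_iff_mul_eq_one h]
  have h1 : toC (q⁻¹) * toC q = 1 := by
    rw [← map_mul, MvPowerSeries.inv_mul_cancel _ hq0, map_one]
  have h2 : toC q = toC (reS f) * toC (reS f) + toC (imS f) * toC (imS f) := by
    rw [hq]; simp
  rw [h2] at h1
  conv_lhs => enter [2]; rw [eq_toC_add f]
  simp only [map_mul, map_neg]
  linear_combination h1 - toC (imS f) * toC (imS f) * toC q⁻¹ * C_I_mul_C_I (σ := σ)

end Complex

section Complex

variable {σ τ : Type*} [Fintype σ] [Fintype τ] {r : σ → ℝ≥0}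

lemma wnorm_toC (f : MvPowerSeries σ ℝ) (r : σ → ℝ≥0) : wnorm (toC f) r = wnorm f r := by
  simp [wnorm]

lemma ev_toC (f : MvPowerSeries σ ℝ) (x : σ → ℝ) :
    ev (toC f) (fun i => (x i : ℂ)) = (ev f x : ℝ) := by
  rw [ev, ev, Complex.ofReal_tsum]
  refine tsum_congr fun α => ?_
  simp [mon]

lemma wnorm_reS_le (f : MvPowerSeries σ ℂ) (r : σ → ℝ≥0) : wnorm (reS f) r ≤ wnorm f r :=
  wnorm_le_of_coeff_le (fun α => Complex.abs_re_le_norm (coeff α f)) r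

lemma wnorm_imS_le (f : MvPowerSeries σ ℂ) (r : σ → ℝ≥0) : wnorm (imS f) r ≤ wnorm f r :=
  wnorm_le_of_coeff_le (fun α => Complex.abs_im_le_norm (coeff α f)) r

lemma ev_eq_reS_add {f : MvPowerSeries σ ℂ} (hf : wnorm f r ≠ ⊤) {x : σ → ℝ}
    (hx : ∀ i, ‖x i‖₊ ≤ r i) :
    ev f (fun i => (x i : ℂ)) = ⟨ev (reS f) x, ev (imS f) x⟩ := by
  have h1 : wnorm (toC (reS f)) r ≠ ⊤ := by
    rw [wnorm_toC]; exact ne_top_of_le_ne_top hf (wnorm_reS_le f r)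
  have h2 : wnorm (toC (imS f)) r ≠ ⊤ := by
    rw [wnorm_toC]; exact ne_top_of_le_ne_top hf (wnorm_imS_le f r)
  have h3 : wnorm (C Complex.I : MvPowerSeries σ ℂ) r ≠ ⊤ := by rw [wnorm_C]; simp
  have hx' : ∀ i, ‖((x i : ℝ) : ℂ)‖₊ ≤ r i := fun i => by simpa using hx i
  conv_lhs => rw [eq_toC_add f]
  rw [ev_add h1 (wnorm_mul_ne_top h3 h2) hx', ev_mul h3 h2 hx', ev_C, ev_toC, ev_toC]
  apply Complex.ext <;> simp

end Complex

/-! ### Convergence -/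

section Convergence

variable {n m : ℕ}

/-- The boxes are open, so finite radii fit strictly between |a_i| and R_i; absolute convergence at
the corner they define is finiteness of the weighted norm. -/
lemma exists_wnorm_ne_top_of_mem_domain {f : Series n} {a : Fin n → ℝ} (ha : a ∈ domain f) :
    ∃ r : Fin n → ℝ≥0, (∀ i, ‖a i‖₊ < r i) ∧ wnorm f r ≠ ⊤ := by
  obtain ⟨R, ⟨-, hR⟩, haR⟩ := Set.mem_iUnion₂.1 ha
  choose x hx1 hx2 using fun i => EReal.lt_iff_exists_real_btwn.1 (haR i)
  have hx0 : ∀ i, |a i| < x i := fun i => EReal.coe_lt_coe_iff.1 (hx1 i)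
  have hxn : ∀ i, 0 ≤ x i := fun i => (abs_nonneg _).trans (hx0 i).le
  have hs := hR x fun i => by rw [abs_of_nonneg (hxn i)]; exact hx2 i
  refine ⟨fun i => ⟨x i, hxn i⟩, fun i => hx0 i, ENNReal.tsum_coe_ne_top_iff_summable.2 ?_⟩
  rw [← NNReal.summable_coe]
  refine hs.congr fun α => ?_
  rw [term, abs_mul, NNReal.coe_mul, coe_nnnorm, Real.norm_eq_abs, Finset.abs_prod]
  congr 1
  simp only [mon, NNReal.coe_prod, abs_pow]
  exact Finset.prod_congr rfl fun i _ => by rw [abs_of_nonneg (hxn i)]; rfl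

lemma box_subset_domain {f : Series n} {r : Fin n → ℝ≥0} (hr : ∀ i, 0 < r i)
    (hf : wnorm f r ≠ ⊤) : (fun i => ((r i : ℝ) : EReal)) ∈ radii f := by
  refine ⟨fun i => EReal.coe_lt_coe_iff.2 (hr i), fun x hx => ?_⟩
  exact summable_norm_term hf fun i => (EReal.coe_lt_coe_iff.1 (hx i)).le

lemma mem_domain {f : Series n} {r : Fin n → ℝ≥0} (hf : wnorm f r ≠ ⊤) {a : Fin n → ℝ}
    (ha : ∀ i, ‖a i‖₊ < r i) : a ∈ domain f :=
  Set.mem_iUnion₂.2 ⟨_, box_subset_domain (fun i => (zero_le (a := ‖a i‖₊)).trans_lt (ha i)) hf,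
    fun i => EReal.coe_lt_coe_iff.2 (ha i)⟩

lemma isConvergent_iff {f : Series n} :
    IsConvergent f ↔ ∃ r : Fin n → ℝ≥0, (∀ i, 0 < r i) ∧ wnorm f r ≠ ⊤ := by
  constructor
  · rintro ⟨R, hR⟩
    have h0 : (0 : Fin n → ℝ) ∈ domain f :=
      Set.mem_iUnion₂.2 ⟨R, hR, fun i => by simpa using hR.1 i⟩
    obtain ⟨r, hr, hf⟩ := exists_wnorm_ne_top_of_mem_domain h0
    exact ⟨r, fun i => by simpa using hr i, hf⟩
  · rintro ⟨r, hr, hf⟩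
    exact ⟨_, box_subset_domain hr hf⟩

end Convergence

/-! ### Series converging near the origin -/

section Germs

variable {σ : Type*} [Fintype σ] {𝕜 : Type*} [RCLike 𝕜]

/-- Convergence at some positive polyradius. -/
def Conv (f : MvPowerSeries σ 𝕜) : Prop := ∃ r : σ → ℝ≥0, (∀ i, 0 < r i) ∧ wnorm f r ≠ ⊤

lemma Conv.exists_common {f g : MvPowerSeries σ 𝕜} (hf : Conv f) (hg : Conv g) :
    ∃ r : σ → ℝ≥0, (∀ i, 0 < r i) ∧ wnorm f r ≠ ⊤ ∧ wnorm g r ≠ ⊤ := by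
  obtain ⟨r, hr, hf⟩ := hf
  obtain ⟨s, hs, hg⟩ := hg
  exact ⟨fun i => min (r i) (s i), fun i => lt_min (hr i) (hs i),
    ne_top_of_le_ne_top hf (wnorm_mono f fun i => min_le_left _ _),
    ne_top_of_le_ne_top hg (wnorm_mono g fun i => min_le_right _ _)⟩

lemma Conv.add {f g : MvPowerSeries σ 𝕜} (hf : Conv f) (hg : Conv g) : Conv (f + g) := by
  obtain ⟨r, hr, h1, h2⟩ := hf.exists_common hg
  exact ⟨r, hr, wnorm_add_ne_top h1 h2⟩

lemma Conv.neg {f : MvPowerSeries σ 𝕜} (hf : Conv f) : Conv (-f) := by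
  obtain ⟨r, hr, h⟩ := hf
  exact ⟨r, hr, by rwa [wnorm_neg]⟩

lemma Conv.sub {f g : MvPowerSeries σ 𝕜} (hf : Conv f) (hg : Conv g) : Conv (f - g) := by
  rw [sub_eq_add_neg]; exact hf.add hg.neg

lemma Conv.mul {f g : MvPowerSeries σ 𝕜} (hf : Conv f) (hg : Conv g) : Conv (f * g) := by
  obtain ⟨r, hr, h1, h2⟩ := hf.exists_common hg
  exact ⟨r, hr, wnorm_mul_ne_top h1 h2⟩

lemma conv_C (c : 𝕜) : Conv (C c : MvPowerSeries σ 𝕜) :=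
  ⟨1, fun _ => one_pos, by rw [wnorm_C]; simp⟩

lemma conv_X (i : σ) : Conv (X i : MvPowerSeries σ 𝕜) :=
  ⟨1, fun _ => one_pos, by rw [wnorm_X]; simp⟩

lemma Conv.inv {f : MvPowerSeries σ 𝕜} (hf : Conv f) (h0 : constantCoeff f ≠ 0) : Conv f⁻¹ := by
  obtain ⟨r, hr, hf⟩ := hf
  obtain ⟨t, ht, -, h⟩ := exists_wnorm_lt (f := f - C (constantCoeff f)) (r := r)
    (wnorm_sub_ne_top hf (by rw [wnorm_C]; simp)) (by simp)
    (ε := ‖constantCoeff f‖₊) (by simpa using h0)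
  exact ⟨_, fun i => mul_pos ht (hr i), wnorm_inv_ne_top h⟩

lemma eventually_nnnorm_le {r : σ → ℝ≥0} (hr : ∀ i, 0 < r i) :
    ∀ᶠ x : σ → 𝕜 in 𝓝 0, ∀ i, ‖x i‖₊ ≤ r i := by
  refine eventually_all.2 fun i => ?_
  have : Tendsto (fun x : σ → 𝕜 => ‖x i‖₊) (𝓝 0) (𝓝 0) := by
    have h : Continuous fun x : σ → 𝕜 => ‖x i‖₊ := by fun_prop
    simpa using h.tendsto 0
  exact (this.eventually (gt_mem_nhds (hr i))).mono fun _ => le_of_lt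

lemma Conv.continuousAt {f : MvPowerSeries σ 𝕜} (hf : Conv f) : ContinuousAt (ev f) 0 := by
  obtain ⟨r, hr, hf⟩ := hf
  exact (continuousOn_ev hf).continuousAt (eventually_nnnorm_le hr)

lemma ev_at_zero (f : MvPowerSeries σ 𝕜) : ev f 0 = constantCoeff f := by
  rw [ev, tsum_eq_single 0]
  · simp [mon_zero]
  · intro α hα
    obtain ⟨i, hi⟩ := Finsupp.ne_iff.1 hα
    rw [mon, Finset.prod_eq_zero (Finset.mem_univ i), mul_zero]
    simpa using hi

lemma tendsto_ofReal {σ : Type*} : Tendsto (fun (x : σ → ℝ) (i : σ) => ((x i : ℝ) : 𝕜)) (𝓝 0) (𝓝 0) := by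
  have h : Continuous fun (x : σ → ℝ) (i : σ) => ((x i : ℝ) : 𝕜) := by fun_prop
  have := h.tendsto 0
  simpa [funext_iff, Pi.zero_def] using this

/-- The form of the identity theorem used below: formal identities, and with them memberships, are
checked by comparing values near the origin. -/
lemma Conv.eq_of_eventually {f g : MvPowerSeries σ 𝕜} (hf : Conv f) (hg : Conv g)
    (h : ∀ᶠ x : σ → ℝ in 𝓝 0, ev f (fun i => (x i : 𝕜)) = ev g (fun i => (x i : 𝕜))) : f = g := by
  obtain ⟨r, hr, h1, h2⟩ := hf.exists_common hg
  refine sub_eq_zero.1 (eq_zero_of_eventually_ev_eq_zero hr (wnorm_sub_ne_top h1 h2) ?_)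
  filter_upwards [h, (tendsto_ofReal (𝕜 := 𝕜)).eventually (eventually_nnnorm_le hr)] with x hx hxr
  rw [ev_sub h1 h2 hxr, hx, sub_self]

lemma Conv.eq_of_eventually_real {f g : MvPowerSeries σ ℝ} (hf : Conv f) (hg : Conv g)
    (h : ∀ᶠ x : σ → ℝ in 𝓝 0, ev f x = ev g x) : f = g :=
  hf.eq_of_eventually hg (by simpa using h)

lemma Conv.eq_of_eventually_complex {f g : MvPowerSeries σ ℂ} (hf : Conv f) (hg : Conv g)
    (h : ∀ᶠ x : σ → ℝ in 𝓝 0, ev f (fun i => (x i : ℂ)) = ev g (fun i => (x i : ℂ))) : f = g :=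
  hf.eq_of_eventually hg h

lemma Conv.toC {f : MvPowerSeries σ ℝ} (hf : Conv f) : Conv (toC f) := by
  obtain ⟨r, hr, h⟩ := hf
  exact ⟨r, hr, by rwa [wnorm_toC]⟩

lemma Conv.reS {f : MvPowerSeries σ ℂ} (hf : Conv f) : Conv (reS f) := by
  obtain ⟨r, hr, h⟩ := hf
  exact ⟨r, hr, ne_top_of_le_ne_top h (wnorm_reS_le f r)⟩

lemma Conv.imS {f : MvPowerSeries σ ℂ} (hf : Conv f) : Conv (imS f) := by
  obtain ⟨r, hr, h⟩ := hf
  exact ⟨r, hr, ne_top_of_le_ne_top h (wnorm_imS_le f r)⟩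

lemma Conv.of_reS_imS {f : MvPowerSeries σ ℂ} (h1 : Conv (ConvergentSeries.reS f))
    (h2 : Conv (ConvergentSeries.imS f)) : Conv f := by
  rw [eq_toC_add f]
  exact h1.toC.add ((conv_C _).mul h2.toC)

end Germs

/-! ### Complexification -/

section Complexify

variable {n : ℕ}

lemma complexify_eq_tsubst (f : Series n) :
    complexify f = tsubst (toC f) fun j => X (reIdx j) + C Complex.I * X (imIdx j) :=
  subst_eq_tsubst _ (hasSubst_of_constantCoeff_zero fun j => by simp)

lemma wnorm_complexify_le (f : Series n) {r : Fin n → ℝ≥0} {s : Fin (2 * n) → ℝ≥0}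
    (h : ∀ j, s (reIdx j) + s (imIdx j) ≤ r j) : wnorm (complexify f) s ≤ wnorm f r := by
  rw [complexify_eq_tsubst, ← wnorm_toC f]
  refine wnorm_tsubst_le _ fun j => (wnorm_add_le _ _ _).trans ?_
  refine (add_le_add le_rfl (wnorm_mul_le _ _ _)).trans ?_
  rw [wnorm_X, wnorm_X, wnorm_C]
  simpa using (by exact_mod_cast h j : ((s (reIdx j) : ℝ≥0∞) + s (imIdx j) ≤ r j))

lemma ev_complexify {f : Series n} {r : Fin n → ℝ≥0} (hf : wnorm f r ≠ ⊤)
    {s : Fin (2 * n) → ℝ≥0} (h : ∀ j, s (reIdx j) + s (imIdx j) ≤ r j) {x : Fin (2 * n) → ℂ}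
    (hx : ∀ i, ‖x i‖₊ ≤ s i) :
    ev (complexify f) x = ev (toC f) fun j => x (reIdx j) + Complex.I * x (imIdx j) := by
  have hI : ∀ j : Fin n, wnorm (C Complex.I * X (imIdx j) : MvPowerSeries (Fin (2 * n)) ℂ) s
      ≤ s (imIdx j) := fun j => by
    refine (wnorm_mul_le _ _ _).trans ?_
    rw [wnorm_X, wnorm_C]
    simp
  rw [complexify_eq_tsubst, ev_tsubst (r := r) (by rwa [wnorm_toC]) (s := s) (fun j => ?_) hx]
  · congr 1
    ext j
    rw [ev_add (r := s) (by rw [wnorm_X]; simp) (ne_top_of_le_ne_top ENNReal.coe_ne_top (hI j)) hx,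
      ev_mul (r := s) (by rw [wnorm_C]; simp) (by rw [wnorm_X]; simp) hx, ev_X, ev_X, ev_C]
  · refine (wnorm_add_le _ _ _).trans ((add_le_add (wnorm_X _ _).le (hI j)).trans ?_)
    exact_mod_cast h j

end Complexify

/-! ### Presystems -/

section Presystem

variable {W : Collection} {n m : ℕ}

namespace IsPresystem

lemma conv (hW : IsPresystem W) {f : Series n} (hf : f ∈ W n) : Conv f :=
  isConvergent_iff.1 (hW.convergent n f hf)

lemma add_mem (hW : IsPresystem W) {f g : Series n} (hf : f ∈ W n) (hg : g ∈ W n) :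
    f + g ∈ W n := by
  obtain ⟨A, hA⟩ := hW.subring n
  rw [← hA] at hf hg ⊢; exact A.add_mem hf hg

lemma mul_mem (hW : IsPresystem W) {f g : Series n} (hf : f ∈ W n) (hg : g ∈ W n) :
    f * g ∈ W n := by
  obtain ⟨A, hA⟩ := hW.subring n
  rw [← hA] at hf hg ⊢; exact A.mul_mem hf hg

lemma neg_mem (hW : IsPresystem W) {f : Series n} (hf : f ∈ W n) : -f ∈ W n := by
  obtain ⟨A, hA⟩ := hW.subring n
  rw [← hA] at hf ⊢; exact A.neg_mem hf

lemma sub_mem (hW : IsPresystem W) {f g : Series n} (hf : f ∈ W n) (hg : g ∈ W n) :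
    f - g ∈ W n := by
  rw [sub_eq_add_neg]; exact hW.add_mem hf (hW.neg_mem hg)

lemma zero_mem (hW : IsPresystem W) (n : ℕ) : (0 : Series n) ∈ W n := by
  obtain ⟨A, hA⟩ := hW.subring n
  rw [← hA]; exact A.zero_mem

lemma natCast_mem (hW : IsPresystem W) (n k : ℕ) : (k : Series n) ∈ W n := by
  obtain ⟨A, hA⟩ := hW.subring n
  rw [← hA]; exact _root_.natCast_mem A k

lemma intCast_mem (hW : IsPresystem W) (n : ℕ) (k : ℤ) : (k : Series n) ∈ W n := by
  obtain ⟨A, hA⟩ := hW.subring n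
  rw [← hA]; exact _root_.intCast_mem A k

/-- Any injection of variables is the standard inclusion followed by a permutation, so the two
presystem axioms on variables give all injective renamings. -/
lemma exists_perm_comp_castLE {j : Fin n → Fin m} (hj : Function.Injective j) :
    ∃ (h : n ≤ m) (σ : Equiv.Perm (Fin m)), ⇑σ ∘ Fin.castLE h = j := by
  have h : n ≤ m := by simpa using Fintype.card_le_of_injective j hj
  obtain ⟨σ, hσ⟩ := Equiv.Perm.exists_extending_pair (Fin.castLE h) j
    (Fin.castLE_injective h) hj
  exact ⟨h, σ, funext hσ⟩

lemma rename_castLE_mem_iff (hW : IsPresystem W) (h : n ≤ m) {f : Series n} (hf : Conv f) :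
    f ∈ W n ↔ MvPowerSeries.rename (Fin.castLE h) f ∈ W m := by
  induction m, h using Nat.le_induction with
  | base =>
    simp
  | succ m h ih =>
    have hc : IsConvergent (MvPowerSeries.rename (Fin.castLE h) f) := by
      obtain ⟨r, hr, hf⟩ := hf
      refine isConvergent_iff.2 ⟨fun i => if h : (i : ℕ) < n then r ⟨i, h⟩ else 1, fun i => ?_,
        ne_top_of_le_ne_top hf ((wnorm_rename_le _ f).trans (le_of_eq ?_))⟩
      · simp only
        split_ifs
        exacts [hr _, one_pos]
      · simp
    rw [ih, hW.inter m _ hc, rename_rename]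
    rfl

lemma rename_mem (hW : IsPresystem W) {j : Fin n → Fin m} (hj : Function.Injective j)
    {f : Series n} (hf : f ∈ W n) : MvPowerSeries.rename j f ∈ W m := by
  obtain ⟨h, σ, rfl⟩ := exists_perm_comp_castLE hj
  rw [← rename_rename]
  exact hW.perm m _ ((hW.rename_castLE_mem_iff h (hW.conv hf)).1 hf) σ

lemma mem_of_rename_mem (hW : IsPresystem W) {j : Fin n → Fin m} (hj : Function.Injective j)
    {f : Series n} (hf : Conv f) (h : MvPowerSeries.rename j f ∈ W m) : f ∈ W n := by
  obtain ⟨hnm, σ, rfl⟩ := exists_perm_comp_castLE hj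
  refine (hW.rename_castLE_mem_iff hnm hf).2 ?_
  rw [← rename_rename] at h
  have := hW.perm m _ h σ.symm
  rwa [show MvPowerSeries.rename σ.symm (MvPowerSeries.rename σ _) = _ from
    (renameEquiv ℝ σ).symm_apply_apply _] at this

lemma C_mem (hW : IsPresystem W) {c : ℝ} (hc : c ∈ coeffField W) (n : ℕ) :
    (C c : Series n) ∈ W n := by
  have := hW.rename_mem (j := (Fin.elim0 : Fin 0 → Fin n)) (fun i => i.elim0) hc
  rwa [rename_C] at this

lemma mem_of_eventually (hW : IsPresystem W) {f g : Series n} (hf : Conv f) (hg : g ∈ W n)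
    (h : ∀ᶠ x : Fin n → ℝ in 𝓝 0, ev f x = ev g x) : f ∈ W n := by
  rwa [hf.eq_of_eventually_real (hW.conv hg) h]

end IsPresystem

end Presystem

/-! ### The intermediate notion of system and its complex series -/

/-- The closure properties shared by convergent Analysis systems and integrated algebraic series:
presystems containing the variables that are closed under inverses, translation to rational
points, restriction, and antiderivatives. -/
structure IsRatSystem (W : Collection) : Prop extends IsPresystem W where
  X_mem : ∀ n, ∀ i : Fin n, (X i : Series n) ∈ W n
  inv_mem : ∀ n, ∀ f ∈ W n, constantCoeff f ≠ 0 → f⁻¹ ∈ W n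
  ratTranslation_mem : ∀ n, ∀ f ∈ W n, ∀ a : Fin n → ℚ, (fun i => (a i : ℝ)) ∈ domain f →
    translation f (fun i => (a i : ℝ)) ∈ W n
  restrict_mem : ∀ n, ∀ f ∈ W (n + 1),
    MvPowerSeries.killCompl (Fin.castSuccEmb : Fin n ↪ Fin (n + 1)) f ∈ W n
  antideriv_mem : ∀ n, ∀ f ∈ W (n + 1), antideriv (Fin.last n) f ∈ W (n + 1)

/-- Systems as in `IsRatSystem` that are closed under real and imaginary parts. -/
structure IsRatAnalysisSystem (W : Collection) : Prop extends IsRatSystem W where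
  rePart_mem : ∀ n, ∀ f ∈ W (n + 1), rePart f ∈ W (2 * (n + 1))
  imPart_mem : ∀ n, ∀ f ∈ W (n + 1), imPart f ∈ W (2 * (n + 1))

section

variable {W : Collection} {n m : ℕ}

lemma killCompl_rename_perm {σ τ : Type*} [Finite τ] (e : σ ↪ τ) (π : Equiv.Perm τ)
    (f : MvPowerSeries τ ℝ) :
    killCompl e (rename π f) = killCompl (e.trans π.symm.toEmbedding) f := by
  ext α
  rw [coeff_killCompl, coeff_killCompl]
  have h : rename (π : τ → τ) f = rename π.toEmbedding f := rfl
  have h2 : α.embDomain e = (α.embDomain (e.trans π.symm.toEmbedding)).embDomain π.toEmbedding := by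
    rw [← Finsupp.embDomain_trans_apply]
    congr 1
    ext i
    simp
  rw [h, h2, coeff_embDomain_rename]

lemma killCompl_trans {σ τ υ : Type*} (e : σ ↪ τ) (e' : τ ↪ υ) (f : MvPowerSeries υ ℝ) :
    killCompl e (killCompl e' f) = killCompl (e.trans e') f := by
  ext α
  rw [coeff_killCompl, coeff_killCompl, coeff_killCompl, ← Finsupp.embDomain_trans_apply]

lemma coeff_antid {σ : Type*} (i : σ) (f : MvPowerSeries σ ℝ) (α : σ →₀ ℕ) :
    coeff α (antid i f) =
      if α i = 0 then 0 else coeff (α - Finsupp.single i 1) f / (α i : ℝ) := rfl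

lemma rename_perm_antid {σ : Type*} [Finite σ] (π : Equiv.Perm σ) (i : σ)
    (f : MvPowerSeries σ ℝ) : rename π (antid i f) = antid (π i) (rename π f) := by
  classical
  ext α
  have h : ∀ f : MvPowerSeries σ ℝ, rename (π : σ → σ) f = rename π.toEmbedding f := fun _ => rfl
  obtain ⟨β, rfl⟩ : ∃ β : σ →₀ ℕ, β.embDomain π.toEmbedding = α :=
    (Finsupp.mem_range_embDomain_iff _ _).2 (by simp)
  have h1 : (β.embDomain π.toEmbedding) (π i) = β i :=
    Finsupp.embDomain_apply_self π.toEmbedding β i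
  have h2 : β.embDomain π.toEmbedding - Finsupp.single (π i) 1 =
      (β - Finsupp.single i 1).embDomain π.toEmbedding := by
    ext k
    obtain ⟨j, rfl⟩ := π.surjective k
    have h3 : ∀ γ : σ →₀ ℕ, (γ.embDomain π.toEmbedding) (π j) = γ j :=
      fun γ => Finsupp.embDomain_apply_self π.toEmbedding γ j
    rw [Finsupp.tsub_apply, h3, h3, Finsupp.tsub_apply]
    simp [Finsupp.single_apply]
  rw [h, coeff_embDomain_rename, coeff_antid, coeff_antid, h1, h2, h, coeff_embDomain_rename]

namespace IsRatSystem

lemma one_mem (hW : IsRatSystem W) (n : ℕ) : (1 : Series n) ∈ W n := by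
  simpa using hW.natCast_mem n 1

lemma ratCast_mem (hW : IsRatSystem W) (n : ℕ) (q : ℚ) : (C (q : ℝ) : Series n) ∈ W n := by
  have h : (C (q : ℝ) : Series n) = (q.num : Series n) * (q.den : Series n)⁻¹ := by
    rw [← map_natCast (C (σ := Fin n) (R := ℝ)), C_inv, ← map_intCast (C (σ := Fin n) (R := ℝ)),
      ← map_mul]
    congr 1
    rw [← div_eq_mul_inv]
    exact_mod_cast (Rat.num_div_den q).symm
  rw [h]
  exact hW.mul_mem (hW.intCast_mem n _) (hW.inv_mem n _ (hW.natCast_mem n _) (by simp))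

lemma ratCast_mem_coeffField (hW : IsRatSystem W) (q : ℚ) : (q : ℝ) ∈ coeffField W :=
  hW.ratCast_mem 0 q

lemma killCompl_castLE_mem (hW : IsRatSystem W) (h : n ≤ m) {f : Series m} (hf : f ∈ W m) :
    killCompl (Fin.castLEEmb h) f ∈ W n := by
  induction m, h using Nat.le_induction with
  | base =>
    convert hf using 1
    refine MvPowerSeries.ext fun α => ?_
    rw [coeff_killCompl]
    congr 2
    exact Finsupp.ext fun i => Finsupp.embDomain_apply_self (Fin.castLEEmb le_rfl) α i
  | succ m h ih =>
    have := ih (hW.restrict_mem m f hf)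
    rw [killCompl_trans] at this
    exact this

lemma killCompl_mem (hW : IsRatSystem W) (e : Fin n ↪ Fin m) {f : Series m}
    (hf : f ∈ W m) : killCompl e f ∈ W n := by
  obtain ⟨h, π, hπ⟩ := IsPresystem.exists_perm_comp_castLE e.injective
  have := hW.killCompl_castLE_mem h (hW.perm m f hf π.symm)
  rw [killCompl_rename_perm] at this
  convert this using 3
  exact Function.Embedding.ext fun i => (congrFun hπ i).symm

/-- Only the last variable can be integrated by hypothesis; the others are reached by conjugating
with a transposition. -/
lemma antid_mem (hW : IsRatSystem W) (i : Fin n) {f : Series n} (hf : f ∈ W n) :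
    antid i f ∈ W n := by
  cases n with
  | zero => exact i.elim0
  | succ n =>
    have h := hW.antideriv_mem n _ (hW.perm _ f hf (Equiv.swap i (Fin.last n)))
    have h2 := hW.perm _ _ h (Equiv.swap i (Fin.last n))
    change rename _ (antid (Fin.last n) _) ∈ _ at h2
    rw [rename_perm_antid, Equiv.swap_apply_right] at h2
    convert h2 using 2
    have := (renameEquiv ℝ (Equiv.swap i (Fin.last n))).symm_apply_apply f
    rw [renameEquiv_symm, Equiv.symm_swap] at this
    exact this.symm

lemma transl_mem (hW : IsRatSystem W) {f : Series n} (hf : f ∈ W n) {r : Fin n → ℝ≥0}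
    (hr : wnorm f r ≠ ⊤) {a : Fin n → ℝ} (ha : ∀ i, ‖a i‖₊ < r i) (hq : ∀ i, ∃ q : ℚ, (q : ℝ) = a i) :
    transl a f ∈ W n := by
  choose q hq using hq
  obtain rfl : (fun i => (q i : ℝ)) = a := funext hq
  exact hW.ratTranslation_mem n f hf q (mem_domain hr ha)

end IsRatSystem

/-- Complex power series whose real and imaginary parts belong to a collection. -/
def MemC (W : Collection) (g : MvPowerSeries (Fin n) ℂ) : Prop := reS g ∈ W n ∧ imS g ∈ W n

namespace MemC

variable {f g : MvPowerSeries (Fin n) ℂ}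

lemma conv (hW : IsPresystem W) (hf : MemC W f) : Conv f :=
  Conv.of_reS_imS (hW.conv hf.1) (hW.conv hf.2)

lemma add (hW : IsPresystem W) (hf : MemC W f) (hg : MemC W g) : MemC W (f + g) :=
  ⟨reS_add f g ▸ hW.add_mem hf.1 hg.1, imS_add f g ▸ hW.add_mem hf.2 hg.2⟩

lemma neg (hW : IsPresystem W) (hf : MemC W f) : MemC W (-f) :=
  ⟨reS_neg f ▸ hW.neg_mem hf.1, imS_neg f ▸ hW.neg_mem hf.2⟩

lemma sub (hW : IsPresystem W) (hf : MemC W f) (hg : MemC W g) : MemC W (f - g) := by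
  rw [sub_eq_add_neg]; exact hf.add hW (hg.neg hW)

lemma mul (hW : IsPresystem W) (hf : MemC W f) (hg : MemC W g) : MemC W (f * g) :=
  ⟨reS_mul f g ▸ hW.sub_mem (hW.mul_mem hf.1 hg.1) (hW.mul_mem hf.2 hg.2),
    imS_mul f g ▸ hW.add_mem (hW.mul_mem hf.1 hg.2) (hW.mul_mem hf.2 hg.1)⟩

lemma toC (hW : IsPresystem W) {f : Series n} (hf : f ∈ W n) : MemC W (toC f) :=
  ⟨by rwa [reS_toC], by rw [imS_toC]; exact hW.zero_mem n⟩

lemma const (hW : IsPresystem W) {c : ℂ} (h1 : c.re ∈ coeffField W) (h2 : c.im ∈ coeffField W) :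
    MemC W (C c : MvPowerSeries (Fin n) ℂ) :=
  ⟨by rw [reS_C]; exact hW.C_mem h1 n, by rw [imS_C]; exact hW.C_mem h2 n⟩

lemma C_I (hW : IsRatSystem W) : MemC W (C Complex.I : MvPowerSeries (Fin n) ℂ) :=
  const hW.toIsPresystem (by simpa using hW.ratCast_mem_coeffField 0)
    (by simpa using hW.ratCast_mem_coeffField 1)

lemma inv (hW : IsRatSystem W) (hf : MemC W f) (h : constantCoeff f ≠ 0) : MemC W f⁻¹ := by
  have hP := hW.toIsPresystem
  obtain ⟨h0, h1⟩ := inv_eq_toC_add h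
  have h2 := hW.inv_mem n _ (hP.add_mem (hP.mul_mem hf.1 hf.1) (hP.mul_mem hf.2 hf.2)) h0
  rw [h1]
  refine ⟨?_, ?_⟩
  · rw [reS_toC_add]; exact hP.mul_mem hf.1 h2
  · rw [imS_toC_add]; exact hP.neg_mem (hP.mul_mem hf.2 h2)

lemma killCompl (hW : IsRatSystem W) (e : Fin m ↪ Fin n) (hf : MemC W f) :
    MemC W (killCompl e f) :=
  ⟨hW.killCompl_mem e hf.1, hW.killCompl_mem e hf.2⟩

lemma antid (hW : IsRatSystem W) (i : Fin n) (hf : MemC W f) : MemC W (antid i f) := by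
  have h : ∀ c : ℂ, ∀ k : ℕ, (c / k).re = c.re / k ∧ (c / k).im = c.im / k := fun c k =>
    ⟨Complex.div_natCast_re c k, Complex.div_natCast_im c k⟩
  constructor
  · convert hW.antid_mem i hf.1 using 1
    ext α
    change (if _ then (0 : ℂ) else _).re = if _ then (0 : ℝ) else _
    split_ifs
    exacts [rfl, (h _ _).1]
  · convert hW.antid_mem i hf.2 using 1
    ext α
    change (if _ then (0 : ℂ) else _).im = if _ then (0 : ℝ) else _
    split_ifs
    exacts [rfl, (h _ _).2]

lemma of_eventually (hW : IsPresystem W) (hf : Conv f) (hg : MemC W g)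
    (h : ∀ᶠ x : Fin n → ℝ in 𝓝 0, ev f (fun i => (x i : ℂ)) = ev g (fun i => (x i : ℂ))) :
    MemC W f := by
  rwa [hf.eq_of_eventually_complex (hg.conv hW) h]

/-- Translation to a real point commutes with taking real and imaginary parts, because both sides
have the same values at real points. -/
lemma _root_.ConvergentSeries.transl_eq_toC_add {f : MvPowerSeries (Fin n) ℂ} {r : Fin n → ℝ≥0}
    (hr : wnorm f r ≠ ⊤) {a : Fin n → ℝ} (ha : ∀ i, ‖a i‖₊ < r i) :
    transl (fun i => (a i : ℂ)) f =
      ConvergentSeries.toC (transl a (reS f)) +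
        C Complex.I * ConvergentSeries.toC (transl a (imS f)) := by
  set s : Fin n → ℝ≥0 := fun i => r i - ‖a i‖₊ with hs
  have hs0 : ∀ i, 0 < s i := fun i => tsub_pos_of_lt (ha i)
  have hsr : ∀ i, s i + ‖a i‖₊ ≤ r i := fun i => (tsub_add_cancel_of_le (ha i).le).le
  have hsr' : ∀ i, s i + ‖((a i : ℝ) : ℂ)‖₊ ≤ r i := fun i => by
    rw [Complex.nnnorm_real]; exact hsr i
  have hre := ne_top_of_le_ne_top hr (wnorm_reS_le f r)
  have him := ne_top_of_le_ne_top hr (wnorm_imS_le f r)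
  have c1 : Conv (transl (fun i => (a i : ℂ)) f) :=
    ⟨s, hs0, ne_top_of_le_ne_top hr (wnorm_transl_le _ f hsr')⟩
  have n2 : wnorm (transl a (reS f)) s ≠ ⊤ := ne_top_of_le_ne_top hre (wnorm_transl_le _ _ hsr)
  have n3 : wnorm (transl a (imS f)) s ≠ ⊤ := ne_top_of_le_ne_top him (wnorm_transl_le _ _ hsr)
  have nI : wnorm (C Complex.I : MvPowerSeries (Fin n) ℂ) s ≠ ⊤ := by rw [wnorm_C]; simp
  refine c1.eq_of_eventually_complex (Conv.add (Conv.toC ⟨s, hs0, n2⟩)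
    ((conv_C _).mul (Conv.toC ⟨s, hs0, n3⟩))) ?_
  filter_upwards [eventually_nnnorm_le (𝕜 := ℝ) hs0] with x hx
  have hx' : ∀ i, ‖((x i : ℝ) : ℂ)‖₊ ≤ s i := fun i => by rw [Complex.nnnorm_real]; exact hx i
  rw [← wnorm_toC] at n2 n3
  have e1 := ev_transl (fun i => (a i : ℂ)) hr hsr' hx'
  have e2 : ev f (fun i => ((x i + a i : ℝ) : ℂ)) = _ := ev_eq_reS_add hr (x := fun i => x i + a i)
    fun i => (nnnorm_add_le _ _).trans ((add_le_add_left (hx i) _).trans (hsr i))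
  push_cast at e2
  rw [e1, e2, ev_add n2 (wnorm_mul_ne_top nI n3) hx', ev_mul nI n3 hx', ev_C,
    ev_toC, ev_toC, ev_transl a hre hsr hx, ev_transl a him hsr hx]
  apply Complex.ext <;> simp

lemma transl (hW : IsRatSystem W) (hf : MemC W f) {r : Fin n → ℝ≥0}
    (hr : wnorm f r ≠ ⊤) {a : Fin n → ℝ} (ha : ∀ i, ‖a i‖₊ < r i) (hq : ∀ i, ∃ q : ℚ, (q : ℝ) = a i) :
    MemC W (transl (fun i => (a i : ℂ)) f) := by
  rw [transl_eq_toC_add hr ha]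
  refine ⟨?_, ?_⟩
  · rw [reS_toC_add]
    exact hW.transl_mem hf.1 (ne_top_of_le_ne_top hr (wnorm_reS_le f r)) ha hq
  · rw [imS_toC_add]
    exact hW.transl_mem hf.2 (ne_top_of_le_ne_top hr (wnorm_imS_le f r)) ha hq

end MemC

end

/-! ### Tuples of variables -/

section Tuples

variable {α : Type*} {n m : ℕ}

/-- Appending an entry to a tuple. -/
def vsnoc (x : Fin n → α) (a : α) : Fin (n + 1) → α := Fin.snoc (α := fun _ => α) x a

@[simp] lemma vsnoc_castSucc (x : Fin n → α) (a : α) (j : Fin n) : vsnoc x a j.castSucc = x j :=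
  Fin.snoc_castSucc (α := fun _ => α) a x j

@[simp] lemma vsnoc_last (x : Fin n → α) (a : α) : vsnoc x a (Fin.last n) = a :=
  Fin.snoc_last (α := fun _ => α) a x

lemma forall_fin_succ_iff {P : Fin (n + 1) → Prop} :
    (∀ i, P i) ↔ (∀ j : Fin n, P j.castSucc) ∧ P (Fin.last n) :=
  ⟨fun h => ⟨fun _ => h _, h _⟩, fun h i => Fin.lastCases h.2 h.1 i⟩

lemma comp_vsnoc {β : Type*} (φ : α → β) (x : Fin n → α) (a : α) :
    (fun i => φ (vsnoc x a i)) = vsnoc (fun i => φ (x i)) (φ a) :=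
  funext fun i => Fin.lastCases (by simp) (by simp) i

lemma vsnoc_comp_castSucc (y : Fin (n + 1) → α) :
    vsnoc (fun j => y j.castSucc) (y (Fin.last n)) = y :=
  funext fun i => Fin.lastCases (by simp) (by simp) i

lemma update_vsnoc_last (x : Fin n → α) (a b : α) :
    Function.update (vsnoc x a) (Fin.last n) b = vsnoc x b :=
  funext fun i => Fin.lastCases (by simp) (fun j => by simp [Fin.castSucc_ne_last]) i

/-- The tuple with given entries at the positions of `X_1, …, X_m` and of `Y_1, …, Y_m`. -/
def interleave (p q : Fin m → α) : Fin (2 * m) → α := fun k =>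
  if (k : ℕ) % 2 = 0 then p ⟨k / 2, by omega⟩ else q ⟨k / 2, by omega⟩

@[simp] lemma interleave_reIdx (p q : Fin m → α) (j : Fin m) : interleave p q (reIdx j) = p j := by
  simp [interleave, reIdx]

@[simp] lemma interleave_imIdx (p q : Fin m → α) (j : Fin m) : interleave p q (imIdx j) = q j := by
  have h : (2 * (j : ℕ) + 1) / 2 = j := by omega
  simp [interleave, imIdx, h]

lemma eq_reIdx_or_eq_imIdx (k : Fin (2 * m)) : (∃ j, k = reIdx j) ∨ ∃ j, k = imIdx j := by
  rcases Nat.mod_two_eq_zero_or_one k with h | h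
  · exact Or.inl ⟨⟨k / 2, by omega⟩, Fin.ext (by simp only [reIdx]; omega)⟩
  · exact Or.inr ⟨⟨k / 2, by omega⟩, Fin.ext (by simp only [imIdx]; omega)⟩

lemma forall_fin_two_mul_iff {P : Fin (2 * m) → Prop} :
    (∀ k, P k) ↔ (∀ j : Fin m, P (reIdx j)) ∧ ∀ j : Fin m, P (imIdx j) := by
  refine ⟨fun h => ⟨fun j => h _, fun j => h _⟩, fun h k => ?_⟩
  rcases eq_reIdx_or_eq_imIdx k with ⟨j, rfl⟩ | ⟨j, rfl⟩
  exacts [h.1 j, h.2 j]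

lemma reIdx_injective : Function.Injective (reIdx : Fin m → Fin (2 * m)) := fun i j h => by
  have := congrArg Fin.val h
  simp only [reIdx] at this
  exact Fin.ext (by omega)

lemma imIdx_injective : Function.Injective (imIdx : Fin m → Fin (2 * m)) := fun i j h => by
  have := congrArg Fin.val h
  simp only [imIdx] at this
  exact Fin.ext (by omega)

lemma reIdx_ne_imIdx (i j : Fin m) : reIdx i ≠ imIdx j := fun h => by
  have := congrArg Fin.val h
  simp only [reIdx, imIdx] at this
  omega

/-- The positions of `X_1, …, X_{n+1}, Y_{n+1}` among the variables `X_1, Y_1, …`. -/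
def partialEmb (n : ℕ) : Fin (n + 2) ↪ Fin (2 * (n + 1)) :=
  ⟨vsnoc reIdx (imIdx (Fin.last n)), fun i j => by
    induction i using Fin.lastCases <;> induction j using Fin.lastCases <;>
      simp [reIdx_injective.eq_iff, reIdx_ne_imIdx, (reIdx_ne_imIdx _ _).symm]⟩

lemma partialEmb_castSucc (j : Fin (n + 1)) : partialEmb n j.castSucc = reIdx j :=
  vsnoc_castSucc _ _ j

lemma partialEmb_last : partialEmb n (Fin.last (n + 1)) = imIdx (Fin.last n) :=
  vsnoc_last _ _

lemma interleave_comp_partialEmb (p q : Fin (n + 1) → α) :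
    (fun i => interleave p q (partialEmb n i)) = vsnoc p (q (Fin.last n)) :=
  funext fun i => Fin.lastCases (by simp [partialEmb_last])
    (fun j => by simp [partialEmb_castSucc]) i

end Tuples

/-! ### Series along horizontal and vertical complex lines -/

section Line

variable {W : Collection} {n : ℕ}

/-- The complex power series `f(X', X_n + iY_n)`. -/
def complexifyLast (f : Series (n + 1)) : MvPowerSeries (Fin (n + 2)) ℂ :=
  killCompl (partialEmb n) (complexify f)

lemma memC_complexifyLast (hW : IsRatAnalysisSystem W) {f : Series (n + 1)} (hf : f ∈ W (n + 1)) :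
    MemC W (complexifyLast f) :=
  MemC.killCompl hW.toIsRatSystem _ ⟨hW.rePart_mem n f hf, hW.imPart_mem n f hf⟩

variable {f : Series (n + 1)} {r : Fin n → ℝ≥0} {R u v : ℝ≥0}

lemma interleave_add_le (huv : u + v ≤ R) (j : Fin (n + 1)) :
    interleave (vsnoc r u) (vsnoc 0 v) (reIdx j) + interleave (vsnoc r u) (vsnoc 0 v) (imIdx j) ≤
      vsnoc r R j := by
  induction j using Fin.lastCases with
  | last => simpa using huv
  | cast j => simp

lemma wnorm_complexifyLast_ne_top (hf : wnorm f (vsnoc r R) ≠ ⊤) (huv : u + v ≤ R) :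
    wnorm (complexifyLast f) (vsnoc (vsnoc r u) v) ≠ ⊤ := by
  refine ne_top_of_le_ne_top hf (le_trans ?_ (wnorm_complexify_le f (interleave_add_le huv)))
  have := wnorm_killCompl_le (partialEmb n) (complexify f) (interleave (vsnoc r u) (vsnoc 0 v))
  rwa [interleave_comp_partialEmb, vsnoc_last] at this

lemma ev_complexifyLast (hf : wnorm f (vsnoc r R) ≠ ⊤) (huv : u + v ≤ R) {x : Fin n → ℂ}
    {a b : ℂ} (hx : ∀ i, ‖x i‖₊ ≤ r i) (ha : ‖a‖₊ ≤ u) (hb : ‖b‖₊ ≤ v) :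
    ev (complexifyLast f) (vsnoc (vsnoc x a) b) = ev (toC f) (vsnoc x (a + Complex.I * b)) := by
  have h1 := ev_killCompl (partialEmb n) (complexify f) (interleave (vsnoc x a) (vsnoc 0 b)) ?_
  · rw [interleave_comp_partialEmb, vsnoc_last] at h1
    rw [complexifyLast, h1, ev_complexify hf (interleave_add_le huv)]
    · congr 1
      ext j
      induction j using Fin.lastCases <;> simp
    · rw [forall_fin_two_mul_iff]
      simp [forall_fin_succ_iff, hx, ha, hb]
  · rw [forall_fin_two_mul_iff]
    refine ⟨fun j hj => absurd ⟨j.castSucc, partialEmb_castSucc j⟩ hj, fun j hj => ?_⟩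
    induction j using Fin.lastCases with
    | last => exact absurd ⟨_, partialEmb_last⟩ hj
    | cast j => simp

/-- The power series `f(X', p + dX_n)`. -/
def lineSeries (f : Series (n + 1)) (p d : ℂ) : MvPowerSeries (Fin (n + 1)) ℂ :=
  tsubst (toC f) (vsnoc (fun j => X j.castSucc) (C p + C d * X (Fin.last n)))

lemma wnorm_C_add_C_mul_X_le {p d : ℂ} {s : ℝ≥0} (h : ‖p‖₊ + ‖d‖₊ * s ≤ R) (i : Fin (n + 1)) :
    wnorm (vsnoc (fun j => X j.castSucc) (C p + C d * X (Fin.last n)) i :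
      MvPowerSeries (Fin (n + 1)) ℂ) (vsnoc r s) ≤ vsnoc r R i := by
  induction i using Fin.lastCases with
  | last =>
    rw [vsnoc_last, vsnoc_last]
    refine (wnorm_add_le _ _ _).trans ((add_le_add le_rfl (wnorm_mul_le _ _ _)).trans ?_)
    rw [wnorm_C, wnorm_C, wnorm_X, vsnoc_last]
    exact_mod_cast h
  | cast j => simp [wnorm_X]

lemma wnorm_lineSeries_le (f : Series (n + 1)) {p d : ℂ} {s : ℝ≥0} (h : ‖p‖₊ + ‖d‖₊ * s ≤ R) :
    wnorm (lineSeries f p d) (vsnoc r s) ≤ wnorm f (vsnoc r R) := by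
  rw [← wnorm_toC f]
  exact wnorm_tsubst_le _ (wnorm_C_add_C_mul_X_le h)

lemma ev_lineSeries (hf : wnorm f (vsnoc r R) ≠ ⊤) {p d : ℂ} {s : ℝ≥0}
    (h : ‖p‖₊ + ‖d‖₊ * s ≤ R) {x : Fin n → ℂ} {t : ℂ} (hx : ∀ i, ‖x i‖₊ ≤ r i) (ht : ‖t‖₊ ≤ s) :
    ev (lineSeries f p d) (vsnoc x t) = ev (toC f) (vsnoc x (p + d * t)) := by
  rw [← wnorm_toC] at hf
  have hxt : ∀ i, ‖vsnoc x t i‖₊ ≤ vsnoc r s i := by simp [forall_fin_succ_iff, hx, ht]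
  rw [lineSeries, ev_tsubst hf (wnorm_C_add_C_mul_X_le h) hxt]
  congr 1
  ext i
  induction i using Fin.lastCases with
  | last =>
    have h1 : wnorm (X (Fin.last n) : MvPowerSeries (Fin (n + 1)) ℂ) (vsnoc r s) ≠ ⊤ := by
      rw [wnorm_X]; simp
    have h2 : ∀ c : ℂ, wnorm (C c : MvPowerSeries (Fin (n + 1)) ℂ) (vsnoc r s) ≠ ⊤ := by
      intro c; rw [wnorm_C]; simp
    simp only [vsnoc_last]
    rw [ev_add (h2 p) (wnorm_mul_ne_top (h2 d) h1) hxt, ev_mul (h2 d) h1 hxt, ev_C, ev_C, ev_X,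
      vsnoc_last]
  | cast j => simp [ev_X]

/-- Translating f(X', X_n + iY_n) to the rational point (0, a, b) gives f(X', p + X_n + iY_n) with p
= a + ib. Setting Y_n = 0 yields direction 1, and setting X_n = 0 yields direction i. The radius |a|
+ s for X_n and |b| + s for Y_n explains the norm hypothesis. -/
lemma memC_lineSeries (hW : IsRatAnalysisSystem W) (hf : f ∈ W (n + 1)) (hr : ∀ i, 0 < r i)
    {a b : ℚ} {s : ℝ≥0} (hs : 0 < s)
    (hfR : wnorm f (vsnoc r ((‖(a : ℝ)‖₊ + s) + (‖(b : ℝ)‖₊ + s))) ≠ ⊤) {d : ℂ}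
    (hd : d = 1 ∨ d = Complex.I) :
    MemC W (lineSeries f ((a : ℝ) + Complex.I * (b : ℝ)) d) := by
  have hd1 : ‖d‖₊ = 1 := by rcases hd with rfl | rfl <;> simp
  have hp : ‖((a : ℝ) : ℂ) + Complex.I * ((b : ℝ) : ℂ)‖₊ + ‖d‖₊ * s ≤
      (‖(a : ℝ)‖₊ + s) + (‖(b : ℝ)‖₊ + s) := by
    rw [hd1, one_mul, ← Complex.nnnorm_real (a : ℝ), ← Complex.nnnorm_real (b : ℝ)]
    refine (add_le_add_left (nnnorm_add_le _ _) s).trans ?_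
    rw [nnnorm_mul, Complex.nnnorm_I, one_mul]
    have : s ≤ s + s := le_add_self
    calc _ ≤ ‖((a : ℝ) : ℂ)‖₊ + ‖((b : ℝ) : ℂ)‖₊ + (s + s) := by gcongr
      _ = _ := by ring
  set c : Fin (n + 2) → ℝ := vsnoc (vsnoc 0 (a : ℝ)) (b : ℝ) with hc
  have hK0 := wnorm_complexifyLast_ne_top hfR le_rfl
  have hcr : ∀ i, ‖c i‖₊ < vsnoc (vsnoc r (‖(a : ℝ)‖₊ + s)) (‖(b : ℝ)‖₊ + s) i := by
    simp only [hc, forall_fin_succ_iff, vsnoc_castSucc, vsnoc_last]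
    exact ⟨⟨by simpa using hr, lt_add_of_pos_right _ hs⟩, lt_add_of_pos_right _ hs⟩
  have hcs : ∀ i, vsnoc (vsnoc r s) s i + ‖((c i : ℝ) : ℂ)‖₊ ≤
      vsnoc (vsnoc r (‖(a : ℝ)‖₊ + s)) (‖(b : ℝ)‖₊ + s) i := by
    simp only [hc, forall_fin_succ_iff, vsnoc_castSucc, vsnoc_last, Complex.nnnorm_real]
    exact ⟨⟨by simp, (add_comm _ _).le⟩, (add_comm _ _).le⟩
  have hM := MemC.transl hW.toIsRatSystem (memC_complexifyLast hW hf) hK0 hcr (by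
    simp only [hc, forall_fin_succ_iff, vsnoc_castSucc, vsnoc_last]
    exact ⟨⟨fun _ => ⟨0, by simp⟩, a, rfl⟩, b, rfl⟩)
  have hconv : Conv (lineSeries f ((a : ℝ) + Complex.I * (b : ℝ)) d) :=
    ⟨vsnoc r s, by simpa [forall_fin_succ_iff] using ⟨hr, hs⟩,
      ne_top_of_le_ne_top hfR (wnorm_lineSeries_le f hp)⟩
  have hev : ∀ (x : Fin n → ℂ) (y z : ℂ), (∀ i, ‖x i‖₊ ≤ r i) → ‖y‖₊ ≤ s → ‖z‖₊ ≤ s →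
      ev (transl (fun i => (c i : ℂ)) (complexifyLast f)) (vsnoc (vsnoc x y) z) =
        ev (toC f) (vsnoc x ((a : ℝ) + Complex.I * (b : ℝ) + (y + Complex.I * z))) := by
    intro x y z hx hy hz
    rw [ev_transl _ hK0 hcs (by simpa [forall_fin_succ_iff] using ⟨⟨hx, hy⟩, hz⟩)]
    have : (fun i => vsnoc (vsnoc x y) z i + (c i : ℂ)) =
        vsnoc (vsnoc x (y + (a : ℝ))) (z + (b : ℝ)) := by
      ext i
      induction i using Fin.lastCases with
      | last => simp [hc]
      | cast i => induction i using Fin.lastCases <;> simp [hc]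
    rw [this, ev_complexifyLast hfR le_rfl hx]
    · congr 2; ring
    · refine (nnnorm_add_le _ _).trans ?_
      rw [Complex.nnnorm_real, add_comm]; gcongr
    · refine (nnnorm_add_le _ _).trans ?_
      rw [Complex.nnnorm_real, add_comm]; gcongr
  have hsmall := eventually_nnnorm_le (𝕜 := ℝ) (r := vsnoc r s)
    (by simpa [forall_fin_succ_iff] using ⟨hr, hs⟩)
  rcases hd with rfl | rfl
  · refine MemC.of_eventually hW.toIsPresystem hconv (hM.killCompl hW.toIsRatSystem Fin.castSuccEmb) ?_
    filter_upwards [hsmall] with y hy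
    obtain ⟨x, t, rfl⟩ : ∃ x t, vsnoc x t = y := ⟨_, _, vsnoc_comp_castSucc y⟩
    simp only [forall_fin_succ_iff, vsnoc_castSucc, vsnoc_last] at hy
    have hx' : ∀ i, ‖((x i : ℝ) : ℂ)‖₊ ≤ r i := by simpa using hy.1
    have ht' : ‖(t : ℂ)‖₊ ≤ s := by simpa using hy.2
    have h1 := ev_killCompl Fin.castSuccEmb (transl (fun i => (c i : ℂ)) (complexifyLast f))
      (vsnoc (vsnoc (fun i => (x i : ℂ)) (t : ℂ)) 0) (by
        simp [forall_fin_succ_iff])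
    rw [hev _ _ _ hx' ht' (by simp)] at h1
    rw [comp_vsnoc, ev_lineSeries hfR hp hx' ht']
    simp only [Fin.coe_castSuccEmb, vsnoc_castSucc] at h1
    rw [show (fun i => vsnoc (fun i => ((x i : ℝ) : ℂ)) (t : ℂ) i) = vsnoc _ _ from rfl] at h1
    rw [h1]
    congr 2
    ring
  -- The embedding skips the position of X_n, so that Y_n takes over the role of the last variable.
  · refine MemC.of_eventually hW.toIsPresystem hconv
      (hM.killCompl hW.toIsRatSystem (Fin.last n).castSucc.succAboveEmb) ?_
    filter_upwards [hsmall] with y hy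
    obtain ⟨x, t, rfl⟩ : ∃ x t, vsnoc x t = y := ⟨_, _, vsnoc_comp_castSucc y⟩
    simp only [forall_fin_succ_iff, vsnoc_castSucc, vsnoc_last] at hy
    have hx' : ∀ i, ‖((x i : ℝ) : ℂ)‖₊ ≤ r i := by simpa using hy.1
    have ht' : ‖(t : ℂ)‖₊ ≤ s := by simpa using hy.2
    have h1 := ev_killCompl (Fin.last n).castSucc.succAboveEmb
      (transl (fun i => (c i : ℂ)) (complexifyLast f))
      (vsnoc (vsnoc (fun i => (x i : ℂ)) 0) (t : ℂ)) (by
        intro i hi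
        rw [Fin.coe_succAboveEmb, Fin.range_succAbove] at hi
        have : i = (Fin.last n).castSucc := by simpa using hi
        simp [this])
    rw [hev _ _ _ hx' (by simp) ht'] at h1
    rw [comp_vsnoc, ev_lineSeries hfR hp hx' ht']
    have h2 : (fun i => vsnoc (vsnoc (fun i => ((x i : ℝ) : ℂ)) 0) (t : ℂ)
        ((Fin.last n).castSucc.succAboveEmb i)) = vsnoc (fun i => ((x i : ℝ) : ℂ)) (t : ℂ) := by
      ext i
      induction i using Fin.lastCases with
      | last => simp
      | cast j =>
        have : (Fin.last n).castSucc.succAbove j.castSucc = j.castSucc.castSucc :=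
          Fin.succAbove_of_castSucc_lt _ _ (by simp [Fin.lt_def])
        simp [this]
    rw [h2] at h1
    rw [h1]
    congr 2
    ring

end Line

/-! ### Cauchy's formula on a square -/

section Square

/-- The integral along the boundary of the square with centre `0` and half side `ρ`. -/
def squareInt (ρ : ℝ) (F : ℂ → ℂ) : ℂ :=
  (∫ t in (-ρ)..ρ, F (t + ((-ρ : ℝ) : ℂ) * Complex.I)) - (∫ t in (-ρ)..ρ, F (t + (ρ : ℂ) * Complex.I)) +
    Complex.I * (∫ t in (-ρ)..ρ, F ((ρ : ℂ) + t * Complex.I)) -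
    Complex.I * (∫ t in (-ρ)..ρ, F (((-ρ : ℝ) : ℂ) + t * Complex.I))

variable {ρ : ℝ}

/-- The farthest points of a side are corners, at distance √2 ρ < 2ρ; all boundary points thus lie
in one annulus. -/
lemma horizontal_mem {b t : ℝ} (hρ : 0 < ρ) (hb : |b| = ρ) (ht : t ∈ Set.uIcc (-ρ) ρ) :
    ρ ≤ ‖(t : ℂ) + (b : ℂ) * Complex.I‖ ∧ ‖(t : ℂ) + (b : ℂ) * Complex.I‖ < 2 * ρ := by
  rw [Set.uIcc_of_le (by linarith), Set.mem_Icc] at ht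
  have hb2 : b ^ 2 = ρ ^ 2 := by rw [← sq_abs, hb]
  have h : ‖(t : ℂ) + (b : ℂ) * Complex.I‖ ^ 2 = t ^ 2 + b ^ 2 := by
    rw [← Complex.normSq_eq_norm_sq, Complex.normSq_add_mul_I]
  constructor
  · refine le_of_sq_le_sq ?_ (norm_nonneg _)
    nlinarith [sq_nonneg t]
  · refine lt_of_pow_lt_pow_left₀ 2 (by linarith) ?_
    rw [h, hb2]; nlinarith

lemma vertical_mem {a t : ℝ} (hρ : 0 < ρ) (ha : |a| = ρ) (ht : t ∈ Set.uIcc (-ρ) ρ) :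
    ρ ≤ ‖(a : ℂ) + (t : ℂ) * Complex.I‖ ∧ ‖(a : ℂ) + (t : ℂ) * Complex.I‖ < 2 * ρ := by
  have h : ‖(a : ℂ) + (t : ℂ) * Complex.I‖ = ‖(t : ℂ) + (a : ℂ) * Complex.I‖ := by
    rw [← sq_eq_sq₀ (norm_nonneg _) (norm_nonneg _), ← Complex.normSq_eq_norm_sq,
      ← Complex.normSq_eq_norm_sq, Complex.normSq_add_mul_I, Complex.normSq_add_mul_I, add_comm]
  rw [h]
  exact horizontal_mem hρ ha ht

lemma continuousOn_horizontal {F : ℂ → ℂ} {b : ℝ} (hρ : 0 < ρ) (hb : |b| = ρ)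
    (hF : ContinuousOn F {z | ρ ≤ ‖z‖ ∧ ‖z‖ < 2 * ρ}) :
    ContinuousOn (fun t : ℝ => F (t + (b : ℂ) * Complex.I)) (Set.uIcc (-ρ) ρ) :=
  hF.comp (by fun_prop) fun _ ht => horizontal_mem hρ hb ht

lemma continuousOn_vertical {F : ℂ → ℂ} {a : ℝ} (hρ : 0 < ρ) (ha : |a| = ρ)
    (hF : ContinuousOn F {z | ρ ≤ ‖z‖ ∧ ‖z‖ < 2 * ρ}) :
    ContinuousOn (fun t : ℝ => F ((a : ℂ) + t * Complex.I)) (Set.uIcc (-ρ) ρ) :=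
  hF.comp (by fun_prop) fun _ ht => vertical_mem hρ ha ht

lemma squareInt_sub_const_mul {F G : ℂ → ℂ} (c : ℂ) (hρ : 0 < ρ)
    (hF : ContinuousOn F {z | ρ ≤ ‖z‖ ∧ ‖z‖ < 2 * ρ})
    (hG : ContinuousOn G {z | ρ ≤ ‖z‖ ∧ ‖z‖ < 2 * ρ}) :
    squareInt ρ (fun z => F z - c * G z) = squareInt ρ F - c * squareInt ρ G := by
  have h1 : |-ρ| = ρ := by rw [abs_neg, abs_of_pos hρ]
  have h2 : |ρ| = ρ := abs_of_pos hρ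
  have hor : ∀ b : ℝ, |b| = ρ → ∫ t in (-ρ)..ρ, (F (t + (b : ℂ) * Complex.I) -
      c * G (t + (b : ℂ) * Complex.I)) = (∫ t in (-ρ)..ρ, F (t + (b : ℂ) * Complex.I)) -
      c * ∫ t in (-ρ)..ρ, G (t + (b : ℂ) * Complex.I) := fun b hb => by
    rw [intervalIntegral.integral_sub (continuousOn_horizontal hρ hb hF).intervalIntegrable
      ((continuousOn_horizontal hρ hb hG).intervalIntegrable.const_mul c),
      intervalIntegral.integral_const_mul]
  have ver : ∀ a : ℝ, |a| = ρ → ∫ t in (-ρ)..ρ, (F ((a : ℂ) + t * Complex.I) -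
      c * G ((a : ℂ) + t * Complex.I)) = (∫ t in (-ρ)..ρ, F ((a : ℂ) + t * Complex.I)) -
      c * ∫ t in (-ρ)..ρ, G ((a : ℂ) + t * Complex.I) := fun a ha => by
    rw [intervalIntegral.integral_sub (continuousOn_vertical hρ ha hF).intervalIntegrable
      ((continuousOn_vertical hρ ha hG).intervalIntegrable.const_mul c),
      intervalIntegral.integral_const_mul]
  rw [squareInt, hor _ h1, hor _ h2, ver _ h1, ver _ h2, squareInt, squareInt]
  ring

lemma squareInt_congr {F G : ℂ → ℂ} (hρ : 0 < ρ)
    (h : ∀ z, ρ ≤ ‖z‖ → ‖z‖ < 2 * ρ → F z = G z) : squareInt ρ F = squareInt ρ G := by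
  have h1 : |-ρ| = ρ := by rw [abs_neg, abs_of_pos hρ]
  have h2 : |ρ| = ρ := abs_of_pos hρ
  have hor : ∀ b : ℝ, |b| = ρ → ∫ t in (-ρ)..ρ, F (t + (b : ℂ) * Complex.I) =
      ∫ t in (-ρ)..ρ, G (t + (b : ℂ) * Complex.I) := fun b hb =>
    intervalIntegral.integral_congr fun t ht =>
      h _ (horizontal_mem hρ hb ht).1 (horizontal_mem hρ hb ht).2
  have ver : ∀ a : ℝ, |a| = ρ → ∫ t in (-ρ)..ρ, F ((a : ℂ) + t * Complex.I) =
      ∫ t in (-ρ)..ρ, G ((a : ℂ) + t * Complex.I) := fun b hb =>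
    intervalIntegral.integral_congr fun t ht =>
      h _ (vertical_mem hρ hb ht).1 (vertical_mem hρ hb ht).2
  rw [squareInt, squareInt, hor _ h1, hor _ h2, ver _ h1, ver _ h2]

lemma squareInt_eq_zero {F : ℂ → ℂ} (hρ : 0 < ρ)
    (hF : DifferentiableOn ℂ F (Metric.ball 0 (2 * ρ))) : squareInt ρ F = 0 := by
  have := Complex.integral_boundary_rect_eq_zero_of_differentiableOn F
    (⟨-ρ, -ρ⟩ : ℂ) (⟨ρ, ρ⟩ : ℂ) (hF.mono fun z hz => ?_)
  · simpa only [squareInt, smul_eq_mul] using this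
  · rw [Complex.mem_reProdIm] at hz
    simp only [Set.uIcc_of_le (show -ρ ≤ ρ by linarith), Set.mem_Icc] at hz
    rw [mem_ball_zero_iff]
    refine lt_of_pow_lt_pow_left₀ 2 (by linarith) ?_
    rw [← Complex.normSq_eq_norm_sq, Complex.normSq_apply]
    nlinarith [hz.1.1, hz.1.2, hz.2.1, hz.2.2]

lemma im_mul_integral_pos {w : ℝ → ℂ} (c : ℂ) (hρ : 0 < ρ)
    (hw : ContinuousOn w (Set.uIcc (-ρ) ρ)) (hpos : ∀ t ∈ Set.uIcc (-ρ) ρ, 0 < (c / w t).im) :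
    0 < (c * ∫ t in (-ρ)..ρ, 1 / w t).im := by
  have h0 : ∀ t ∈ Set.uIcc (-ρ) ρ, w t ≠ 0 := fun t ht h => by
    have := hpos t ht
    simp [h] at this
  have hc : ContinuousOn (fun t => c / w t) (Set.uIcc (-ρ) ρ) := continuousOn_const.div hw h0
  rw [← intervalIntegral.integral_const_mul]
  simp_rw [mul_one_div]
  have := Complex.imCLM.intervalIntegral_comp_comm (hc.intervalIntegrable (μ := MeasureTheory.volume))
  simp only [Complex.imCLM_apply] at this
  rw [← this]
  refine intervalIntegral.intervalIntegral_pos_of_pos_on ?_ (fun t ht => hpos t ?_) (by linarith)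
  · exact (Complex.continuous_im.comp_continuousOn hc).intervalIntegrable
  · rw [Set.uIcc_of_le (by linarith)]
    exact Set.Ioo_subset_Icc_self ht

/-- No winding number is computed. With its orientation factor, each of the four sides contributes a
positive imaginary part: the coordinate of z normal to the side is ±ρ there, and the perturbation e,
bounded by ρ/4, cannot change its sign. -/
lemma squareInt_one_div_ne_zero {e : ℂ → ℂ} (hρ : 0 < ρ)
    (he : DifferentiableOn ℂ e (Metric.ball 0 (3 * ρ)))
    (hb : ∀ z ∈ Metric.ball (0 : ℂ) (3 * ρ), ‖e z‖ ≤ ρ / 4) :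
    squareInt ρ (fun z => 1 / (z - e z)) ≠ 0 := by
  have h1 : |-ρ| = ρ := by rw [abs_neg, abs_of_pos hρ]
  have h2 : |ρ| = ρ := abs_of_pos hρ
  have hcont : ContinuousOn (fun z => z - e z) {z | ρ ≤ ‖z‖ ∧ ‖z‖ < 2 * ρ} := by
    refine continuousOn_id.sub (he.continuousOn.mono fun z hz => ?_)
    rw [mem_ball_zero_iff]; linarith [hz.2]
  have hbd : ∀ z : ℂ, ‖z‖ < 2 * ρ → |(e z).re| ≤ ρ / 4 ∧ |(e z).im| ≤ ρ / 4 := fun z hz => by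
    have := hb z (by rw [mem_ball_zero_iff]; linarith)
    exact ⟨(Complex.abs_re_le_norm _).trans this, (Complex.abs_im_le_norm _).trans this⟩
  have key : ∀ c w : ℂ, 0 < c.im * w.re - c.re * w.im → 0 < (c / w).im := fun c w h => by
    have hw : w ≠ 0 := by rintro rfl; simp at h
    rw [Complex.div_im, ← sub_div]
    exact div_pos h (Complex.normSq_pos.2 hw)
  have b1 := im_mul_integral_pos (1 : ℂ) hρ (continuousOn_horizontal hρ h1 hcont) fun t ht => by
    refine key _ _ ?_
    have := (abs_le.1 (hbd _ (horizontal_mem hρ h1 ht).2).2)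
    simp at this ⊢
    linarith
  have b2 := im_mul_integral_pos (-1 : ℂ) hρ (continuousOn_horizontal hρ h2 hcont) fun t ht => by
    refine key _ _ ?_
    have := (abs_le.1 (hbd _ (horizontal_mem hρ h2 ht).2).2)
    simp at this ⊢
    linarith
  have b3 := im_mul_integral_pos Complex.I hρ (continuousOn_vertical hρ h2 hcont) fun t ht => by
    refine key _ _ ?_
    have := (abs_le.1 (hbd _ (vertical_mem hρ h2 ht).2).1)
    simp at this ⊢
    linarith
  have b4 := im_mul_integral_pos (-Complex.I) hρ (continuousOn_vertical hρ h1 hcont) fun t ht => by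
    refine key _ _ ?_
    have := (abs_le.1 (hbd _ (vertical_mem hρ h1 ht).2).1)
    simp at this ⊢
    linarith
  intro h0
  have := congrArg Complex.im h0
  rw [squareInt, sub_eq_add_neg, sub_eq_add_neg, ← neg_mul, Complex.add_im, Complex.add_im,
    Complex.add_im] at this
  rw [one_mul] at b1
  rw [neg_one_mul] at b2
  rw [Complex.zero_im] at this
  linarith

/-- The function (h(z) - h(φ)) / (z - e(z)) extends holomorphically across φ, because φ is the only
zero of the denominator and it is simple; Cauchy's theorem on the square then gives the equality. -/
lemma squareInt_div_eq {h e : ℂ → ℂ} {φ : ℂ} (hρ : 0 < ρ)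
    (hh : DifferentiableOn ℂ h (Metric.ball 0 (3 * ρ)))
    (he : DifferentiableOn ℂ e (Metric.ball 0 (3 * ρ)))
    (hb : ∀ z ∈ Metric.ball (0 : ℂ) (3 * ρ), ‖e z‖ ≤ ρ / 4)
    (hφ : φ ∈ Metric.ball (0 : ℂ) (3 * ρ)) (hfix : e φ = φ) :
    squareInt ρ (fun z => h z / (z - e z)) = h φ * squareInt ρ (fun z => 1 / (z - e z)) := by
  have hsub : Metric.ball (0 : ℂ) (2 * ρ) ⊆ Metric.ball 0 (3 * ρ) :=
    Metric.ball_subset_ball (by linarith)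
  have hφ4 : ‖φ‖ ≤ ρ / 4 := by simpa [hfix] using hb φ hφ
  have hφ2 : φ ∈ Metric.ball (0 : ℂ) (2 * ρ) := by rw [mem_ball_zero_iff]; linarith
  have hnhds : Metric.ball (0 : ℂ) (2 * ρ) ∈ 𝓝 φ := Metric.isOpen_ball.mem_nhds hφ2
  have hda : ∀ z ∈ Metric.ball (0 : ℂ) (2 * ρ), DifferentiableAt ℂ e z := fun z hz =>
    he.differentiableAt (Metric.isOpen_ball.mem_nhds (hsub hz))
  -- Cauchy's estimate on circles of radius ρ/2 gives |e'| ≤ (ρ/4)/(ρ/2). Hence e is a contraction,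
  -- which makes φ the unique fixed point, and e'(φ) ≠ 1 makes the zero simple.
  have hderiv : ∀ z ∈ Metric.ball (0 : ℂ) (2 * ρ), ‖deriv e z‖ ≤ 1 / 2 := fun z hz => by
    have hcl : Metric.closedBall z (ρ / 2) ⊆ Metric.ball 0 (3 * ρ) := fun y hy => by
      rw [mem_ball_zero_iff] at hz ⊢
      rw [mem_closedBall_iff_norm] at hy
      have := norm_add_le (y - z) z
      rw [sub_add_cancel] at this
      linarith
    have := Complex.norm_deriv_le_of_forall_mem_sphere_norm_le (half_pos hρ)
      ((he.mono hcl).diffContOnCl_ball subset_rfl)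
      fun y hy => hb y (hcl (Metric.sphere_subset_closedBall hy))
    refine this.trans (le_of_eq ?_)
    field_simp; norm_num
  have hlip : ∀ z ∈ Metric.ball (0 : ℂ) (2 * ρ), ‖e z - e φ‖ ≤ 1 / 2 * ‖z - φ‖ := fun z hz =>
    (convex_ball _ _).norm_image_sub_le_of_norm_deriv_le hda hderiv hφ2 hz
  set q : ℂ → ℂ := fun z => z - e z with hq
  have hqφ : q φ = 0 := by simp [hq, hfix]
  have hdq : DifferentiableOn ℂ q (Metric.ball 0 (2 * ρ)) := differentiableOn_id.sub (he.mono hsub)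
  have hq0 : ∀ z ∈ Metric.ball (0 : ℂ) (2 * ρ), z ≠ φ → q z ≠ 0 := fun z hz hne h0 => by
    have h1 := hlip z hz
    rw [hfix, ← sub_eq_zero.1 h0] at h1
    have : 0 < ‖z - φ‖ := norm_pos_iff.2 (sub_ne_zero.2 hne)
    linarith
  have hds : ∀ z ∈ Metric.ball (0 : ℂ) (2 * ρ), dslope q φ z ≠ 0 := fun z hz => by
    by_cases hne : z = φ
    · rw [hne, dslope_same]
      have : deriv q φ = 1 - deriv e φ := by
        rw [hq, deriv_fun_sub differentiableAt_fun_id (hda φ hφ2), deriv_id'']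
      rw [this]
      intro h0
      have h1 := hderiv φ hφ2
      rw [← sub_eq_zero.1 h0, norm_one] at h1
      norm_num at h1
    · rw [dslope_of_ne _ hne, slope_def_field, hqφ, sub_zero]
      exact div_ne_zero (hq0 z hz hne) (sub_ne_zero.2 hne)
  -- Dividing numerator and denominator by z - φ removes the singularity; off φ this quotient is
  -- (h(z) - h(φ)) / (z - e(z)).
  have hG : DifferentiableOn ℂ (fun z => dslope h φ z / dslope q φ z) (Metric.ball 0 (2 * ρ)) :=
    ((Complex.differentiableOn_dslope hnhds).2 (hh.mono hsub)).div
      ((Complex.differentiableOn_dslope hnhds).2 hdq) hds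
  have h0 := squareInt_eq_zero hρ hG
  have hne : ∀ z : ℂ, ρ ≤ ‖z‖ → z ≠ φ := by rintro z hz rfl; linarith
  have hS : {z : ℂ | ρ ≤ ‖z‖ ∧ ‖z‖ < 2 * ρ} ⊆ Metric.ball 0 (2 * ρ) := fun z hz => by
    rw [mem_ball_zero_iff]; exact hz.2
  have hqS : ∀ z ∈ {z : ℂ | ρ ≤ ‖z‖ ∧ ‖z‖ < 2 * ρ}, q z ≠ 0 := fun z hz =>
    hq0 z (hS hz) (hne z hz.1)
  have hcq : ContinuousOn q {z : ℂ | ρ ≤ ‖z‖ ∧ ‖z‖ < 2 * ρ} := hdq.continuousOn.mono hS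
  have hch : ContinuousOn h {z : ℂ | ρ ≤ ‖z‖ ∧ ‖z‖ < 2 * ρ} := (hh.mono hsub).continuousOn.mono hS
  rw [squareInt_congr (G := fun z => h z / q z - h φ * (1 / q z)) hρ,
    squareInt_sub_const_mul (F := fun z => h z / q z) (G := fun z => 1 / q z) _ hρ
    (hch.div hcq hqS) (continuousOn_const.div hcq hqS), sub_eq_zero] at h0
  · exact h0
  · intro z hz1 hz2
    have hzφ := hne z hz1
    have h3 : z - φ ≠ 0 := sub_ne_zero.2 hzφ
    have h4 := hqS z ⟨hz1, hz2⟩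
    rw [dslope_of_ne _ hzφ, dslope_of_ne _ hzφ, slope_def_field, slope_def_field, hqφ, sub_zero]
    field_simp

end Square

/-! ### Parametrized integrals along segments -/

section Contour

variable {W : Collection} {n : ℕ} {E f : Series (n + 1)} {r : Fin n → ℝ≥0} {ρ : ℝ≥0}

/-- The quotient `f(x, z) / (z - E(x, z))`. -/
def cauchyQuot (E f : Series (n + 1)) (x : Fin n → ℝ) (z : ℂ) : ℂ :=
  ev (toC f) (vsnoc (fun i => (x i : ℂ)) z) / (z - ev (toC E) (vsnoc (fun i => (x i : ℂ)) z))

lemma nnnorm_vsnoc_le {x : Fin n → ℂ} {z : ℂ} {s : ℝ≥0} (hx : ∀ i, ‖x i‖₊ ≤ r i)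
    (hz : ‖z‖₊ ≤ s) : ∀ i, ‖vsnoc x z i‖₊ ≤ vsnoc r s i := by
  simp [forall_fin_succ_iff, hx, hz]

lemma hasDerivAt_ev_vsnoc {g : MvPowerSeries (Fin (n + 1)) ℂ} {s : ℝ≥0}
    (hg : wnorm g (vsnoc r s) ≠ ⊤) {x : Fin n → ℂ} (hx : ∀ i, ‖x i‖₊ ≤ r i) {z : ℂ}
    (hz : ‖z‖₊ < s) :
    HasDerivAt (fun z => ev (antid (Fin.last n) g) (vsnoc x z)) (ev g (vsnoc x z)) z := by
  have := hasDerivAt_ev_antid hg (Fin.last n) (x := vsnoc x 0) (t := z)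
    (fun j hj => nnnorm_vsnoc_le hx (by simp) j) (by simpa using hz)
  simpa only [update_vsnoc_last] using this

lemma differentiableAt_ev_vsnoc {g : MvPowerSeries (Fin (n + 1)) ℂ} {s : ℝ≥0}
    (hg : wnorm g (vsnoc r s) ≠ ⊤) {x : Fin n → ℂ} (hx : ∀ i, ‖x i‖₊ ≤ r i) {z : ℂ}
    (hz : ‖z‖₊ < s) : DifferentiableAt ℂ (fun z => ev g (vsnoc x z)) z := by
  have := hasDerivAt_ev_update hg (Fin.last n) (x := vsnoc x 0) (t := z)
    (fun j hj => nnnorm_vsnoc_le hx (by simp) j) (by simpa using hz)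
  simp only [update_vsnoc_last] at this
  exact this.differentiableAt

/-- The series p + dX_n - E(X', p + dX_n) has an inverse converging for |t| ≤ 3ρ/4, because |p| ≥ ρ
dominates 3ρ/4 plus the norm of E, which is below ρ/4. Radius 3ρ for E is what is needed: |a| + |b|
= 3ρ/2, and each of X_n and Y_n gets a margin of 3ρ/4. -/
lemma exists_denominator_inv (hW : IsRatAnalysisSystem W) (hr : ∀ i, 0 < r i) (hρ : 0 < ρ)
    (hE : E ∈ W (n + 1)) (hEn : wnorm E (vsnoc r (3 * ρ)) < (ρ / 4 : ℝ≥0)) {a b : ℚ} {d : ℂ}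
    (hab : ‖(a : ℝ)‖₊ + ‖(b : ℝ)‖₊ = 3 * ρ / 2)
    (hp : ρ ≤ ‖((a : ℝ) + Complex.I * (b : ℝ) : ℂ)‖₊) (hd : d = 1 ∨ d = Complex.I)
    (hpd : ‖((a : ℝ) + Complex.I * (b : ℝ) : ℂ)‖₊ + ‖d‖₊ * (3 * ρ / 4) ≤ 3 * ρ) :
    ∃ K : MvPowerSeries (Fin (n + 1)) ℂ, MemC W K ∧ wnorm K (vsnoc r (3 * ρ / 4)) ≠ ⊤ ∧
      ∀ (x : Fin n → ℂ) (t : ℂ), (∀ i, ‖x i‖₊ ≤ r i) → ‖t‖₊ ≤ 3 * ρ / 4 →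
        ev K (vsnoc x t) = ((a : ℝ) + Complex.I * (b : ℝ) + d * t -
          ev (toC E) (vsnoc x ((a : ℝ) + Complex.I * (b : ℝ) + d * t)))⁻¹ := by
  have hP := hW.toIsPresystem
  set p : ℂ := (a : ℝ) + Complex.I * (b : ℝ) with hp_def
  set s : ℝ≥0 := 3 * ρ / 4 with hs
  have hd1 : ‖d‖₊ = 1 := by rcases hd with rfl | rfl <;> simp
  have hsum : (‖(a : ℝ)‖₊ + s) + (‖(b : ℝ)‖₊ + s) = 3 * ρ := by
    rw [add_add_add_comm, hab, hs]
    apply NNReal.coe_injective; push_cast; ring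
  have hEtop : wnorm E (vsnoc r (3 * ρ)) ≠ ⊤ := hEn.ne_top
  set G := lineSeries E p d with hG
  have hGM : MemC W G := memC_lineSeries hW hE hr (s := s) (by positivity) (by rwa [hsum]) hd
  have hGn : wnorm G (vsnoc r s) < (ρ / 4 : ℝ≥0) := (wnorm_lineSeries_le E hpd).trans_lt hEn
  have hGtop : wnorm G (vsnoc r s) ≠ ⊤ := hGn.ne_top
  set e0 := constantCoeff G with he0
  have hXtop : wnorm (X (Fin.last n) : MvPowerSeries (Fin (n + 1)) ℂ) (vsnoc r s) ≠ ⊤ := by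
    rw [wnorm_X]; simp
  have hCtop : ∀ c : ℂ, wnorm (C c : MvPowerSeries (Fin (n + 1)) ℂ) (vsnoc r s) ≠ ⊤ := fun c => by
    rw [wnorm_C]; simp
  set D : MvPowerSeries (Fin (n + 1)) ℂ := C p + C d * X (Fin.last n) - G with hD
  have hD0 : constantCoeff D = p - e0 := by simp [hD, he0]
  have hDtop : wnorm D (vsnoc r s) ≠ ⊤ := wnorm_sub_ne_top
    (wnorm_add_ne_top (hCtop p) (wnorm_mul_ne_top (hCtop d) hXtop)) hGtop
  have hDM : MemC W D := by
    refine MemC.sub hP (MemC.add hP (MemC.const hP ?_ ?_) (MemC.mul hP ?_ ?_)) hGM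
    · simpa [hp_def] using hW.ratCast_mem_coeffField a
    · simpa [hp_def] using hW.ratCast_mem_coeffField b
    · rcases hd with rfl | rfl
      · simpa using MemC.toC hP (hW.one_mem (n + 1))
      · exact MemC.C_I hW.toIsRatSystem
    · simpa using MemC.toC hP (hW.X_mem (n + 1) (Fin.last n))
  -- With e0 the constant term and A the norm of the rest of G, |e0| + A < ρ/4; thus the constant
  -- term of D has size at least ρ - |e0| > 3ρ/4 + A.
  have hlt : wnorm (D - C (constantCoeff D)) (vsnoc r s) < ‖constantCoeff D‖₊ := by
    have h1 : D - C (constantCoeff D) = C d * X (Fin.last n) - (G - C e0) := by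
      rw [hD0, hD, map_sub]; ring
    have h2 : wnorm (D - C (constantCoeff D)) (vsnoc r s) ≤
        (s : ℝ≥0∞) + wnorm (G - C e0) (vsnoc r s) := by
      rw [h1]
      refine (wnorm_sub_le _ _ _).trans (add_le_add ((wnorm_mul_le _ _ _).trans ?_) le_rfl)
      rw [wnorm_C, wnorm_X, hd1, vsnoc_last]; simp
    refine h2.trans_lt ?_
    have h3 := wnorm_eq_constantCoeff_add G (vsnoc r s)
    rw [← he0] at h3
    have h4 : wnorm (G - C e0) (vsnoc r s) ≠ ⊤ := wnorm_sub_ne_top hGtop (hCtop e0)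
    lift wnorm (G - C e0) (vsnoc r s) to ℝ≥0 using h4 with A
    rw [h3] at hGn
    have h5 : ‖e0‖₊ + A < ρ / 4 := by exact_mod_cast hGn
    have h6 : ‖p‖₊ ≤ ‖constantCoeff D‖₊ + ‖e0‖₊ := by
      rw [hD0]; simpa using nnnorm_add_le (p - e0) e0
    norm_cast
    have h7 : ((‖e0‖₊ : ℝ) + A < ρ / 4) := by exact_mod_cast h5
    have h8 : ((ρ : ℝ) ≤ ‖constantCoeff D‖₊ + ‖e0‖₊) := by exact_mod_cast hp.trans h6
    have h9 : (s : ℝ) = 3 * ρ / 4 := by rw [hs]; push_cast; ring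
    have : ((s : ℝ) + A < ‖constantCoeff D‖₊) := by linarith
    exact_mod_cast this
  have hD0' : constantCoeff D ≠ 0 := by
    intro h0
    simp [h0] at hlt
  refine ⟨D⁻¹, hDM.inv hW.toIsRatSystem hD0', wnorm_inv_ne_top hlt, fun x t hx ht => ?_⟩
  have hxt := nnnorm_vsnoc_le hx ht
  rw [ev_inv hD0' hDtop (wnorm_inv_ne_top hlt) hxt, hD,
    ev_sub (wnorm_add_ne_top (hCtop p) (wnorm_mul_ne_top (hCtop d) hXtop)) hGtop hxt,
    ev_add (hCtop p) (wnorm_mul_ne_top (hCtop d) hXtop) hxt, ev_mul (hCtop d) hXtop hxt, ev_C, ev_C,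
    ev_X, vsnoc_last, hG, ev_lineSeries hEtop hpd hx ht]

/-- The integrand is a product of two series of the system in X' and t. Integrate it formally in t
and evaluate at t = ±ρ/2; these points are rational and lie inside the radius 3ρ/4, so each
evaluation is a translation followed by a restriction. -/
lemma exists_segment_integral (hW : IsRatAnalysisSystem W) (hr : ∀ i, 0 < r i) (hρ : 0 < ρ)
    (hρq : ∃ q : ℚ, (q : ℝ) = ρ) (hE : E ∈ W (n + 1)) (hf : f ∈ W (n + 1))
    (hEn : wnorm E (vsnoc r (3 * ρ)) < (ρ / 4 : ℝ≥0)) (hfn : wnorm f (vsnoc r (3 * ρ)) ≠ ⊤)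
    {a b : ℚ} {d : ℂ} (hab : ‖(a : ℝ)‖₊ + ‖(b : ℝ)‖₊ = 3 * ρ / 2)
    (hp : ρ ≤ ‖((a : ℝ) + Complex.I * (b : ℝ) : ℂ)‖₊) (hd : d = 1 ∨ d = Complex.I) :
    ∃ Φ : MvPowerSeries (Fin n) ℂ, MemC W Φ ∧ wnorm Φ r ≠ ⊤ ∧
      ∀ x : Fin n → ℝ, (∀ i, ‖x i‖₊ ≤ r i) → ev Φ (fun i => (x i : ℂ)) =
        ∫ t in (-(ρ / 2 : ℝ))..(ρ / 2 : ℝ),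
          cauchyQuot E f x ((a : ℝ) + Complex.I * (b : ℝ) + d * (t : ℂ)) := by
  have hP := hW.toIsPresystem
  have hd1 : ‖d‖₊ = 1 := by rcases hd with rfl | rfl <;> simp
  have hpd : ‖((a : ℝ) + Complex.I * (b : ℝ) : ℂ)‖₊ + ‖d‖₊ * (3 * ρ / 4) ≤ 3 * ρ := by
    have h1 : ‖((a : ℝ) + Complex.I * (b : ℝ) : ℂ)‖₊ ≤ 3 * ρ / 2 := by
      rw [← hab]
      refine (nnnorm_add_le _ _).trans ?_
      rw [nnnorm_mul, Complex.nnnorm_I, one_mul, Complex.nnnorm_real, Complex.nnnorm_real]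
    rw [hd1, one_mul]
    refine (add_le_add_left h1 _).trans ?_
    rw [← NNReal.coe_le_coe]; push_cast
    linarith [ρ.coe_nonneg]
  obtain ⟨K, hKM, hKn, hKev⟩ := exists_denominator_inv hW hr hρ hE hEn hab hp hd hpd
  set p : ℂ := (a : ℝ) + Complex.I * (b : ℝ) with hp_def
  set s : ℝ≥0 := 3 * ρ / 4 with hs
  set τ : ℝ≥0 := ρ / 2 with hτ
  have hs0 : 0 < s := by positivity
  have hτs : τ < s := by
    rw [← NNReal.coe_lt_coe, hs, hτ]; push_cast
    have : (0 : ℝ) < ρ := hρ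
    linarith
  have hsum : (‖(a : ℝ)‖₊ + s) + (‖(b : ℝ)‖₊ + s) = 3 * ρ := by
    rw [add_add_add_comm, hab, hs]
    apply NNReal.coe_injective; push_cast; ring
  have hGM : MemC W (lineSeries f p d) := memC_lineSeries hW hf hr hs0 (by rwa [hsum]) hd
  have hGn : wnorm (lineSeries f p d) (vsnoc r s) ≠ ⊤ :=
    ne_top_of_le_ne_top hfn (wnorm_lineSeries_le f hpd)
  set L := lineSeries f p d * K with hL
  have hLM : MemC W L := hGM.mul hP hKM
  have hLn : wnorm L (vsnoc r s) ≠ ⊤ := wnorm_mul_ne_top hGn hKn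
  have hLev : ∀ (x : Fin n → ℝ) (t : ℂ), (∀ i, ‖x i‖₊ ≤ r i) → ‖t‖₊ ≤ s →
      ev L (vsnoc (fun i => (x i : ℂ)) t) = cauchyQuot E f x (p + d * t) := fun x t hx ht => by
    have hx' : ∀ i, ‖((x i : ℝ) : ℂ)‖₊ ≤ r i := by simpa using hx
    rw [hL, ev_mul hGn hKn (nnnorm_vsnoc_le hx' ht), ev_lineSeries hfn hpd hx' ht,
      hKev _ _ hx' ht]
    rfl
  set A := antid (Fin.last n) L with hA
  have hAM : MemC W A := hLM.antid hW.toIsRatSystem _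
  have hAn : wnorm A (vsnoc r s) ≠ ⊤ := ne_top_of_le_ne_top
    (ENNReal.mul_ne_top ENNReal.coe_ne_top hLn) (wnorm_antid_le _ _ _)
  obtain ⟨q, hq⟩ := hρq
  have key : ∀ ε : ℚ, |(ε : ℝ)| = τ → ∃ Φ : MvPowerSeries (Fin n) ℂ, MemC W Φ ∧ wnorm Φ r ≠ ⊤ ∧
      ∀ x : Fin n → ℂ, (∀ i, ‖x i‖₊ ≤ r i) → ev Φ x = ev A (vsnoc x ((ε : ℝ) : ℂ)) := by
    intro ε hε
    have hε' : ‖(ε : ℝ)‖₊ = τ := by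
      apply NNReal.coe_injective; rw [coe_nnnorm, Real.norm_eq_abs, hε]
    set c : Fin (n + 1) → ℝ := vsnoc 0 (ε : ℝ) with hc
    have hcr : ∀ i, ‖c i‖₊ < vsnoc r s i := by
      simpa [forall_fin_succ_iff, hc, hε'] using ⟨hr, hτs⟩
    -- The last radius is 0: after the translation the last variable is only set to 0, and the first
    -- n radii must not shrink.
    have hcs : ∀ i, vsnoc r 0 i + ‖((c i : ℝ) : ℂ)‖₊ ≤ vsnoc r s i := by
      have : ‖((ε : ℝ) : ℂ)‖₊ = τ := by rw [Complex.nnnorm_real, hε']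
      simp only [forall_fin_succ_iff, hc, vsnoc_castSucc, vsnoc_last, this]
      simpa using hτs.le
    have hTM := MemC.transl hW.toIsRatSystem hAM hAn hcr (by
      simp only [forall_fin_succ_iff, hc, vsnoc_castSucc, vsnoc_last]
      exact ⟨fun _ => ⟨0, by simp⟩, ε, rfl⟩)
    refine ⟨_, hTM.killCompl hW.toIsRatSystem Fin.castSuccEmb, ?_, fun x hx => ?_⟩
    · have h1 := wnorm_killCompl_le Fin.castSuccEmb (transl (fun i => (c i : ℂ)) A) (vsnoc r 0)
      simp only [Fin.coe_castSuccEmb, vsnoc_castSucc] at h1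
      exact ne_top_of_le_ne_top hAn (h1.trans (wnorm_transl_le _ A hcs))
    · have h1 := ev_killCompl Fin.castSuccEmb (transl (fun i => (c i : ℂ)) A) (vsnoc x 0)
        (by simp [forall_fin_succ_iff])
      simp only [Fin.coe_castSuccEmb, vsnoc_castSucc] at h1
      rw [h1, ev_transl _ hAn hcs (nnnorm_vsnoc_le hx (by simp))]
      congr 1
      ext i
      induction i using Fin.lastCases <;> simp [hc]
  have hqτ : ((q / 2 : ℚ) : ℝ) = τ := by rw [hτ]; push_cast; rw [hq]
  obtain ⟨Φ₁, hM₁, hn₁, hev₁⟩ := key (q / 2) (by rw [hqτ, abs_of_nonneg τ.coe_nonneg])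
  obtain ⟨Φ₂, hM₂, hn₂, hev₂⟩ := key (-(q / 2)) (by
    rw [Rat.cast_neg, hqτ, abs_neg, abs_of_nonneg τ.coe_nonneg])
  refine ⟨Φ₁ - Φ₂, hM₁.sub hP hM₂, wnorm_sub_ne_top hn₁ hn₂, fun x hx => ?_⟩
  have hx' : ∀ i, ‖((x i : ℝ) : ℂ)‖₊ ≤ r i := by simpa using hx
  rw [ev_sub hn₁ hn₂ hx', hev₁ _ hx', hev₂ _ hx', Rat.cast_neg, hqτ]
  have hτ2 : (ρ / 2 : ℝ) = τ := by rw [hτ]; push_cast; rfl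
  rw [hτ2]
  have hle : ∀ t ∈ Set.uIcc (-(τ : ℝ)) τ, ‖((t : ℝ) : ℂ)‖₊ ≤ τ := fun t ht => by
    rw [Set.uIcc_of_le (by linarith [τ.coe_nonneg]), Set.mem_Icc, ← abs_le] at ht
    rw [← NNReal.coe_le_coe, coe_nnnorm, Complex.norm_real]
    exact ht
  have hint := intervalIntegral.integral_eq_sub_of_hasDerivAt
    (f := fun t : ℝ => ev A (vsnoc (fun i => (x i : ℂ)) (t : ℂ)))
    (f' := fun t : ℝ => ev L (vsnoc (fun i => (x i : ℂ)) (t : ℂ))) (a := -(τ : ℝ)) (b := τ)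
    (fun t ht => (hasDerivAt_ev_vsnoc hLn hx' ((hle t ht).trans_lt hτs)).comp_ofReal) ?_
  · rw [Complex.ofReal_neg] at hint ⊢
    rw [← hint]
    exact intervalIntegral.integral_congr fun t ht => hLev x t hx ((hle t ht).trans hτs.le)
  · refine ContinuousOn.intervalIntegrable fun t ht => ContinuousAt.continuousWithinAt ?_
    exact (differentiableAt_ev_vsnoc hLn hx' ((hle t ht).trans_lt hτs)).continuousAt.comp
      (f := fun t : ℝ => (t : ℂ)) Complex.continuous_ofReal.continuousAt

end Contour

/-! ### Values at the root of z = E(x, z) -/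

section FixedPoint

variable {W : Collection} {n : ℕ} {E f : Series (n + 1)} {r : Fin n → ℝ≥0} {ρ : ℝ≥0}

lemma differentiableOn_ev_vsnoc (hfn : wnorm f (vsnoc r (3 * ρ)) ≠ ⊤) {x : Fin n → ℝ}
    (hx : ∀ i, ‖x i‖₊ ≤ r i) :
    DifferentiableOn ℂ (fun z => ev (toC f) (vsnoc (fun i => (x i : ℂ)) z))
      (Metric.ball 0 (3 * (ρ : ℝ))) := fun z hz => by
  have hx' : ∀ i, ‖((x i : ℝ) : ℂ)‖₊ ≤ r i := by simpa using hx
  have hz' : ‖z‖₊ < 3 * ρ := by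
    rw [mem_ball_zero_iff] at hz
    exact_mod_cast hz
  exact (differentiableAt_ev_vsnoc (by rwa [wnorm_toC]) hx' hz').differentiableWithinAt

lemma norm_ev_vsnoc_le (hEn : wnorm E (vsnoc r (3 * ρ)) < (ρ / 4 : ℝ≥0)) {x : Fin n → ℝ}
    (hx : ∀ i, ‖x i‖₊ ≤ r i) : ∀ z ∈ Metric.ball (0 : ℂ) (3 * (ρ : ℝ)),
    ‖ev (toC E) (vsnoc (fun i => (x i : ℂ)) z)‖ ≤ (ρ : ℝ) / 4 := fun z hz => by
  have hx' : ∀ i, ‖((x i : ℝ) : ℂ)‖₊ ≤ r i := by simpa using hx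
  have hz' : ‖z‖₊ ≤ 3 * ρ := by
    rw [mem_ball_zero_iff] at hz
    exact_mod_cast hz.le
  have h1 := nnnorm_ev_le (f := toC E) (nnnorm_vsnoc_le hx' hz')
  rw [wnorm_toC] at h1
  have h2 := h1.trans hEn.le
  exact_mod_cast h2

lemma continuousOn_cauchyQuot (hρ : 0 < ρ) (hEn : wnorm E (vsnoc r (3 * ρ)) < (ρ / 4 : ℝ≥0))
    (hfn : wnorm f (vsnoc r (3 * ρ)) ≠ ⊤) {x : Fin n → ℝ} (hx : ∀ i, ‖x i‖₊ ≤ r i) :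
    ContinuousOn (cauchyQuot E f x) {z | (ρ : ℝ) ≤ ‖z‖ ∧ ‖z‖ < 2 * ρ} := by
  have hρ' : (0 : ℝ) < ρ := hρ
  have hsub : {z : ℂ | (ρ : ℝ) ≤ ‖z‖ ∧ ‖z‖ < 2 * ρ} ⊆ Metric.ball 0 (3 * (ρ : ℝ)) := fun z hz => by
    rw [mem_ball_zero_iff]; linarith [hz.2]
  refine ((differentiableOn_ev_vsnoc hfn hx).continuousOn.mono hsub).div
    (continuousOn_id.sub ((differentiableOn_ev_vsnoc hEn.ne_top hx).continuousOn.mono hsub)) ?_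
  intro z hz h0
  have h1 := norm_ev_vsnoc_le hEn hx z (hsub hz)
  rw [← sub_eq_zero.1 h0] at h1
  have := hz.1
  linarith

lemma integral_eq_add_shift {g : ℝ → ℂ} (hρ : 0 < ρ)
    (hg : ContinuousOn g (Set.uIcc (-(ρ : ℝ)) ρ)) :
    ∫ t in (-(ρ : ℝ))..ρ, g t = (∫ t in (-(ρ / 2 : ℝ))..(ρ / 2 : ℝ), g (t - ρ / 2)) +
      ∫ t in (-(ρ / 2 : ℝ))..(ρ / 2 : ℝ), g (t + ρ / 2) := by
  have hρ' : (0 : ℝ) < ρ := hρ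
  rw [intervalIntegral.integral_comp_sub_right, intervalIntegral.integral_comp_add_right,
    show -(ρ / 2 : ℝ) - ρ / 2 = -ρ by ring, show (ρ / 2 : ℝ) - ρ / 2 = 0 by ring,
    show -(ρ / 2 : ℝ) + ρ / 2 = 0 by ring, show (ρ / 2 : ℝ) + ρ / 2 = ρ by ring]
  rw [Set.uIcc_of_le (by linarith)] at hg
  refine (intervalIntegral.integral_add_adjacent_intervals ?_ ?_).symm <;>
  refine (hg.mono ?_).intervalIntegrable <;> rw [Set.uIcc_of_le (by linarith)]
  · exact Set.Icc_subset_Icc le_rfl hρ'.le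
  · exact Set.Icc_subset_Icc (by linarith) le_rfl

/-- A whole side is too long for one expansion: about its midpoint, at distance ρ from 0, it would
need |t| up to ρ, beyond the radius 3ρ/4. Its two halves, centred at distance ρ/2 from that
midpoint, only need |t| ≤ ρ/2. -/
lemma exists_side_integral (hW : IsRatAnalysisSystem W) (hr : ∀ i, 0 < r i) (hρ : 0 < ρ)
    {q : ℚ} (hq : (q : ℝ) = ρ) (hE : E ∈ W (n + 1)) (hf : f ∈ W (n + 1))
    (hEn : wnorm E (vsnoc r (3 * ρ)) < (ρ / 4 : ℝ≥0)) (hfn : wnorm f (vsnoc r (3 * ρ)) ≠ ⊤)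
    {b : ℚ} (hb : |(b : ℝ)| = ρ) :
    (∃ Φ : MvPowerSeries (Fin n) ℂ, MemC W Φ ∧ wnorm Φ r ≠ ⊤ ∧
      ∀ x : Fin n → ℝ, (∀ i, ‖x i‖₊ ≤ r i) → ev Φ (fun i => (x i : ℂ)) =
        ∫ t in (-(ρ : ℝ))..ρ, cauchyQuot E f x (t + ((b : ℝ) : ℂ) * Complex.I)) ∧
    (∃ Φ : MvPowerSeries (Fin n) ℂ, MemC W Φ ∧ wnorm Φ r ≠ ⊤ ∧
      ∀ x : Fin n → ℝ, (∀ i, ‖x i‖₊ ≤ r i) → ev Φ (fun i => (x i : ℂ)) =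
        ∫ t in (-(ρ : ℝ))..ρ, cauchyQuot E f x (((b : ℝ) : ℂ) + t * Complex.I)) := by
  have hP := hW.toIsPresystem
  have hρ' : (0 : ℝ) < ρ := hρ
  have hb' : ‖(b : ℝ)‖₊ = ρ := NNReal.coe_injective (by rw [coe_nnnorm, Real.norm_eq_abs, hb])
  have hc : ∀ c : ℚ, |(c : ℝ)| = ρ / 2 → ‖(c : ℝ)‖₊ = ρ / 2 := fun c hc => by
    apply NNReal.coe_injective
    rw [coe_nnnorm, Real.norm_eq_abs, hc]; push_cast; rfl
  have h1 : |((-(q / 2) : ℚ) : ℝ)| = ρ / 2 := by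
    push_cast; rw [hq, abs_neg, abs_of_pos (by positivity)]
  have h2 : |((q / 2 : ℚ) : ℝ)| = ρ / 2 := by
    push_cast; rw [hq, abs_of_pos (by positivity)]
  have hsum : ρ / 2 + ρ = 3 * ρ / 2 := by apply NNReal.coe_injective; push_cast; ring
  have hnorm : ∀ c : ℚ, ρ ≤ ‖((c : ℝ) + Complex.I * (b : ℝ) : ℂ)‖₊ ∧
      ρ ≤ ‖((b : ℝ) + Complex.I * (c : ℝ) : ℂ)‖₊ := fun c => by
    have e1 := Complex.abs_im_le_norm ((c : ℝ) + Complex.I * (b : ℝ) : ℂ)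
    have e2 := Complex.abs_re_le_norm ((b : ℝ) + Complex.I * (c : ℝ) : ℂ)
    simp only [Complex.add_im, Complex.add_re, Complex.ofReal_im, Complex.ofReal_re, Complex.mul_im,
      Complex.mul_re, Complex.I_re, Complex.I_im, zero_mul, one_mul, zero_add, mul_zero,
      add_zero, sub_self, hb] at e1 e2
    exact ⟨e1, e2⟩
  constructor
  · obtain ⟨Φ₁, m1, n1, v1⟩ := exists_segment_integral hW hr hρ ⟨q, hq⟩ hE hf hEn hfn
      (a := -(q / 2)) (b := b) (by rw [hc _ h1, hb', hsum]) (hnorm _).1 (Or.inl rfl)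
    obtain ⟨Φ₂, m2, n2, v2⟩ := exists_segment_integral hW hr hρ ⟨q, hq⟩ hE hf hEn hfn
      (a := q / 2) (b := b) (by rw [hc _ h2, hb', hsum]) (hnorm _).1 (Or.inl rfl)
    refine ⟨Φ₁ + Φ₂, m1.add hP m2, wnorm_add_ne_top n1 n2, fun x hx => ?_⟩
    have hx' : ∀ i, ‖((x i : ℝ) : ℂ)‖₊ ≤ r i := by simpa using hx
    rw [ev_add n1 n2 hx', v1 x hx, v2 x hx, integral_eq_add_shift hρ
      (continuousOn_horizontal hρ' hb (continuousOn_cauchyQuot hρ hEn hfn hx))]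
    congr 1 <;> refine intervalIntegral.integral_congr fun t _ => ?_ <;> congr 1 <;>
      push_cast [← hq] <;> ring
  · obtain ⟨Φ₁, m1, n1, v1⟩ := exists_segment_integral hW hr hρ ⟨q, hq⟩ hE hf hEn hfn
      (a := b) (b := -(q / 2)) (by rw [hc _ h1, hb', add_comm, hsum]) (hnorm _).2 (Or.inr rfl)
    obtain ⟨Φ₂, m2, n2, v2⟩ := exists_segment_integral hW hr hρ ⟨q, hq⟩ hE hf hEn hfn
      (a := b) (b := q / 2) (by rw [hc _ h2, hb', add_comm, hsum]) (hnorm _).2 (Or.inr rfl)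
    refine ⟨Φ₁ + Φ₂, m1.add hP m2, wnorm_add_ne_top n1 n2, fun x hx => ?_⟩
    have hx' : ∀ i, ‖((x i : ℝ) : ℂ)‖₊ ≤ r i := by simpa using hx
    rw [ev_add n1 n2 hx', v1 x hx, v2 x hx, integral_eq_add_shift hρ
      (continuousOn_vertical hρ' hb (continuousOn_cauchyQuot hρ hEn hfn hx))]
    congr 1 <;> refine intervalIntegral.integral_congr fun t _ => ?_ <;> congr 1 <;>
      push_cast [← hq] <;> ring

lemma exists_squareInt_series (hW : IsRatAnalysisSystem W) (hr : ∀ i, 0 < r i) (hρ : 0 < ρ)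
    {q : ℚ} (hq : (q : ℝ) = ρ) (hE : E ∈ W (n + 1)) (hf : f ∈ W (n + 1))
    (hEn : wnorm E (vsnoc r (3 * ρ)) < (ρ / 4 : ℝ≥0)) (hfn : wnorm f (vsnoc r (3 * ρ)) ≠ ⊤) :
    ∃ Φ : MvPowerSeries (Fin n) ℂ, MemC W Φ ∧ wnorm Φ r ≠ ⊤ ∧
      ∀ x : Fin n → ℝ, (∀ i, ‖x i‖₊ ≤ r i) →
        ev Φ (fun i => (x i : ℂ)) = squareInt ρ (cauchyQuot E f x) := by
  have hP := hW.toIsPresystem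
  have h1 : |((-q : ℚ) : ℝ)| = ρ := by push_cast; rw [abs_neg, hq, abs_of_nonneg ρ.coe_nonneg]
  have h2 : |(q : ℝ)| = ρ := by rw [hq, abs_of_nonneg ρ.coe_nonneg]
  obtain ⟨⟨A, mA, nA, vA⟩, ⟨D, mD, nD, vD⟩⟩ := exists_side_integral hW hr hρ hq hE hf hEn hfn h1
  obtain ⟨⟨B, mB, nB, vB⟩, ⟨K, mK, nK, vK⟩⟩ := exists_side_integral hW hr hρ hq hE hf hEn hfn h2
  have hI : wnorm (C Complex.I : MvPowerSeries (Fin n) ℂ) r ≠ ⊤ := by rw [wnorm_C]; simp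
  have mI : MemC W (C Complex.I : MvPowerSeries (Fin n) ℂ) := MemC.C_I hW.toIsRatSystem
  refine ⟨A - B + C Complex.I * K - C Complex.I * D,
    ((mA.sub hP mB).add hP (mI.mul hP mK)).sub hP (mI.mul hP mD),
    wnorm_sub_ne_top (wnorm_add_ne_top (wnorm_sub_ne_top nA nB) (wnorm_mul_ne_top hI nK))
      (wnorm_mul_ne_top hI nD), fun x hx => ?_⟩
  have hx' : ∀ i, ‖((x i : ℝ) : ℂ)‖₊ ≤ r i := by simpa using hx
  rw [ev_sub (wnorm_add_ne_top (wnorm_sub_ne_top nA nB) (wnorm_mul_ne_top hI nK))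
      (wnorm_mul_ne_top hI nD) hx', ev_add (wnorm_sub_ne_top nA nB) (wnorm_mul_ne_top hI nK) hx',
    ev_sub nA nB hx', ev_mul hI nK hx', ev_mul hI nD hx', ev_C, vA x hx, vB x hx, vD x hx, vK x hx,
    squareInt]
  push_cast [hq]
  rfl

/-- Evaluating a series at the fixed point of a small series in the last variable: the value is a
quotient of two parametrized integrals along the boundary of a square. -/
theorem mem_of_fixedPoint (hW : IsRatAnalysisSystem W) (hr : ∀ i, 0 < r i) (hρ : 0 < ρ)
    {q : ℚ} (hq : (q : ℝ) = ρ) (hE : E ∈ W (n + 1)) (hf : f ∈ W (n + 1))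
    (hEn : wnorm E (vsnoc r (3 * ρ)) < (ρ / 4 : ℝ≥0)) (hfn : wnorm f (vsnoc r (3 * ρ)) ≠ ⊤)
    {h : Series n} (hh : Conv h) {φ : (Fin n → ℝ) → ℝ}
    (hφ : ∀ᶠ x in 𝓝 0, |φ x| < 3 * ρ ∧ ev E (vsnoc x (φ x)) = φ x ∧
      ev h x = ev f (vsnoc x (φ x))) : h ∈ W n := by
  have hP := hW.toIsPresystem
  have hρ' : (0 : ℝ) < ρ := hρ
  have h1n : wnorm (1 : Series (n + 1)) (vsnoc r (3 * ρ)) ≠ ⊤ := by rw [wnorm_one]; simp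
  obtain ⟨F, mF, nF, vF⟩ := exists_squareInt_series hW hr hρ hq hE hf hEn hfn
  obtain ⟨G, mG, nG, vG⟩ := exists_squareInt_series hW hr hρ hq hE (hW.one_mem _) hEn h1n
  have hG1 : ∀ x : Fin n → ℝ, cauchyQuot E 1 x =
      fun z => 1 / (z - ev (toC E) (vsnoc (fun i => (x i : ℂ)) z)) := fun x => by
    funext z
    rw [cauchyQuot, show toC (1 : Series (n + 1)) = 1 from map_one _, ev_one]
  have hG0 : ∀ x : Fin n → ℝ, (∀ i, ‖x i‖₊ ≤ r i) → ev G (fun i => (x i : ℂ)) ≠ 0 := fun x hx => by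
    rw [vG x hx, hG1]
    exact squareInt_one_div_ne_zero hρ' (differentiableOn_ev_vsnoc hEn.ne_top hx)
      (norm_ev_vsnoc_le hEn hx)
  have hc : constantCoeff G ≠ 0 := by
    rw [← ev_at_zero]
    simpa [Pi.zero_def] using hG0 0 (by simp)
  obtain ⟨c, hc0, hcn, hcF, hcG⟩ : ∃ c : Fin n → ℝ≥0, (∀ i, 0 < c i) ∧ (∀ i, c i ≤ r i) ∧
      wnorm h c ≠ ⊤ ∧ wnorm G⁻¹ c ≠ ⊤ := by
    obtain ⟨c1, c10, h1, h2⟩ := hh.toC.exists_common (mG.conv hP |>.inv hc)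
    rw [wnorm_toC] at h1
    exact ⟨fun i => min (c1 i) (r i), fun i => lt_min (c10 i) (hr i), fun i => min_le_right _ _,
      ne_top_of_le_ne_top h1 (wnorm_mono _ fun i => min_le_left _ _),
      ne_top_of_le_ne_top h2 (wnorm_mono _ fun i => min_le_left _ _)⟩
  have key : MemC W (toC h) := by
    -- The candidate is the quotient of the integrals with numerators f and 1; at each real x near
    -- 0, `squareInt_div_eq` identifies its value as f(x, φ(x)).
    refine MemC.of_eventually hP hh.toC (mF.mul hP (mG.inv hW.toIsRatSystem hc)) ?_
    filter_upwards [hφ, eventually_nnnorm_le (𝕜 := ℝ) hc0] with x ⟨h1, h2, h3⟩ hxc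
    have hx : ∀ i, ‖x i‖₊ ≤ r i := fun i => (hxc i).trans (hcn i)
    have hxc' : ∀ i, ‖((x i : ℝ) : ℂ)‖₊ ≤ c i := by simpa using hxc
    have nF' := ne_top_of_le_ne_top nF (wnorm_mono F hcn)
    have nG' := ne_top_of_le_ne_top nG (wnorm_mono G hcn)
    have hvs : ∀ g : Series (n + 1), ev (toC g) (vsnoc (fun i => (x i : ℂ)) (φ x : ℂ)) =
        ev g (vsnoc x (φ x)) := fun g => by
      rw [← comp_vsnoc, ev_toC]
    rw [ev_mul nF' hcG hxc', ev_inv hc nG' hcG hxc', vF x hx, vG x hx, ev_toC, h3]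
    have := squareInt_div_eq (φ := (φ x : ℂ)) hρ' (differentiableOn_ev_vsnoc hfn hx)
      (differentiableOn_ev_vsnoc hEn.ne_top hx) (norm_ev_vsnoc_le hEn hx)
      (by rw [mem_ball_zero_iff, Complex.norm_real]; exact h1) (by rw [hvs, h2])
    have hne := hG0 x hx
    rw [vG x hx] at hne
    rw [eq_mul_inv_iff_mul_eq₀ hne, hG1]
    exact (this.trans (by rw [hvs])).symm
  have := key.1
  rwa [reS_toC] at this

end FixedPoint

/-! ### Closure under composition -/

section Composition

variable {W : Collection} {n m : ℕ}

lemma append_vsnoc {α : Type*} {j : ℕ} (x : Fin m → α) (y : Fin (j + 1) → α) :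
    Fin.append x y = vsnoc (Fin.append x fun i => y i.castSucc) (y (Fin.last j)) := by
  rw [vsnoc, ← Fin.append_snoc]
  congr 1
  exact (vsnoc_comp_castSucc y).symm

lemma forall_fin_append_iff {α : Type*} {j : ℕ} {x : Fin m → α} {y : Fin j → α} {P : α → Prop} :
    (∀ i, P (Fin.append x y i)) ↔ (∀ i, P (x i)) ∧ ∀ i, P (y i) := by
  constructor
  · exact fun h => ⟨fun i => by simpa using h (Fin.castAdd j i), fun i => by
      simpa using h (Fin.natAdd m i)⟩
  · rintro ⟨h1, h2⟩ i
    induction i using Fin.addCases with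
    | left i => simpa using h1 i
    | right i => simpa using h2 i

/-- The factor 12 = 3 · 4 leaves room for a rational ρ with 3ρ at most R and ρ/4 above w, as
`mem_of_fixedPoint` requires. -/
lemma exists_rat_radius {w : ℝ≥0∞} {R : ℝ≥0} (h : w < (R / 12 : ℝ≥0)) :
    ∃ (ρ : ℝ≥0) (q : ℚ), 0 < ρ ∧ (q : ℝ) = ρ ∧ 3 * ρ ≤ R ∧ w < (ρ / 4 : ℝ≥0) := by
  lift w to ℝ≥0 using h.ne_top
  have h' : w < R / 12 := by exact_mod_cast h
  have h1 : (w : ℝ) < R / 12 := by exact_mod_cast h'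
  obtain ⟨q, hq1, hq2⟩ := exists_rat_btwn (show 4 * (w : ℝ) < R / 3 by linarith)
  have hq0 : (0 : ℝ) < q := lt_of_le_of_lt (by positivity) hq1
  obtain ⟨ρ, hρ⟩ : ∃ ρ : ℝ≥0, (ρ : ℝ) = q := ⟨⟨q, hq0.le⟩, rfl⟩
  rw [← hρ] at hq1 hq2 hq0
  refine ⟨ρ, q, hq0, hρ.symm, ?_, ?_⟩
  · rw [← NNReal.coe_le_coe]; push_cast; linarith
  · have : w < ρ / 4 := by rw [← NNReal.coe_lt_coe]; push_cast; linarith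
    exact_mod_cast this

/-- The series u_i are substituted one at a time, starting with the last. They depend only on the
first m variables, so each step removes one variable and leaves the remaining ones and their radii
untouched. -/
lemma mem_of_ev_append (hW : IsRatAnalysisSystem W) {s : Fin m → ℝ≥0} (hs : ∀ i, 0 < s i) {j : ℕ} :
    ∀ {f : Series (m + j)} {R : Fin j → ℝ≥0} {u : Fin j → Series m} {h : Series m},
      f ∈ W (m + j) → wnorm f (Fin.append s R) ≠ ⊤ → (∀ i, u i ∈ W m) →
      (∀ i, wnorm (u i) s < (R i / 12 : ℝ≥0)) → Conv h →
      (∀ᶠ x in 𝓝 0, ev h x = ev f (Fin.append x fun i => ev (u i) x)) → h ∈ W m := by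
  induction j with
  | zero =>
    intro f R u h hf _ _ _ hh hev
    refine hW.toIsPresystem.mem_of_eventually hh (g := f) hf ?_
    filter_upwards [hev] with x hx
    rw [hx, Fin.append_right_nil _ _ rfl]
    rfl
  | succ j ih =>
    intro (f : Series (m + j + 1)) R u h hf hfR hu hun hh hev
    set v : Series (m + j) := rename (Fin.castAdd j) (u (Fin.last j)) with hv
    set r : Fin (m + j) → ℝ≥0 := Fin.append s fun i => R i.castSucc with hr_def
    have hR : ∀ i, 0 < R i := fun i => by
      have h1 : (0 : ℝ≥0∞) < (R i / 12 : ℝ≥0) := (zero_le (a := wnorm (u i) s)).trans_lt (hun i)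
      rw [ENNReal.coe_pos] at h1
      rw [pos_iff_ne_zero] at h1 ⊢
      rintro h0
      simp [h0] at h1
    have hr : ∀ i, 0 < r i := forall_fin_append_iff.2 ⟨hs, fun i => hR _⟩
    have hrs : (fun i => r (Fin.castAdd j i)) = s := funext fun i => by simp [hr_def]
    have hfR' : wnorm f (vsnoc r (R (Fin.last j))) ≠ ⊤ := by
      rwa [append_vsnoc s R] at hfR
    obtain ⟨ρ, q, hρ, hq, hρR, hρu⟩ := exists_rat_radius (hun (Fin.last j))
    have hvn : wnorm v r ≤ wnorm (u (Fin.last j)) s := by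
      have := wnorm_rename_le (Fin.castAdd j) (u (Fin.last j)) (s := r)
      rwa [hrs] at this
    have hEn : wnorm (rename (Fin.castSucc) v) (vsnoc r (3 * ρ)) < (ρ / 4 : ℝ≥0) := by
      refine ((wnorm_rename_le Fin.castSucc v).trans ?_).trans_lt hρu
      simpa using hvn
    have hfn : wnorm f (vsnoc r (3 * ρ)) ≠ ⊤ := by
      refine ne_top_of_le_ne_top hfR' (wnorm_mono _ ?_)
      rw [Pi.le_def, forall_fin_succ_iff]
      simpa using hρR
    have hvR : wnorm v r ≤ R (Fin.last j) := by
      refine hvn.trans ((hun _).le.trans ?_)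
      exact_mod_cast NNReal.div_le_of_le_mul' (by
        rw [← NNReal.coe_le_coe]; push_cast; linarith [(R (Fin.last j)).coe_nonneg])
    have hXv : ∀ i, wnorm (vsnoc (fun i => (X i : Series (m + j))) v i) r ≤
        vsnoc r (R (Fin.last j)) i := by
      rw [forall_fin_succ_iff]
      simpa [wnorm_X] using hvR
    set f' : Series (m + j) := tsubst f (vsnoc (fun i => X i) v) with hf'
    have hf'n : wnorm f' r ≤ wnorm f (vsnoc r (R (Fin.last j))) := wnorm_tsubst_le f hXv
    have hvW : v ∈ W (m + j) := hW.rename_mem (Fin.castAdd_injective m j) (hu _)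
    have hvtop : wnorm v r ≠ ⊤ := ne_top_of_le_ne_top ENNReal.coe_ne_top hvR
    have hf'ev : ∀ y, (∀ i, ‖y i‖₊ ≤ r i) → ev f' y = ev f (vsnoc y (ev v y)) := fun y hy => by
      rw [hf', ev_tsubst hfR' hXv hy]
      rw [comp_vsnoc (fun g => ev g y)]
      simp_rw [ev_X]
    have hvev : ∀ y, (∀ i, ‖y i‖₊ ≤ r i) →
        ev v y = ev (u (Fin.last j)) (fun i => y (Fin.castAdd j i)) := fun y hy =>
      ev_rename _ (by rw [hrs]; exact (hun _).ne_top) hy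
    have hf'W : f' ∈ W (m + j) := by
      -- Here E does not involve the last variable, so its fixed point is simply v(y).
      refine mem_of_fixedPoint hW hr hρ hq (hW.rename_mem (Fin.castSucc_injective _) hvW) hf hEn hfn
        ⟨r, hr, ne_top_of_le_ne_top hfR' hf'n⟩ (φ := ev v) ?_
      filter_upwards [eventually_nnnorm_le (𝕜 := ℝ) hr] with y hy
      have h1 : ‖ev v y‖₊ < 3 * ρ := by
        have h2 := (nnnorm_ev_le (f := v) hy).trans_lt (hvn.trans_lt hρu)
        have h3 : ‖ev v y‖₊ < ρ / 4 := by exact_mod_cast h2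
        refine h3.trans ?_
        rw [← NNReal.coe_lt_coe]; push_cast
        have : (0 : ℝ) < ρ := hρ
        linarith
      refine ⟨by exact_mod_cast h1, ?_, hf'ev y hy⟩
      rw [ev_rename Fin.castSucc (s := vsnoc r (3 * ρ)) (by simpa using hvtop)]
      · simp
      · rw [forall_fin_succ_iff]
        simpa using ⟨hy, h1.le⟩
    refine ih hf'W (ne_top_of_le_ne_top hfR' hf'n) (fun i => hu i.castSucc) (fun i => hun _) hh ?_
    filter_upwards [hev, eventually_nnnorm_le (𝕜 := ℝ) hs] with x hx hxs
    have hxr : ∀ i, ‖Fin.append x (fun i => ev (u i.castSucc) x) i‖₊ ≤ r i := fun i => by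
      induction i using Fin.addCases with
      | left i => simpa [hr_def] using hxs i
      | right i =>
        have h1 := (nnnorm_ev_le (f := u i.castSucc) hxs).trans_lt (hun i.castSucc)
        have h2 : ‖ev (u i.castSucc) x‖₊ < R i.castSucc / 12 := by exact_mod_cast h1
        simp only [Fin.append_right, hr_def]
        refine h2.le.trans (NNReal.div_le_of_le_mul' ?_)
        rw [← NNReal.coe_le_coe]; push_cast; linarith [(R i.castSucc).coe_nonneg]
    rw [hx, hf'ev _ hxr, hvev _ hxr, append_vsnoc]
    simp

/-- Composition with series of small norm. -/
theorem tsubst_mem (hW : IsRatAnalysisSystem W) {f : Series n} (hf : f ∈ W n) {R : Fin n → ℝ≥0}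
    (hR : wnorm f R ≠ ⊤) {s : Fin m → ℝ≥0} (hs : ∀ i, 0 < s i) {g : Fin n → Series m}
    (hg : ∀ i, g i ∈ W m) (hgs : ∀ i, wnorm (g i) s < (R i / 12 : ℝ≥0)) : tsubst f g ∈ W m := by
  have hgR : ∀ i, wnorm (g i) s ≤ R i := fun i => (hgs i).le.trans (by
    exact_mod_cast NNReal.div_le_of_le_mul' (by
      rw [← NNReal.coe_le_coe]; push_cast; linarith [(R i).coe_nonneg]))
  have hR' : (fun i => Fin.append s R (Fin.natAdd m i)) = R := funext fun i => by simp
  refine mem_of_ev_append hW hs (hW.rename_mem (Fin.natAdd_injective n m) hf) (R := R) ?_ hg hgs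
    ⟨s, hs, ne_top_of_le_ne_top hR (wnorm_tsubst_le f hgR)⟩ ?_
  · refine ne_top_of_le_ne_top hR ((wnorm_rename_le (Fin.natAdd m) f).trans ?_)
    rw [hR']
  · filter_upwards [eventually_nnnorm_le (𝕜 := ℝ) hs] with x hx
    rw [ev_tsubst hR hgR hx, ev_rename (Fin.natAdd m) (s := Fin.append s R) (by rwa [hR'])]
    · simp
    · intro i
      induction i using Fin.addCases with
      | left i => simpa using hx i
      | right i =>
        simp only [Fin.append_right]
        exact_mod_cast (nnnorm_ev_le (f := g i) hx).trans (hgR i)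

lemma exists_common_wnorm_lt {σ τ : Type*} [Fintype σ] [Finite τ] {𝕜 : Type*} [RCLike 𝕜]
    {g : τ → MvPowerSeries σ 𝕜} (hg : ∀ i, Conv (g i)) (h0 : ∀ i, constantCoeff (g i) = 0)
    {ε : τ → ℝ≥0∞} (hε : ∀ i, 0 < ε i) :
    ∃ s : σ → ℝ≥0, (∀ j, 0 < s j) ∧ ∀ i, wnorm (g i) s < ε i := by
  have := Fintype.ofFinite τ
  choose r hr hgr using hg
  choose t ht _ hgt using fun i => exists_wnorm_lt (hgr i) (h0 i) (hε i)
  rcases isEmpty_or_nonempty τ with h | h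
  · exact ⟨1, fun _ => one_pos, fun i => isEmptyElim i⟩
  · refine ⟨fun j => Finset.univ.inf' Finset.univ_nonempty fun i => t i * r i j, fun j => ?_,
      fun i => ?_⟩
    · exact (Finset.lt_inf'_iff _).2 fun i _ => mul_pos (ht i) (hr i j)
    · exact (wnorm_mono _ fun j => Finset.inf'_le _ (Finset.mem_univ i)).trans_lt (hgt i)

namespace IsRatAnalysisSystem

lemma map_mem (hW : IsRatAnalysisSystem W) (p : MvPolynomial (Fin n) ℚ) :
    (MvPolynomial.map (algebraMap ℚ ℝ) p : Series n) ∈ W n := by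
  induction p using MvPolynomial.induction_on with
  | C a => simpa using hW.ratCast_mem n a
  | add p q hp hq => simpa using hW.add_mem hp hq
  | mul_X p i hp => simpa using hW.mul_mem hp (hW.X_mem n i)

lemma subst_mem (hW : IsRatAnalysisSystem W) {f : Series n} (hf : f ∈ W n) {g : Fin n → Series m}
    (hg : ∀ i, g i ∈ W m) (h0 : ∀ i, constantCoeff (g i) = 0) : f.subst g ∈ W m := by
  obtain ⟨R, hR, hfR⟩ := hW.toIsPresystem.conv hf
  obtain ⟨s, hs, hgs⟩ := exists_common_wnorm_lt (fun i => hW.toIsPresystem.conv (hg i)) h0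
    (ε := fun i => ((R i / 12 : ℝ≥0) : ℝ≥0∞)) fun i => by
      have : 0 < R i / 12 := div_pos (hR i) (by norm_num)
      exact_mod_cast this
  rw [subst_eq_tsubst f (hasSubst_of_constantCoeff_zero h0)]
  exact tsubst_mem hW hf hfR hs hg hgs

/-- The point a need not be rational. Translate to a nearby rational point b and then compose with X
+ (a - b), whose constant term is in the coefficient field; `tsubst_mem` asks only that this series
be small. -/
lemma translation_mem (hW : IsRatAnalysisSystem W) {f : Series n} (hf : f ∈ W n) {a : Fin n → ℝ}
    (ha : a ∈ domain f) (hk : ∀ i, a i ∈ coeffField W) : translation f a ∈ W n := by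
  have hP := hW.toIsPresystem
  obtain ⟨r, har, hr⟩ := exists_wnorm_ne_top_of_mem_domain ha
  -- With s = (r - |a|)/40, the series X + (a - b) has norm at most 2s, while the radius left at b
  -- is at least 39s, and 2s < 39s/12.
  have hδ : ∀ i, 0 < ((r i : ℝ) - |a i|) / 40 := fun i => by
    have : |a i| < r i := har i
    linarith
  choose b hb1 hb2 using fun i => exists_rat_btwn (show a i < a i + ((r i : ℝ) - |a i|) / 40 by
    linarith [hδ i])
  set b' : Fin n → ℝ := fun i => b i with hb'
  set s : Fin n → ℝ≥0 := fun i => ⟨((r i : ℝ) - |a i|) / 40, (hδ i).le⟩ with hs_def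
  have hs : ∀ i, 0 < s i := hδ
  have hbs : ∀ i, |b' i| ≤ |a i| + s i := fun i => by
    have h1 := abs_add_le (a i) (b i - a i)
    rw [add_sub_cancel, abs_of_pos (sub_pos.2 (hb1 i))] at h1
    refine h1.trans ?_
    change _ ≤ |a i| + ((r i : ℝ) - |a i|) / 40
    linarith [hb2 i]
  have hbr : ∀ i, ‖b' i‖₊ < r i := fun i => by
    rw [← NNReal.coe_lt_coe, coe_nnnorm, Real.norm_eq_abs]
    refine (hbs i).trans_lt ?_
    change |a i| + ((r i : ℝ) - |a i|) / 40 < r i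
    linarith [hδ i]
  set R : Fin n → ℝ≥0 := fun i => r i - ‖b' i‖₊ with hR_def
  have hRr : ∀ i, R i + ‖b' i‖₊ ≤ r i := fun i => (tsub_add_cancel_of_le (hbr i).le).le
  have hf1 := hW.transl_mem hf hr hbr fun i => ⟨b i, rfl⟩
  have hf1R := ne_top_of_le_ne_top hr (wnorm_transl_le b' f hRr)
  set g : Fin n → Series n := fun i => X i + C (a i - b' i) with hg_def
  have hg : ∀ i, g i ∈ W n := fun i => hP.add_mem (hW.X_mem n i) (by
    rw [map_sub]
    exact hP.sub_mem (hP.C_mem (hk i) n) (hW.ratCast_mem n (b i)))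
  have hab : ∀ i, ‖a i - b' i‖₊ ≤ s i := fun i => by
    rw [← NNReal.coe_le_coe, coe_nnnorm, Real.norm_eq_abs, abs_sub_comm,
      abs_of_pos (sub_pos.2 (hb1 i))]
    change (b i : ℝ) - a i ≤ ((r i : ℝ) - |a i|) / 40
    linarith [hb2 i]
  have hgs : ∀ i, wnorm (g i) s < (R i / 12 : ℝ≥0) := fun i => by
    refine (wnorm_add_le _ _ _).trans_lt ?_
    rw [wnorm_X, wnorm_C]
    have h1 : s i + ‖a i - b' i‖₊ < R i / 12 := by
      have h2 : (‖a i - b' i‖₊ : ℝ) ≤ s i := hab i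
      have h3 : (s i : ℝ) = ((r i : ℝ) - |a i|) / 40 := rfl
      have h4 : (R i : ℝ) = r i - |b' i| := NNReal.coe_sub (hbr i).le
      rw [← NNReal.coe_lt_coe]; push_cast at h2 ⊢
      linarith [hbs i, hδ i]
    exact_mod_cast h1
  have hgR : ∀ i, wnorm (g i) s ≤ R i := fun i => (hgs i).le.trans (by
    exact_mod_cast NNReal.div_le_of_le_mul' (by
      rw [← NNReal.coe_le_coe]; push_cast; linarith [(R i).coe_nonneg]))
  have hsa : ∀ i, s i + ‖a i‖₊ ≤ r i := fun i => by
    rw [← NNReal.coe_le_coe]; push_cast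
    change ((r i : ℝ) - |a i|) / 40 + |a i| ≤ r i
    linarith [hδ i]
  refine hP.mem_of_eventually (f := transl a f) ⟨s, hs, ne_top_of_le_ne_top hr
    (wnorm_transl_le a f hsa)⟩ (tsubst_mem hW hf1 hf1R hs hg hgs) ?_
  filter_upwards [eventually_nnnorm_le (𝕜 := ℝ) hs] with x hx
  have hgx : ∀ i, ev (g i) x = x i + (a i - b' i) := fun i => by
    rw [hg_def, ev_add (r := s) (by rw [wnorm_X]; simp) (by rw [wnorm_C]; simp) hx, ev_X, ev_C]
  rw [ev_transl a hr hsa hx, ev_tsubst hf1R hgR hx, ev_transl b' hr hRr fun i => by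
    exact_mod_cast (nnnorm_ev_le (f := g i) hx).trans (hgR i)]
  congr 1
  ext i
  rw [hgx]; ring

end IsRatAnalysisSystem

end Composition

/-! ### The implicit function theorem and algebraic series -/

section Algebraic

variable {W : Collection} {n : ℕ}

lemma wnorm_coe_ne_top {σ 𝕜 : Type*} [Fintype σ] [RCLike 𝕜] (p : MvPolynomial σ 𝕜) (r : σ → ℝ≥0) :
    wnorm (p : MvPowerSeries σ 𝕜) r ≠ ⊤ := by
  induction p using MvPolynomial.induction_on with
  | C a => rw [MvPolynomial.coe_C, wnorm_C]; simp
  | add p q hp hq => rw [MvPolynomial.coe_add]; exact wnorm_add_ne_top hp hq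
  | mul_X p i hp =>
    rw [MvPolynomial.coe_mul, MvPolynomial.coe_X]
    exact wnorm_mul_ne_top hp (by rw [wnorm_X]; simp)

lemma ev_coe {σ 𝕜 : Type*} [Fintype σ] [RCLike 𝕜] (p : MvPolynomial σ 𝕜) (y : σ → 𝕜) :
    ev (p : MvPowerSeries σ 𝕜) y = MvPolynomial.eval y p := by
  have hy : ∀ i, ‖y i‖₊ ≤ (fun i => ‖y i‖₊) i := fun i => le_rfl
  induction p using MvPolynomial.induction_on with
  | C a => rw [MvPolynomial.coe_C, ev_C, MvPolynomial.eval_C]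
  | add p q hp hq =>
    rw [MvPolynomial.coe_add, ev_add (wnorm_coe_ne_top p _) (wnorm_coe_ne_top q _) hy, hp, hq,
      map_add]
  | mul_X p i hp =>
    rw [MvPolynomial.coe_mul, MvPolynomial.coe_X, ev_mul (wnorm_coe_ne_top p _)
      (by rw [wnorm_X]; simp) hy, hp, ev_X, map_mul, MvPolynomial.eval_X]

lemma conv_coe {σ 𝕜 : Type*} [Fintype σ] [RCLike 𝕜] (p : MvPolynomial σ 𝕜) :
    Conv (p : MvPowerSeries σ 𝕜) :=
  ⟨1, fun _ => one_pos, wnorm_coe_ne_top p _⟩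

lemma algebraMap_eq_coe_map {σ : Type*} (p : MvPolynomial σ ℚ) :
    algebraMap (MvPolynomial σ ℚ) (MvPowerSeries σ ℝ) p =
      (MvPolynomial.map (algebraMap ℚ ℝ) p : MvPowerSeries σ ℝ) := by
  rw [MvPowerSeries.algebraMap_apply']
  ext α
  simp [MvPolynomial.coeff_map]

/-- The implicit function theorem inside a system: a solution of a rational polynomial equation
that is simple at the origin. -/
lemma mem_of_implicit (hW : IsRatAnalysisSystem W) {Q : MvPolynomial (Fin (n + 1)) ℚ}
    {a : Fin n → ℚ} {g : Series n} (hg : Conv g)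
    (hQ : ∀ᶠ x : Fin n → ℝ in 𝓝 0, MvPolynomial.aeval (vsnoc (fun i => x i + a i) (ev g x)) Q = 0)
    {α : ℝ} (hα : α ≠ 0)
    (hd : HasDerivAt (fun z => MvPolynomial.aeval (vsnoc (fun i => (a i : ℝ)) z) Q) α (ev g 0)) :
    g ∈ W n := by
  have hP := hW.toIsPresystem
  set w := ev g 0 with hw
  -- The Newton map centred at the exact solution (a, w). It has real coefficients, since w and α
  -- may be irrational, and serves only for estimates.
  set E₀ : MvPolynomial (Fin (n + 1)) ℝ := MvPolynomial.X (Fin.last n) - MvPolynomial.C α⁻¹ *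
    MvPolynomial.aeval (fun i => MvPolynomial.X i +
      MvPolynomial.C (vsnoc (fun i => (a i : ℝ)) w i)) Q with hE₀
  have hE₀ev : ∀ y : Fin n → ℝ, ∀ z, ev (E₀ : Series (n + 1)) (vsnoc y z) =
      z - α⁻¹ * MvPolynomial.aeval (vsnoc (fun i => y i + a i) (z + w)) Q := fun y z => by
    rw [ev_coe, hE₀, map_sub, map_mul, MvPolynomial.eval_X, MvPolynomial.eval_C, vsnoc_last]
    congr 2
    change ((MvPolynomial.aeval (vsnoc y z)).restrictScalars ℚ) _ = _
    rw [← AlgHom.comp_apply, MvPolynomial.comp_aeval]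
    congr 2
    ext i
    induction i using Fin.lastCases <;> simp [MvPolynomial.aeval_eq_eval]
  have hQ0 : MvPolynomial.aeval (vsnoc (fun i => (a i : ℝ)) w) Q = 0 := by
    simpa [← hw] using hQ.self_of_nhds
  have hvz : vsnoc (0 : Fin n → ℝ) 0 = 0 := by
    ext i; induction i using Fin.lastCases <;> simp
  -- Neither a constant term nor a term z alone occurs in E₀, by Q = 0 and ∂Q/∂z = α at the centre.
  -- With weight 2 for each x_i and weight 1 for z, every monomial has weight at least 2.
  have hcoeff : ∀ β, coeff β (E₀ : Series (n + 1)) ≠ 0 →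
      2 ≤ 2 * (∑ i : Fin n, β i.castSucc) + β (Fin.last n) := by
    intro β hβ
    by_contra! hlt
    have hs : ∑ i : Fin n, β i.castSucc = 0 := by omega
    have hs' : ∀ i : Fin n, β i.castSucc = 0 := fun i => Finset.sum_eq_zero_iff.1 hs i (by simp)
    have hl : β (Fin.last n) = 0 ∨ β (Fin.last n) = 1 := by omega
    rcases hl with hl | hl
    · have : β = 0 := by
        ext i; induction i using Fin.lastCases <;> simp [hs', hl]
      rw [this] at hβ
      apply hβ
      rw [coeff_zero_eq_constantCoeff_apply, ← ev_at_zero, ← hvz, hE₀ev]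
      simp [hQ0]
    · have : β = 0 + Finsupp.single (Fin.last n) 1 := by
        ext i
        induction i using Fin.lastCases with
        | last => simp [hl]
        | cast i => simp [hs']
      rw [this] at hβ
      apply hβ
      have h1 := hasDerivAt_ev_update (wnorm_coe_ne_top E₀ 1) (Fin.last n) (x := vsnoc 0 0)
        (t := 0) (by simp [forall_fin_succ_iff]) (by simp)
      simp only [update_vsnoc_last, hE₀ev] at h1
      have h2 : HasDerivAt (fun z : ℝ => z - α⁻¹ * MvPolynomial.aeval
          (vsnoc (fun i => (0 : Fin n → ℝ) i + (a i : ℝ)) (z + w)) Q) (1 - α⁻¹ * α) 0 := by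
        refine (hasDerivAt_id (0 : ℝ)).sub (HasDerivAt.const_mul _ ?_)
        refine HasDerivAt.comp_add_const (f := fun z => MvPolynomial.aeval
          (vsnoc (fun i => (0 : Fin n → ℝ) i + (a i : ℝ)) z) Q) 0 w ?_
        simpa using hd
      have h3 := h1.unique h2
      rw [hvz, ev_at_zero, ← coeff_zero_eq_constantCoeff_apply, coeff_pderiv] at h3
      simpa [hα] using h3
  set K := wnorm (E₀ : Series (n + 1)) (vsnoc 1 4) with hK
  have hKtop : K ≠ ⊤ := wnorm_coe_ne_top _ _
  lift K to ℝ≥0 using hKtop with K'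
  obtain ⟨ρ, q, hρ, hq, hρ1, hρK⟩ : ∃ (ρ : ℝ≥0) (q : ℚ), 0 < ρ ∧ (q : ℝ) = ρ ∧ ρ ≤ 1 ∧
      ρ * K' ≤ 1 / 32 := by
    obtain ⟨q, hq1, hq2⟩ := exists_rat_btwn (show (0 : ℝ) < min 1 (1 / (32 * ((K' : ℝ) + 1))) by
      positivity)
    rw [lt_min_iff, lt_div_iff₀ (by positivity)] at hq2
    obtain ⟨ρ, hρ⟩ : ∃ ρ : ℝ≥0, (ρ : ℝ) = q := ⟨⟨q, hq1.le⟩, rfl⟩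
    rw [← hρ] at hq1 hq2
    refine ⟨ρ, q, hq1, hρ.symm, hq2.1.le, ?_⟩
    rw [← NNReal.coe_le_coe]; push_cast
    nlinarith [hq2.2, ρ.coe_nonneg]
  have hρ' : (0 : ℝ) < ρ := hρ
  -- Radii ρ² and 4ρ match the weights: scaling gains ρ², and ρK ≤ 1/32 turns this into ρ/32. The
  -- radius 4ρ instead of 3ρ leaves room for the shift by η.
  have hE₀n : wnorm (E₀ : Series (n + 1)) (vsnoc (fun _ => ρ ^ 2) (4 * ρ)) ≤ (ρ / 32 : ℝ≥0) := by
    have h1 : wnorm (E₀ : Series (n + 1)) (vsnoc (fun _ => ρ ^ 2) (4 * ρ)) ≤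
        (ρ ^ 2 : ℝ≥0) * wnorm (E₀ : Series (n + 1)) (vsnoc 1 4) := by
      refine wnorm_le_mul_of_mon_le fun β hβ => ?_
      have h2 : mon (vsnoc (fun _ : Fin n => ρ ^ 2) (4 * ρ)) β =
          ρ ^ (2 * (∑ i : Fin n, β i.castSucc) + β (Fin.last n)) * mon (vsnoc 1 4) β := by
        simp only [mon, Fin.prod_univ_castSucc, vsnoc_castSucc, vsnoc_last, ← pow_mul,
          Finset.prod_pow_eq_pow_sum, ← Finset.mul_sum, mul_pow, Pi.one_apply, one_pow, pow_add,
          Finset.prod_const_one]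
        ring
      rw [h2]
      gcongr ?_ * _
      exact pow_le_pow_of_le_one (zero_le) hρ1 (hcoeff β hβ)
    refine h1.trans ?_
    rw [← hK]
    norm_cast
    rw [← NNReal.coe_le_coe] at hρK ⊢
    push_cast at hρK ⊢
    nlinarith
  -- The series used for E must have rational coefficients, so w and 1/α are replaced by rational
  -- approximations c and b.
  obtain ⟨c, hc1, hc2⟩ := exists_rat_btwn (show w < w + ρ / 64 by linarith)
  obtain ⟨b, hb⟩ : ∃ b : ℚ, |1 - α * b| ≤ 1 / 48 := by
    have hα' : 0 < |α| := abs_pos.2 hα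
    obtain ⟨b, hb1, hb2⟩ := exists_rat_btwn (show α⁻¹ < α⁻¹ + 1 / (48 * |α|) by
      have : 0 < 1 / (48 * |α|) := by positivity
      linarith)
    refine ⟨b, ?_⟩
    rw [show 1 - α * b = - (α * (b - α⁻¹)) by field_simp; ring, abs_neg, abs_mul,
      abs_of_pos (sub_pos.2 hb1)]
    have h1 : (b : ℝ) - α⁻¹ ≤ 1 / (48 * |α|) := by linarith
    calc |α| * (b - α⁻¹) ≤ |α| * (1 / (48 * |α|)) := by gcongr
      _ = 1 / 48 := by field_simp
  set κ : ℝ := α * b with hκ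
  set η : ℝ := c - w with hη
  have hη0 : |η| ≤ ρ / 64 := by rw [abs_of_pos (sub_pos.2 hc1)]; linarith
  set r : Fin n → ℝ≥0 := fun _ => ρ ^ 2 with hr_def
  have hr : ∀ i, 0 < r i := fun i => by positivity
  set E : MvPolynomial (Fin (n + 1)) ℚ := MvPolynomial.X (Fin.last n) - MvPolynomial.C b *
    MvPolynomial.aeval (fun i => MvPolynomial.X i + MvPolynomial.C (vsnoc a c i)) Q with hE
  have hEev : ∀ y : Fin n → ℝ, ∀ z, ev (MvPolynomial.map (algebraMap ℚ ℝ) E : Series (n + 1))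
      (vsnoc y z) = z - b * MvPolynomial.aeval (vsnoc (fun i => y i + a i) (z + c)) Q :=
    fun y z => by
    rw [ev_coe, MvPolynomial.eval_map, ← MvPolynomial.aeval_def, hE, map_sub, map_mul,
      MvPolynomial.aeval_X, MvPolynomial.aeval_C, vsnoc_last]
    congr 2
    rw [← AlgHom.comp_apply, MvPolynomial.comp_aeval]
    congr 2
    ext i
    induction i using Fin.lastCases <;> simp
  set u : Fin (n + 1) → ℝ := vsnoc 0 η with hu
  have hus : ∀ i, vsnoc r (3 * ρ) i + ‖u i‖₊ ≤ vsnoc r (4 * ρ) i := by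
    rw [forall_fin_succ_iff]
    refine ⟨fun i => by simp [hu], ?_⟩
    simp only [hu, vsnoc_last]
    rw [← NNReal.coe_le_coe]; push_cast
    rw [Real.norm_eq_abs]
    linarith
  set T : Series (n + 1) := transl u (E₀ : Series (n + 1)) with hT
  have hTn : wnorm T (vsnoc r (3 * ρ)) ≤ (ρ / 32 : ℝ≥0) := (wnorm_transl_le u _ hus).trans hE₀n
  have hTtop := ne_top_of_le_ne_top ENNReal.coe_ne_top hTn
  have hs0 : ∀ i, 0 < vsnoc r (3 * ρ) i := by
    rw [forall_fin_succ_iff]; simpa using ⟨hr, hρ⟩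
  have hCtop : ∀ t : ℝ, wnorm (C t : Series (n + 1)) (vsnoc r (3 * ρ)) ≠ ⊤ := fun t => by
    rw [wnorm_C]; simp
  have hXtop : wnorm (X (Fin.last n) : Series (n + 1)) (vsnoc r (3 * ρ)) ≠ ⊤ := by
    rw [wnorm_X]; exact ENNReal.coe_ne_top
  -- E is E₀ shifted by η plus correction terms measuring the errors κ - 1 and η. The norm is then
  -- at most ρ/16 + ρ/32 + ρ/16, which is below ρ/4.
  have hEeq : (MvPolynomial.map (algebraMap ℚ ℝ) E : Series (n + 1)) =
      C (1 - κ) * X (Fin.last n) - C (κ * η) + C κ * T := by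
    refine (conv_coe _).eq_of_eventually_real ((((conv_C _).mul (conv_X _)).sub (conv_C _)).add
      ((conv_C _).mul ⟨_, hs0, hTtop⟩)) ?_
    filter_upwards [eventually_nnnorm_le (𝕜 := ℝ) hs0] with y hy
    obtain ⟨x, t, rfl⟩ : ∃ x t, vsnoc x t = y := ⟨_, _, vsnoc_comp_castSucc y⟩
    rw [hEev, ev_add (wnorm_sub_ne_top (wnorm_mul_ne_top (hCtop _) hXtop) (hCtop _))
      (wnorm_mul_ne_top (hCtop _) hTtop) hy, ev_sub (wnorm_mul_ne_top (hCtop _) hXtop) (hCtop _) hy,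
      ev_mul (hCtop _) hXtop hy, ev_mul (hCtop _) hTtop hy, ev_C, ev_C, ev_C, ev_X, vsnoc_last, hT,
      ev_transl u (wnorm_coe_ne_top E₀ (vsnoc r (4 * ρ))) hus hy]
    have h1 : (fun i => vsnoc x t i + u i) = vsnoc x (t + η) := by
      ext i; induction i using Fin.lastCases <;> simp [hu]
    rw [h1, hE₀ev, show t + η + w = t + c by rw [hη]; ring, hκ]
    field_simp
    ring
  have hEn : wnorm (MvPolynomial.map (algebraMap ℚ ℝ) E : Series (n + 1)) (vsnoc r (3 * ρ)) <
      (ρ / 4 : ℝ≥0) := by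
    rw [hEeq]
    refine ((wnorm_add_le _ _ _).trans (add_le_add (wnorm_sub_le _ _ _) le_rfl)).trans_lt ?_
    refine (add_le_add (add_le_add (wnorm_mul_le _ _ _) le_rfl) ((wnorm_mul_le _ _ _).trans
      (mul_le_mul_right hTn _))).trans_lt ?_
    rw [wnorm_C, wnorm_C, wnorm_C, wnorm_X, vsnoc_last]
    norm_cast
    rw [← NNReal.coe_lt_coe]; push_cast
    rw [Real.norm_eq_abs, Real.norm_eq_abs, Real.norm_eq_abs, abs_mul]
    have hκ2 : |κ| ≤ 2 := by
      have h1 : |κ| - |(1 : ℝ)| ≤ |κ - 1| := abs_sub_abs_le_abs_sub κ 1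
      rw [abs_sub_comm, abs_one] at h1
      linarith
    have h1 : |1 - κ| * (3 * ρ) ≤ 1 / 48 * (3 * ρ) := by gcongr
    have h2 : |κ| * |η| ≤ 2 * (ρ / 64) := by gcongr
    have h3 : |κ| * (ρ / 32) ≤ 2 * (ρ / 32) := by gcongr
    linarith
  have hgc : Conv (g - C (c : ℝ)) := hg.sub (conv_C _)
  have hfin : g - C (c : ℝ) ∈ W n := by
    -- The fixed point is g - c, since Q vanishes along g; taking f to be the last variable returns
    -- the fixed point itself.
    refine mem_of_fixedPoint hW hr hρ hq (hW.map_mem E) (hW.X_mem (n + 1) (Fin.last n)) hEn hXtop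
      hgc (φ := ev (g - C (c : ℝ))) ?_
    have hcont := hgc.continuousAt
    obtain ⟨R, hR, hgR⟩ := hg
    have hev : ∀ x, (∀ i, ‖x i‖₊ ≤ R i) → ev (g - C (c : ℝ)) x = ev g x - c := fun x hx => by
      rw [ev_sub hgR (by rw [wnorm_C]; simp) hx, ev_C]
    have h0 : |ev (g - C (c : ℝ)) 0| < 3 * (ρ : ℝ) := by
      rw [hev 0 (by simp), ← hw, abs_sub_comm]
      linarith
    filter_upwards [hcont.abs.eventually (gt_mem_nhds h0), hQ, eventually_nnnorm_le (𝕜 := ℝ) hR]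
      with x h1 h2 h3
    refine ⟨h1, ?_, by rw [ev_X, vsnoc_last]⟩
    rw [hEev, hev x h3, sub_add_cancel, h2, mul_zero, sub_zero]
  have := hP.add_mem hfin (hW.ratCast_mem n c)
  rwa [sub_add_cancel] at this

/-- Descent on the degree: if the derivative of a relation also annihilates f, use it instead. In
characteristic zero it is nonzero unless the relation is constant, and a nonzero constant cannot
annihilate f. -/
lemma exists_aeval_derivative_ne_zero {R A : Type*} [CommRing R] [IsDomain R] [CharZero R]
    [CommRing A] [Algebra R A] [FaithfulSMul R A] {f : A} (hf : IsAlgebraic R f) :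
    ∃ Q : Polynomial R, Polynomial.aeval f Q = 0 ∧ Polynomial.aeval f Q.derivative ≠ 0 := by
  obtain ⟨P, hP0, hP⟩ := hf
  induction hN : P.natDegree using Nat.strong_induction_on generalizing P with
  | _ N ih =>
    have hdeg : P.natDegree ≠ 0 := fun h => by
      rw [Polynomial.eq_C_of_natDegree_eq_zero h, Polynomial.aeval_C] at hP
      rw [Polynomial.eq_C_of_natDegree_eq_zero h] at hP0
      exact hP0 (by rw [(FaithfulSMul.algebraMap_eq_zero_iff R A).1 hP, map_zero])
    by_cases h : Polynomial.aeval f P.derivative = 0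
    · refine ih _ (hN ▸ Polynomial.natDegree_derivative_lt hdeg) _ (fun h0 => ?_) h rfl
      exact hdeg (Polynomial.derivative_eq_zero.1 h0)
    · exact ⟨P, hP, h⟩

lemma ev_aeval {f : Series n} {r : Fin n → ℝ≥0} (hf : wnorm f r ≠ ⊤)
    (Q : Polynomial (MvPolynomial (Fin n) ℚ)) :
    wnorm (Polynomial.aeval f Q) r ≠ ⊤ ∧ ∀ y, (∀ i, ‖y i‖₊ ≤ r i) →
      ev (Polynomial.aeval f Q) y =
        Polynomial.eval₂ (MvPolynomial.aeval y : _ →ₐ[ℚ] ℝ).toRingHom (ev f y) Q := by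
  induction Q using Polynomial.induction_on' with
  | add p q hp hq =>
    rw [map_add]
    exact ⟨wnorm_add_ne_top hp.1 hq.1, fun y hy => by
      rw [ev_add hp.1 hq.1 hy, hp.2 y hy, hq.2 y hy, Polynomial.eval₂_add]⟩
  | monomial k p =>
    have h1 := wnorm_coe_ne_top (MvPolynomial.map (algebraMap ℚ ℝ) p) r
    have h2 := wnorm_pow_ne_top hf k
    rw [Polynomial.aeval_monomial, algebraMap_eq_coe_map]
    refine ⟨wnorm_mul_ne_top h1 h2, fun y hy => ?_⟩
    rw [ev_mul h1 h2 hy, ev_pow hf hy, ev_coe, Polynomial.eval₂_monomial, MvPolynomial.eval_map]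
    rfl

/-- By the identity theorem the nonvanishing set is a nonempty open subset of the box, and rational
points are dense. -/
lemma exists_rat_ev_ne_zero {g : Series n} (hg0 : g ≠ 0) {r : Fin n → ℝ≥0} (hr : ∀ i, 0 < r i)
    (hg : wnorm g r ≠ ⊤) :
    ∃ a : Fin n → ℚ, (∀ i, ‖(a i : ℝ)‖₊ < r i) ∧ ev g (fun i => (a i : ℝ)) ≠ 0 := by
  set U : Set (Fin n → ℝ) := {x | ∀ i, ‖x i‖₊ < r i} with hU
  have hUo : IsOpen U := by
    have : U = ⋂ i, {x : Fin n → ℝ | ‖x i‖₊ < r i} := by ext; simp [hU]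
    rw [this]
    exact isOpen_iInter_of_finite fun i => isOpen_lt (by fun_prop) continuous_const
  have hc : ContinuousOn (ev g) U := (continuousOn_ev hg).mono fun x hx i => (hx i).le
  have hV := hc.isOpen_inter_preimage hUo (isOpen_compl_singleton (x := (0 : ℝ)))
  have hne : (U ∩ ev g ⁻¹' {0}ᶜ).Nonempty := by
    by_contra h
    rw [Set.not_nonempty_iff_eq_empty] at h
    refine hg0 (eq_zero_of_eventually_ev_eq_zero hr hg ?_)
    filter_upwards [hUo.mem_nhds (show (0 : Fin n → ℝ) ∈ U by simpa [hU] using hr)] with x hx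
    by_contra h0
    exact (Set.eq_empty_iff_forall_notMem.1 h x) ⟨hx, by simpa using h0⟩
  obtain ⟨a, ha⟩ := (DenseRange.piMap fun _ : Fin n =>
    Rat.denseRange_cast (𝕜 := ℝ)).exists_mem_open hV hne
  exact ⟨a, fun i => ha.1 i, ha.2⟩

/-- Translate back by -a. After the first translation the guaranteed radius is r - |a|, and it must
still exceed |a|; hence the factor 2. -/
lemma IsRatSystem.mem_of_transl_mem (hW : IsRatSystem W) {f : Series n} {r : Fin n → ℝ≥0}
    (hf : wnorm f r ≠ ⊤) {a : Fin n → ℝ} (ha : ∀ i, 2 * ‖a i‖₊ < r i)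
    (hq : ∀ i, ∃ q : ℚ, (q : ℝ) = a i) (h : transl a f ∈ W n) : f ∈ W n := by
  have har : ∀ i, ‖a i‖₊ < r i := fun i =>
    lt_of_le_of_lt (by rw [two_mul]; exact le_self_add) (ha i)
  set s : Fin n → ℝ≥0 := fun i => r i - ‖a i‖₊ with hs_def
  have hsr : ∀ i, s i + ‖a i‖₊ ≤ r i := fun i => (tsub_add_cancel_of_le (har i).le).le
  have hneg : ∀ i, ‖-a i‖₊ < s i := fun i => by
    rw [nnnorm_neg, hs_def, lt_tsub_iff_left, ← two_mul]
    exact ha i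
  have hgn : wnorm (transl a f) s ≠ ⊤ := ne_top_of_le_ne_top hf (wnorm_transl_le a f hsr)
  have hback := hW.transl_mem h hgn hneg fun i => by
    obtain ⟨q, hq⟩ := hq i
    exact ⟨-q, by rw [Rat.cast_neg, hq]⟩
  set t : Fin n → ℝ≥0 := fun i => s i - ‖-a i‖₊ with ht_def
  have ht : ∀ i, 0 < t i := fun i => tsub_pos_of_lt (hneg i)
  have hts : ∀ i, t i + ‖-a i‖₊ ≤ s i := fun i => (tsub_add_cancel_of_le (hneg i).le).le
  refine hW.toIsPresystem.mem_of_eventually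
    ⟨r, fun i => (zero_le (a := ‖a i‖₊)).trans_lt (har i), hf⟩ hback ?_
  filter_upwards [eventually_nnnorm_le (𝕜 := ℝ) ht] with x hx
  rw [ev_transl (fun i => -a i) hgn hts hx, ev_transl a hf hsr fun i =>
    (nnnorm_add_le _ _).trans ((add_le_add_left (hx i) _).trans (hts i))]
  simp

/-- The derivative of the chosen relation at f is a nonzero series but may vanish at the origin.
Moving to a nearby rational point where it does not vanish puts the problem within reach of
`mem_of_implicit`. -/
theorem algebraic_mem (hW : IsRatAnalysisSystem W) {f : Series n} (hf : f ∈ algebraicSeries n) :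
    f ∈ W n := by
  obtain ⟨hfc, hfa⟩ := hf
  obtain ⟨r, hr, hfr⟩ := isConvergent_iff.1 hfc
  have : FaithfulSMul (MvPolynomial (Fin n) ℚ) (Series n) := by
    rw [faithfulSMul_iff_algebraMap_injective]
    intro p q h
    rw [algebraMap_eq_coe_map, algebraMap_eq_coe_map] at h
    exact MvPolynomial.map_injective _ (algebraMap ℚ ℝ).injective (MvPolynomial.coe_injective _ _ h)
  obtain ⟨Q, hQ0, hQ1⟩ := exists_aeval_derivative_ne_zero hfa
  have hQev := ev_aeval hfr Q
  have hQ'ev := ev_aeval hfr Q.derivative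
  obtain ⟨a, ha, haQ⟩ := exists_rat_ev_ne_zero hQ1 (r := fun i => r i / 2)
    (fun i => half_pos (hr i)) (ne_top_of_le_ne_top hQ'ev.1 (wnorm_mono _ fun i => half_le_self (zero_le)))
  set a' : Fin n → ℝ := fun i => a i with ha'
  have har : ∀ i, ‖a' i‖₊ < r i := fun i => (ha i).trans (half_lt_self (hr i))
  set s : Fin n → ℝ≥0 := fun i => r i - ‖a' i‖₊ with hs_def
  have hs : ∀ i, 0 < s i := fun i => tsub_pos_of_lt (har i)
  have hsr : ∀ i, s i + ‖a' i‖₊ ≤ r i := fun i => (tsub_add_cancel_of_le (har i).le).le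
  have hgn : wnorm (transl a' f) s ≠ ⊤ := ne_top_of_le_ne_top hfr (wnorm_transl_le a' f hsr)
  have hgev : ∀ x, (∀ i, ‖x i‖₊ ≤ s i) → ev (transl a' f) x = ev f (fun i => x i + a' i) :=
    fun x hx => ev_transl a' hfr hsr hx
  set Q₁ : MvPolynomial (Fin (n + 1)) ℚ := Polynomial.eval₂
    (MvPolynomial.rename Fin.castSucc).toRingHom (MvPolynomial.X (Fin.last n)) Q with hQ₁
  have hQ₁ev : ∀ (y : Fin n → ℝ) (z : ℝ), MvPolynomial.aeval (vsnoc y z) Q₁ =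
      Polynomial.eval₂ (MvPolynomial.aeval y : _ →ₐ[ℚ] ℝ).toRingHom z Q := fun y z => by
    change (MvPolynomial.aeval (vsnoc y z) : _ →ₐ[ℚ] ℝ).toRingHom _ = _
    rw [hQ₁, Polynomial.hom_eval₂]
    congr 1
    · refine MvPolynomial.ringHom_ext (fun q => ?_) fun i => ?_ <;> simp
    · simp
  have hmem : transl a' f ∈ W n := by
    refine mem_of_implicit hW (Q := Q₁) (a := a) ⟨s, hs, hgn⟩ ?_ haQ ?_
    · filter_upwards [eventually_nnnorm_le (𝕜 := ℝ) hs] with x hx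
      have hy : ∀ i, ‖x i + a' i‖₊ ≤ r i := fun i =>
        (nnnorm_add_le _ _).trans ((add_le_add_left (hx i) _).trans (hsr i))
      rw [hQ₁ev, hgev x hx, ← hQev.2 _ hy, hQ0, ev_zero]
    · simp_rw [hQ₁ev]
      have h0 : ev (transl a' f) 0 = ev f a' := by
        rw [hgev 0 (by simp)]; simp
      rw [h0, hQ'ev.2 _ fun i => (har i).le]
      simp_rw [Polynomial.eval₂_eq_eval_map]
      rw [← Polynomial.derivative_map]
      exact Polynomial.hasDerivAt _ _
  exact hW.mem_of_transl_mem hfr (fun i => (lt_div_iff₀' two_pos).1 (ha i))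
    (fun i => ⟨a i, rfl⟩) hmem

end Algebraic

/-! ### Convergence and formal closure properties of ℐ𝒜 -/

section IntegratedAlgebraic

variable {n m : ℕ}

lemma Conv.rename {σ τ : Type*} [Fintype σ] [Fintype τ] {𝕜 : Type*} [RCLike 𝕜]
    {f : MvPowerSeries σ 𝕜} (hf : Conv f) {e : σ → τ} (he : Function.Injective e) :
    Conv (MvPowerSeries.rename e f) := by
  obtain ⟨r, hr, hfr⟩ := hf
  have h1 : (fun i => Function.extend e r 1 (e i)) = r := funext fun i => he.extend_apply _ _ _
  refine ⟨Function.extend e r 1, fun j => ?_, ?_⟩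
  · by_cases hj : ∃ i, e i = j
    · obtain ⟨i, rfl⟩ := hj
      rw [he.extend_apply]; exact hr i
    · rw [Function.extend_apply' _ _ _ hj]; exact one_pos
  · refine ne_top_of_le_ne_top hfr ((wnorm_rename_le e f).trans ?_)
    rw [h1]

lemma Conv.antid {σ : Type*} [Fintype σ] {𝕜 : Type*} [RCLike 𝕜] {f : MvPowerSeries σ 𝕜}
    (hf : Conv f) (i : σ) : Conv (antid i f) := by
  obtain ⟨r, hr, hfr⟩ := hf
  exact ⟨r, hr, ne_top_of_le_ne_top (ENNReal.mul_ne_top ENNReal.coe_ne_top hfr)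
    (wnorm_antid_le _ _ _)⟩

lemma Conv.subst {f : Series n} (hf : Conv f) {g : Fin n → Series m} (hg : ∀ i, Conv (g i))
    (h0 : ∀ i, constantCoeff (g i) = 0) : Conv (f.subst g) := by
  obtain ⟨R, hR, hfR⟩ := hf
  obtain ⟨s, hs, hgs⟩ := exists_common_wnorm_lt hg h0 (ε := fun i => (R i : ℝ≥0∞))
    fun i => by exact_mod_cast hR i
  rw [subst_eq_tsubst f (hasSubst_of_constantCoeff_zero h0)]
  exact ⟨s, hs, ne_top_of_le_ne_top hfR (wnorm_tsubst_le f fun i => (hgs i).le)⟩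

lemma conv_transl {f : Series n} {a : Fin n → ℝ} (ha : a ∈ domain f) : Conv (transl a f) := by
  obtain ⟨r, har, hr⟩ := exists_wnorm_ne_top_of_mem_domain ha
  exact ⟨fun i => r i - ‖a i‖₊, fun i => tsub_pos_of_lt (har i), ne_top_of_le_ne_top hr
    (wnorm_transl_le a f fun i => (tsub_add_cancel_of_le (har i).le).le)⟩

lemma constantCoeff_coe_map {σ : Type*} (p : MvPolynomial σ ℚ) :
    constantCoeff (MvPolynomial.map (algebraMap ℚ ℝ) p : MvPowerSeries σ ℝ) =
      ((MvPolynomial.constantCoeff p : ℚ) : ℝ) := by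
  rw [← coeff_zero_eq_constantCoeff_apply, MvPolynomial.coeff_coe, MvPolynomial.coeff_map]
  rfl

/-- The collection of all convergent power series. -/
def convergentSeries : Collection := fun _ => {f | IsConvergent f}

lemma mem_convergentSeries {f : Series n} : f ∈ convergentSeries n ↔ Conv f := isConvergent_iff

lemma isPresystem_convergentSeries : IsPresystem convergentSeries where
  convergent _ _ hf := hf
  subring n := by
    refine ⟨⟨⟨⟨⟨{f | IsConvergent f}, ?_⟩, ?_⟩, ?_, ?_⟩, ?_⟩, rfl⟩
    · intro f g hf hg
      exact mem_convergentSeries.2 ((mem_convergentSeries.1 hf).mul (mem_convergentSeries.1 hg))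
    · exact mem_convergentSeries.2 (by simpa using conv_C (σ := Fin n) (1 : ℝ))
    · intro f g hf hg
      exact mem_convergentSeries.2 ((mem_convergentSeries.1 hf).add (mem_convergentSeries.1 hg))
    · exact mem_convergentSeries.2 (by simpa using conv_C (σ := Fin n) (0 : ℝ))
    · intro f hf
      exact mem_convergentSeries.2 (mem_convergentSeries.1 hf).neg
  inter n f hf := ⟨fun _ => mem_convergentSeries.2
    (Conv.rename (isConvergent_iff.1 hf) (Fin.castSucc_injective n)), fun _ => hf⟩
  perm n f hf π := mem_convergentSeries.2 (Conv.rename (isConvergent_iff.1 hf) π.injective)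

lemma isIntegrationClosed_convergentSeries : IsIntegrationClosed convergentSeries where
  algebraic_mem _ _ hf := hf.1
  inv_mem _ _ hf h0 := mem_convergentSeries.2 ((mem_convergentSeries.1 hf).inv h0)
  subst_mem _ _ hf h h0 := mem_convergentSeries.2 ((mem_convergentSeries.1 hf).subst
    (fun _ => conv_coe _) fun i => by rw [constantCoeff_coe_map, h0 i, Rat.cast_zero])
  translation_mem _ _ _ _ ha := mem_convergentSeries.2 (conv_transl ha)
  antideriv_mem _ _ hf := mem_convergentSeries.2 ((mem_convergentSeries.1 hf).antid _)

lemma mem_integratedAlgebraic_iff {f : Series n} : f ∈ integratedAlgebraic n ↔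
    ∀ S : Collection, IsPresystem S → IsIntegrationClosed S → f ∈ S n := by
  rw [integratedAlgebraic, sInf_apply]
  simp only [Set.iInf_eq_iInter, Set.mem_iInter, Subtype.forall, Set.mem_ofPred_eq, and_imp]

/-- An intersection inherits convergence only if the family is nonempty; the collection of all
convergent series is a member of it. -/
lemma conv_of_mem_integratedAlgebraic {f : Series n} (hf : f ∈ integratedAlgebraic n) : Conv f :=
  mem_convergentSeries.1 (mem_integratedAlgebraic_iff.1 hf _ isPresystem_convergentSeries
    isIntegrationClosed_convergentSeries)

lemma isPresystem_integratedAlgebraic : IsPresystem integratedAlgebraic where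
  convergent _ _ hf := isConvergent_iff.2 (conv_of_mem_integratedAlgebraic hf)
  subring n := by
    refine ⟨⟨⟨⟨⟨integratedAlgebraic n, ?_⟩, ?_⟩, ?_, ?_⟩, ?_⟩, rfl⟩
    · intro f g hf hg
      refine mem_integratedAlgebraic_iff.2 fun S h1 h2 => ?_
      exact h1.mul_mem (mem_integratedAlgebraic_iff.1 hf S h1 h2)
        (mem_integratedAlgebraic_iff.1 hg S h1 h2)
    · refine mem_integratedAlgebraic_iff.2 fun S h1 h2 => ?_
      simpa using h1.natCast_mem n 1
    · intro f g hf hg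
      refine mem_integratedAlgebraic_iff.2 fun S h1 h2 => ?_
      exact h1.add_mem (mem_integratedAlgebraic_iff.1 hf S h1 h2)
        (mem_integratedAlgebraic_iff.1 hg S h1 h2)
    · exact mem_integratedAlgebraic_iff.2 fun S h1 h2 => h1.zero_mem n
    · intro f hf
      refine mem_integratedAlgebraic_iff.2 fun S h1 h2 => ?_
      exact h1.neg_mem (mem_integratedAlgebraic_iff.1 hf S h1 h2)
  inter n f hf := by
    constructor <;> refine fun h => mem_integratedAlgebraic_iff.2 fun S h1 h2 => ?_
    · exact (h1.inter n f hf).1 (mem_integratedAlgebraic_iff.1 h S h1 h2)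
    · exact (h1.inter n f hf).2 (mem_integratedAlgebraic_iff.1 h S h1 h2)
  perm n f hf π := mem_integratedAlgebraic_iff.2 fun S h1 h2 =>
    h1.perm n f (mem_integratedAlgebraic_iff.1 hf S h1 h2) π

lemma isIntegrationClosed_integratedAlgebraic : IsIntegrationClosed integratedAlgebraic where
  algebraic_mem n f hf := mem_integratedAlgebraic_iff.2 fun _ _ h2 => h2.algebraic_mem n f hf
  inv_mem n f hf h0 := mem_integratedAlgebraic_iff.2 fun S h1 h2 =>
    h2.inv_mem n f (mem_integratedAlgebraic_iff.1 hf S h1 h2) h0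
  subst_mem n f hf h h0 := mem_integratedAlgebraic_iff.2 fun S h1 h2 =>
    h2.subst_mem n f (mem_integratedAlgebraic_iff.1 hf S h1 h2) h h0
  translation_mem n f hf a ha := mem_integratedAlgebraic_iff.2 fun S h1 h2 =>
    h2.translation_mem n f (mem_integratedAlgebraic_iff.1 hf S h1 h2) a ha
  antideriv_mem n f hf := mem_integratedAlgebraic_iff.2 fun S h1 h2 =>
    h2.antideriv_mem n f (mem_integratedAlgebraic_iff.1 hf S h1 h2)

lemma integratedAlgebraic_le {S : Collection} (h1 : IsPresystem S) (h2 : IsIntegrationClosed S) :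
    integratedAlgebraic ≤ S := fun _ _ hf => mem_integratedAlgebraic_iff.1 hf S h1 h2

end IntegratedAlgebraic

/-! ### Setting a variable to zero -/

section AtZero

variable {σ : Type*} {𝕜 : Type*} [RCLike 𝕜]

/-- The series with the variable `X_i` replaced by `0`. -/
def atZero (i : σ) (f : MvPowerSeries σ 𝕜) : MvPowerSeries σ 𝕜 :=
  fun α => if α i = 0 then coeff α f else 0

lemma coeff_atZero (i : σ) (f : MvPowerSeries σ 𝕜) (α : σ →₀ ℕ) :
    coeff α (atZero i f) = if α i = 0 then coeff α f else 0 := rfl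

lemma pderiv_atZero_of_ne {i j : σ} (h : j ≠ i) (f : MvPowerSeries σ 𝕜) :
    pderiv 𝕜 j (atZero i f) = atZero i (pderiv 𝕜 j f) := by
  ext α
  rw [coeff_pderiv, coeff_atZero, coeff_atZero, coeff_pderiv]
  simp [h]

lemma eq_antid_pderiv_add_atZero (i : σ) (f : MvPowerSeries σ 𝕜) :
    f = antid i (pderiv 𝕜 i f) + atZero i f := by
  ext α
  rw [map_add, coeff_atZero]
  split_ifs with h
  · rw [coeff_antid_of_eq_zero i _ h, zero_add]
  · obtain ⟨β, rfl⟩ : ∃ β, β + Finsupp.single i 1 = α :=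
      ⟨α - Finsupp.single i 1, tsub_add_cancel_of_le (by
        rw [Finsupp.single_le_iff]; omega)⟩
    rw [coeff_antid_add_single, coeff_pderiv, add_zero]
    have : ((β i : 𝕜) + 1) ≠ 0 := by exact_mod_cast Nat.succ_ne_zero (β i)
    push_cast
    field_simp

lemma pderiv_antid (i : σ) (f : MvPowerSeries σ 𝕜) : pderiv 𝕜 i (antid i f) = f := by
  ext α
  rw [coeff_pderiv, coeff_antid_add_single]
  have : ((α i : 𝕜) + 1) ≠ 0 := by exact_mod_cast Nat.succ_ne_zero (α i)
  push_cast
  field_simp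

variable [Fintype σ]

lemma wnorm_atZero_le (i : σ) (f : MvPowerSeries σ 𝕜) (r : σ → ℝ≥0) :
    wnorm (atZero i f) r ≤ wnorm f r :=
  wnorm_le_of_coeff_le (fun α => by rw [coeff_atZero]; split_ifs <;> simp) r

lemma Conv.atZero {f : MvPowerSeries σ 𝕜} (hf : Conv f) (i : σ) : Conv (atZero i f) := by
  obtain ⟨r, hr, hfr⟩ := hf
  exact ⟨r, hr, ne_top_of_le_ne_top hfr (wnorm_atZero_le i f r)⟩

lemma mon_update_zero [DecidableEq σ] {i : σ} (x : σ → 𝕜) (α : σ →₀ ℕ) :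
    mon (Function.update x i 0) α = if α i = 0 then mon x α else 0 := by
  split_ifs with h
  · refine Finset.prod_congr rfl fun j _ => ?_
    by_cases hj : j = i
    · rw [hj, h, pow_zero, pow_zero]
    · rw [Function.update_of_ne hj]
  · exact Finset.prod_eq_zero (Finset.mem_univ i) (by simp [h])

lemma ev_atZero [DecidableEq σ] (i : σ) (f : MvPowerSeries σ 𝕜) (x : σ → 𝕜) :
    ev (atZero i f) x = ev f (Function.update x i 0) := by
  refine tsum_congr fun α => ?_
  rw [coeff_atZero, mon_update_zero]
  split_ifs <;> simp

lemma ev_antid_of_eq_zero {i : σ} (f : MvPowerSeries σ 𝕜) {x : σ → 𝕜} (hx : x i = 0) :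
    ev (antid i f) x = 0 := by
  rw [ev_antid]
  simp [hx]

end AtZero

/-! ### ℐ𝒜 satisfies the real closure properties -/

section IntegratedAlgebraic

variable {n m : ℕ}

lemma constantCoeff_update_X (i j : Fin n) :
    constantCoeff (Function.update (X : Fin n → Series n) i 0 j) = 0 := by
  by_cases hj : j = i
  · rw [hj]; simp
  · simp [hj]

lemma atZero_eq_subst (i : Fin n) {f : Series n} (hf : Conv f) :
    atZero i f = f.subst (Function.update (X : Fin n → Series n) i 0) := by
  have hX : ∀ j, Conv (Function.update (X : Fin n → Series n) i 0 j) := fun j => by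
    by_cases hj : j = i
    · rw [hj, Function.update_self]; simpa using conv_C (σ := Fin n) (0 : ℝ)
    · rw [Function.update_of_ne hj]; exact conv_X j
  refine (hf.atZero i).eq_of_eventually_real (hf.subst hX (constantCoeff_update_X i)) ?_
  rw [subst_eq_tsubst f (hasSubst_of_constantCoeff_zero (constantCoeff_update_X i))]
  obtain ⟨r, hr, hfr⟩ := hf
  filter_upwards [eventually_nnnorm_le (𝕜 := ℝ) hr] with x hx
  rw [ev_atZero, ev_tsubst hfr (s := r) _ hx]
  · congr 1
    ext j
    by_cases hj : j = i
    · rw [hj]; simp [ev_zero]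
    · simp [hj, ev_X]
  · intro j
    by_cases hj : j = i
    · rw [hj]; simp [wnorm_zero]
    · simp [hj, wnorm_X]

lemma atZero_mem_integratedAlgebraic (i : Fin n) {f : Series n} (hf : f ∈ integratedAlgebraic n) :
    atZero i f ∈ integratedAlgebraic n := by
  have hu : (fun j => (MvPolynomial.map (algebraMap ℚ ℝ) (Function.update MvPolynomial.X i 0 j) :
      Series n)) = Function.update X i 0 := by
    ext1 j
    by_cases hj : j = i
    · rw [hj]; simp
    · simp [hj]
  rw [atZero_eq_subst i (conv_of_mem_integratedAlgebraic hf), ← hu]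
  refine isIntegrationClosed_integratedAlgebraic.subst_mem n f hf _ fun j => ?_
  by_cases hj : j = i
  · rw [hj]; simp
  · simp [hj]

/-- Only restriction needs an argument: replacing X_n by the polynomial 0 stays in ℐ𝒜, and the
result, which does not involve X_n, descends by the intersection axiom of presystems. -/
lemma isRatSystem_integratedAlgebraic : IsRatSystem integratedAlgebraic where
  toIsPresystem := isPresystem_integratedAlgebraic
  X_mem n i := isIntegrationClosed_integratedAlgebraic.algebraic_mem n _
    ⟨isConvergent_iff.2 (conv_X i), by
      have : (X i : Series n) = algebraMap (MvPolynomial (Fin n) ℚ) _ (MvPolynomial.X i) := by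
        rw [algebraMap_eq_coe_map]; simp
      rw [this]
      exact isAlgebraic_algebraMap _⟩
  inv_mem := isIntegrationClosed_integratedAlgebraic.inv_mem
  ratTranslation_mem := isIntegrationClosed_integratedAlgebraic.translation_mem
  restrict_mem n f hf := by
    obtain ⟨r, hr, hfr⟩ := conv_of_mem_integratedAlgebraic hf
    have hk : wnorm (killCompl (Fin.castSuccEmb : Fin n ↪ Fin (n + 1)) f)
        (fun i => r i.castSucc) ≠ ⊤ :=
      ne_top_of_le_ne_top hfr (wnorm_killCompl_le Fin.castSuccEmb f r)
    have hkc : Conv (killCompl (Fin.castSuccEmb : Fin n ↪ Fin (n + 1)) f) :=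
      ⟨_, fun i => hr _, hk⟩
    refine isPresystem_integratedAlgebraic.mem_of_rename_mem (Fin.castSucc_injective n) hkc ?_
    refine isPresystem_integratedAlgebraic.mem_of_eventually
      (hkc.rename (Fin.castSucc_injective n)) (atZero_mem_integratedAlgebraic (Fin.last n) hf) ?_
    filter_upwards [eventually_nnnorm_le (𝕜 := ℝ) hr] with x hx
    obtain ⟨y, t, rfl⟩ : ∃ y t, vsnoc y t = x := ⟨_, _, vsnoc_comp_castSucc x⟩
    have h1 := ev_killCompl Fin.castSuccEmb f (vsnoc y 0) (by simp [forall_fin_succ_iff])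
    simp only [Fin.coe_castSuccEmb, vsnoc_castSucc] at h1
    rw [ev_rename Fin.castSucc hk hx, ev_atZero, update_vsnoc_last]
    simpa using h1
  antideriv_mem := isIntegrationClosed_integratedAlgebraic.antideriv_mem

end IntegratedAlgebraic

/-! ### Complexification of derivatives, antiderivatives and renamings -/

section Complexify

variable {n m : ℕ}

lemma hasSubst_complexPoint (n : ℕ) : HasSubst (fun j : Fin n =>
    (X (reIdx j) + C Complex.I * X (imIdx j) : MvPowerSeries (Fin (2 * n)) ℂ)) :=
  hasSubst_of_constantCoeff_zero fun j => by simp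

/-- Passing to the complexification, as a ring homomorphism. -/
def complexifyHom (n : ℕ) : Series n →+* MvPowerSeries (Fin (2 * n)) ℂ :=
  (substAlgHom (R := ℂ) (hasSubst_complexPoint n)).toRingHom.comp
    (MvPowerSeries.map Complex.ofRealHom)

lemma complexifyHom_apply (f : Series n) : complexifyHom n f = complexify f := by
  rw [complexify, ← coe_substAlgHom (hasSubst_complexPoint n)]
  rfl

lemma complexify_add (f g : Series n) : complexify (f + g) = complexify f + complexify g := by
  simp_rw [← complexifyHom_apply, map_add]

lemma complexify_mul (f g : Series n) : complexify (f * g) = complexify f * complexify g := by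
  simp_rw [← complexifyHom_apply, map_mul]

lemma complexify_neg (f : Series n) : complexify (-f) = -complexify f := by
  simp_rw [← complexifyHom_apply, map_neg]

lemma complexify_C (c : ℝ) : complexify (C c : Series n) = C (c : ℂ) := by
  rw [← complexifyHom_apply]
  change substAlgHom (hasSubst_complexPoint n) (MvPowerSeries.map Complex.ofRealHom (C c)) = _
  rw [map_C]
  have := substAlgHom_coe (hasSubst_complexPoint n) (MvPolynomial.C (c : ℂ))
  rwa [MvPolynomial.aeval_C, MvPolynomial.coe_C] at this

lemma complexify_X (j : Fin n) :
    complexify (X j : Series n) = X (reIdx j) + C Complex.I * X (imIdx j) := by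
  rw [← complexifyHom_apply]
  change substAlgHom (hasSubst_complexPoint n) (MvPowerSeries.map Complex.ofRealHom (X j)) = _
  rw [map_X, substAlgHom_X]

/-- The point of `ℂ^n` with given real and imaginary parts. -/
def complexPoint (x : Fin (2 * n) → ℂ) : Fin n → ℂ := fun j =>
  x (reIdx j) + Complex.I * x (imIdx j)

/-- Radii for the complexification. -/
def halfRadius (r : Fin n → ℝ≥0) : Fin (2 * n) → ℝ≥0 :=
  interleave (fun j => r j / 2) fun j => r j / 2

lemma halfRadius_pos {r : Fin n → ℝ≥0} (hr : ∀ i, 0 < r i) : ∀ i, 0 < halfRadius r i := by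
  rw [forall_fin_two_mul_iff]
  simp [halfRadius, hr]

lemma halfRadius_add (r : Fin n → ℝ≥0) (j : Fin n) :
    halfRadius r (reIdx j) + halfRadius r (imIdx j) ≤ r j := by
  simp [halfRadius]

lemma nnnorm_complexPoint_le {r : Fin n → ℝ≥0} {x : Fin (2 * n) → ℂ}
    (hx : ∀ i, ‖x i‖₊ ≤ halfRadius r i) (j : Fin n) : ‖complexPoint x j‖₊ ≤ r j := by
  refine (nnnorm_add_le _ _).trans ((add_le_add (hx _) ?_).trans (halfRadius_add r j))
  rw [nnnorm_mul, Complex.nnnorm_I, one_mul]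
  exact hx _

lemma ev_complexify_of_le {f : Series n} {r : Fin n → ℝ≥0} (hf : wnorm f r ≠ ⊤)
    {x : Fin (2 * n) → ℂ} (hx : ∀ i, ‖x i‖₊ ≤ halfRadius r i) :
    ev (complexify f) x = ev (toC f) (complexPoint x) :=
  ev_complexify hf (halfRadius_add r) hx

lemma wnorm_complexify_ne_top {f : Series n} {r : Fin n → ℝ≥0} (hf : wnorm f r ≠ ⊤) :
    wnorm (complexify f) (halfRadius r) ≠ ⊤ :=
  ne_top_of_le_ne_top hf (wnorm_complexify_le f (halfRadius_add r))

lemma Conv.complexify {f : Series n} (hf : Conv f) : Conv (complexify f) := by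
  obtain ⟨r, hr, hfr⟩ := hf
  exact ⟨_, halfRadius_pos hr, wnorm_complexify_ne_top hfr⟩

lemma Conv.pderiv {σ : Type*} [Fintype σ] {𝕜 : Type*} [RCLike 𝕜] {f : MvPowerSeries σ 𝕜}
    (hf : Conv f) (i : σ) : Conv (pderiv 𝕜 i f) := by
  classical
  obtain ⟨r, hr, hfr⟩ := hf
  refine ⟨Function.update r i (r i / 2), fun j => ?_,
    wnorm_update_ne_top_pderiv hfr i (half_lt_self (hr i))⟩
  by_cases hj : j = i
  · rw [hj]; simpa using hr i
  · rw [Function.update_of_ne hj]; exact hr j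

lemma pderiv_toC (j : Fin n) (f : Series n) : pderiv ℂ j (toC f) = toC (pderiv ℝ j f) := by
  ext α
  rw [coeff_pderiv, coeff_map, coeff_map, coeff_pderiv]
  simp

/-- The chain rule: the real variable number k moves only the j-th complex coordinate, with constant
speed c. The cases c = 1 and c = i are the two forms of the Cauchy-Riemann equations. -/
lemma pderiv_complexify_aux {f : Series n} (hf : Conv f) (j : Fin n) (k : Fin (2 * n)) {c : ℂ}
    (b : (Fin (2 * n) → ℂ) → ℂ) (hk : ∀ x t, complexPoint (Function.update x k t) =
      Function.update (complexPoint x) j (b x + c * t)) :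
    pderiv ℂ k (complexify f) = C c * complexify (pderiv ℝ j f) := by
  have hcc := (hf.complexify).pderiv k
  have hpc := hf.pderiv j
  refine hcc.eq_of_eventually_complex ((conv_C c).mul hpc.complexify) ?_
  obtain ⟨r, hr, hfr, hpr⟩ := hf.exists_common hpc
  have hs := halfRadius_pos hr
  have hq : ∀ i, 0 < halfRadius r i / 2 := fun i => half_pos (hs i)
  filter_upwards [eventually_nnnorm_le (𝕜 := ℝ) hq] with x hx
  set x' : Fin (2 * n) → ℂ := fun i => x i with hx'
  have hlt : ∀ i, ‖x' i‖₊ < halfRadius r i := fun i => by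
    rw [hx', Complex.nnnorm_real]
    exact (hx i).trans_lt (half_lt_self (hs i))
  have hle : ∀ i, ‖x' i‖₊ ≤ halfRadius r i := fun i => (hlt i).le
  have h1 := hasDerivAt_ev_update (wnorm_complexify_ne_top hfr) k (x := x') (t := x' k)
    (fun i _ => hle i) (hlt k)
  rw [Function.update_eq_self] at h1
  have hz : complexPoint x' = Function.update (complexPoint x') j (b x' + c * x' k) := by
    rw [← hk, Function.update_eq_self]
  have hzj : b x' + c * x' k = complexPoint x' j := by
    conv_rhs => rw [hz]
    simp
  have hzlt : ‖b x' + c * x' k‖₊ < r j := by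
    rw [hzj]
    have h2 : ‖complexPoint x' j‖₊ < halfRadius r (reIdx j) + halfRadius r (imIdx j) := by
      refine (nnnorm_add_le _ _).trans_lt (add_lt_add (hlt _) ?_)
      rw [nnnorm_mul, Complex.nnnorm_I, one_mul]
      exact hlt _
    exact h2.trans_le (halfRadius_add r j)
  have h2 := hasDerivAt_ev_update (f := toC f) (r := r) (by rwa [wnorm_toC]) j
    (x := complexPoint x') (t := b x' + c * x' k) (fun i _ => nnnorm_complexPoint_le hle i) hzlt
  have h3 : HasDerivAt (fun t => b x' + c * t) c (x' k) := by
    simpa using ((hasDerivAt_id (x' k)).const_mul c).const_add (b x')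
  have h4 := h2.comp (x' k) h3
  rw [← hz, pderiv_toC] at h4
  have h5 : (fun t => ev (complexify f) (Function.update x' k t)) =ᶠ[𝓝 (x' k)]
      ((fun t => ev (toC f) (Function.update (complexPoint x') j t)) ∘ fun t => b x' + c * t) := by
    have : ∀ᶠ t in 𝓝 (x' k), ‖t‖₊ < halfRadius r k :=
      continuous_nnnorm.continuousAt.eventually (gt_mem_nhds (hlt k))
    filter_upwards [this] with t ht
    rw [ev_complexify_of_le hfr, hk]
    · rfl
    · intro i
      by_cases hi : i = k
      · rw [hi]; simpa using ht.le
      · rw [Function.update_of_ne hi]; exact hle i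
  rw [h1.unique (h4.congr_of_eventuallyEq h5), ev_mul (r := halfRadius r) (by rw [wnorm_C]; simp)
    (wnorm_complexify_ne_top hpr) hle, ev_C, ev_complexify_of_le hpr hle, mul_comm]

/-- The Cauchy-Riemann equations. -/
lemma pderiv_reIdx_complexify {f : Series n} (hf : Conv f) (j : Fin n) :
    pderiv ℂ (reIdx j) (complexify f) = complexify (pderiv ℝ j f) := by
  have := pderiv_complexify_aux hf j (reIdx j) (c := 1) (fun x => Complex.I * x (imIdx j))
    fun x t => by
      ext i
      by_cases hi : i = j
      · rw [hi]; simp [complexPoint, (reIdx_ne_imIdx _ _).symm, add_comm]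
      · simp [complexPoint, hi, reIdx_injective.eq_iff, (reIdx_ne_imIdx _ _).symm]
  rwa [map_one, one_mul] at this

lemma pderiv_imIdx_complexify {f : Series n} (hf : Conv f) (j : Fin n) :
    pderiv ℂ (imIdx j) (complexify f) = C Complex.I * complexify (pderiv ℝ j f) :=
  pderiv_complexify_aux hf j (imIdx j) (fun x => x (reIdx j)) fun x t => by
    ext i
    by_cases hi : i = j
    · rw [hi]; simp [complexPoint, reIdx_ne_imIdx]
    · simp [complexPoint, hi, imIdx_injective.eq_iff, reIdx_ne_imIdx]

/-- This integrates f along the path from 0 to iY_j and on to X_j + iY_j. Formally, a series is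
recovered from its X_j-derivative and its value at X_j = 0, and the latter from its Y_j-derivative.
-/
lemma complexify_antid {f : Series n} (hf : Conv f) (j : Fin n) :
    complexify (antid j f) = antid (reIdx j) (complexify f) +
      antid (imIdx j) (C Complex.I * atZero (reIdx j) (complexify f)) := by
  have hA := hf.antid j
  have h1 := eq_antid_pderiv_add_atZero (reIdx j) (complexify (antid j f))
  have h2 := eq_antid_pderiv_add_atZero (imIdx j) (atZero (reIdx j) (complexify (antid j f)))
  rw [pderiv_reIdx_complexify hA, pderiv_antid] at h1
  rw [pderiv_atZero_of_ne (reIdx_ne_imIdx j j).symm, pderiv_imIdx_complexify hA, pderiv_antid] at h2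
  -- At X_j = Y_j = 0 the antiderivative is evaluated where its j-th coordinate vanishes, so no
  -- integration constant remains.
  have h3 : atZero (imIdx j) (atZero (reIdx j) (complexify (antid j f))) = 0 := by
    refine ((hA.complexify.atZero _).atZero _).eq_of_eventually_complex
      (by simpa using conv_C (σ := Fin (2 * n)) (0 : ℂ)) ?_
    obtain ⟨r, hr, hAr⟩ := hA
    filter_upwards [eventually_nnnorm_le (𝕜 := ℝ) (halfRadius_pos hr)] with x hx
    have hx' : ∀ i, ‖((x i : ℝ) : ℂ)‖₊ ≤ halfRadius r i := fun i => by
      rw [Complex.nnnorm_real]; exact hx i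
    have hup : ∀ (y : Fin (2 * n) → ℂ) (k : Fin (2 * n)), (∀ i, ‖y i‖₊ ≤ halfRadius r i) →
        ∀ i, ‖Function.update y k 0 i‖₊ ≤ halfRadius r i := fun y k hy i => by
      by_cases hi : i = k
      · rw [hi]; simp
      · rw [Function.update_of_ne hi]; exact hy i
    rw [ev_atZero, ev_atZero, ev_complexify_of_le hAr (hup _ _ (hup _ _ hx')), ev_zero]
    have : toC (antid j f) = antid j (toC f) := by
      ext α
      rw [coeff_map, coeff_antid]
      change _ = if α j = 0 then (0 : ℂ) else coeff (α - Finsupp.single j 1) (toC f) / (α j : ℂ)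
      split_ifs <;> simp
    rw [this]
    refine ev_antid_of_eq_zero _ ?_
    simp [complexPoint, (reIdx_ne_imIdx _ _).symm]
  have h4 : atZero (reIdx j) (C Complex.I * complexify f) =
      C Complex.I * atZero (reIdx j) (complexify f) := by
    ext α
    rw [coeff_atZero, coeff_C_mul, coeff_C_mul, coeff_atZero]
    split_ifs <;> simp
  rw [h3, add_zero, h4] at h2
  rw [← h2]
  exact h1

/-- The map of variables `(X, Y)` induced by a map of the variables `X`. -/
def doubleMap (e : Fin n → Fin m) : Fin (2 * n) → Fin (2 * m) :=
  interleave (fun j => reIdx (e j)) fun j => imIdx (e j)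

lemma doubleMap_injective {e : Fin n → Fin m} (he : Function.Injective e) :
    Function.Injective (doubleMap e) := by
  intro i
  revert i
  rw [forall_fin_two_mul_iff]
  refine ⟨fun j => ?_, fun j => ?_⟩ <;> intro k <;> revert k <;> rw [forall_fin_two_mul_iff] <;>
    simp [doubleMap, reIdx_injective.eq_iff, imIdx_injective.eq_iff, he.eq_iff, reIdx_ne_imIdx,
      (reIdx_ne_imIdx _ _).symm]

lemma complexify_rename {f : Series n} (hf : Conv f) {e : Fin n → Fin m}
    (he : Function.Injective e) :
    complexify (rename e f) = rename (doubleMap e) (complexify f) := by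
  have hc := (hf.rename he).complexify
  refine hc.eq_of_eventually_complex (hf.complexify.rename (doubleMap_injective he)) ?_
  obtain ⟨R, hR, hfR⟩ := hf.rename he
  obtain ⟨r, hr, hfr⟩ := hf
  set s : Fin m → ℝ≥0 := fun i => min (R i) (Function.extend e r 1 i) with hs_def
  have hs : ∀ i, 0 < s i := fun i => lt_min (hR i) (by
    by_cases hj : ∃ j, e j = i
    · obtain ⟨j, rfl⟩ := hj
      rw [he.extend_apply]; exact hr j
    · rw [Function.extend_apply' _ _ _ hj]; exact one_pos)
  have hse : wnorm f (fun j => s (e j)) ≠ ⊤ := ne_top_of_le_ne_top hfr (wnorm_mono _ fun j => by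
    refine (min_le_right _ _).trans ?_
    rw [he.extend_apply])
  have hsR := ne_top_of_le_ne_top hfR (wnorm_mono (rename e f) (r := s) fun j => min_le_left _ _)
  have hh : (fun i => halfRadius s (doubleMap e i)) = halfRadius fun j => s (e j) := by
    funext i
    revert i
    rw [forall_fin_two_mul_iff]
    simp [halfRadius, doubleMap]
  filter_upwards [eventually_nnnorm_le (𝕜 := ℝ) (halfRadius_pos hs)] with x hx
  have hx' : ∀ i, ‖((x i : ℝ) : ℂ)‖₊ ≤ halfRadius s i := fun i => by
    rw [Complex.nnnorm_real]; exact hx i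
  have h1 : toC (rename e f) = rename e (toC f) := (rename_map e Complex.ofRealHom f).symm
  rw [ev_complexify_of_le hsR hx', ev_rename (doubleMap e) (s := halfRadius s) (by
    rw [hh]; exact wnorm_complexify_ne_top hse) hx', ev_complexify_of_le hse, h1,
    ev_rename e (s := s) (by rwa [wnorm_toC]) (nnnorm_complexPoint_le hx')]
  · congr 1
    ext j
    simp [complexPoint, doubleMap]
  · intro i
    rw [← hh]
    exact hx' _

lemma complexify_eq_zero_iff {f : Series n} (hf : Conv f) : complexify f = 0 ↔ f = 0 := by
  refine ⟨fun h => ?_, fun h => by rw [h, ← complexifyHom_apply, map_zero]⟩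
  obtain ⟨r, hr, hfr⟩ := hf
  have hr2 : ∀ i, 0 < r i / 2 := fun i => half_pos (hr i)
  refine eq_zero_of_eventually_ev_eq_zero hr hfr ?_
  filter_upwards [eventually_nnnorm_le (𝕜 := ℝ) hr2] with x hx
  have h1 := ev_complexify_of_le hfr (x := interleave (fun j => (x j : ℂ)) 0) (by
    rw [forall_fin_two_mul_iff]
    simp only [halfRadius, interleave_reIdx, interleave_imIdx, Complex.nnnorm_real]
    exact ⟨hx, by simp⟩)
  rw [h, ev_zero] at h1
  have h2 : complexPoint (interleave (fun j => (x j : ℂ)) 0) = fun j => (x j : ℂ) := by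
    ext j; simp [complexPoint]
  rw [h2, ev_toC] at h1
  exact_mod_cast h1.symm

end Complexify

/-! ### Real and imaginary parts of algebraic series -/

section AlgebraicParts

variable {n : ℕ}

lemma isAlgebraic_C_ratCast {σ : Type*} (q : ℚ) :
    IsAlgebraic (MvPolynomial σ ℚ) (C (q : ℂ) : MvPowerSeries σ ℂ) := by
  have : (C (q : ℂ) : MvPowerSeries σ ℂ) =
      algebraMap (MvPolynomial σ ℚ) _ (MvPolynomial.C q) := by
    rw [MvPowerSeries.algebraMap_apply', MvPolynomial.coe_C, map_C]
    rfl
  rw [this]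
  exact isAlgebraic_algebraMap _

lemma isAlgebraic_X {σ : Type*} (i : σ) :
    IsAlgebraic (MvPolynomial σ ℚ) (X i : MvPowerSeries σ ℂ) := by
  have : (X i : MvPowerSeries σ ℂ) = algebraMap (MvPolynomial σ ℚ) _ (MvPolynomial.X i) := by
    rw [MvPowerSeries.algebraMap_apply', MvPolynomial.coe_X, map_X]
  rw [this]
  exact isAlgebraic_algebraMap _

lemma isAlgebraic_C_I {σ : Type*} :
    IsAlgebraic (MvPolynomial σ ℚ) (C Complex.I : MvPowerSeries σ ℂ) := by
  refine IsIntegral.isAlgebraic ⟨Polynomial.X ^ 2 + 1, ?_, ?_⟩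
  · exact Polynomial.monic_X_pow_add (by simp)
  · simp [pow_two, C_I_mul_C_I]

/-- Complexification sends rational polynomials to polynomials in X + iY, which are algebraic
because i is. A relation for f is therefore carried to one over the algebraic elements, nontrivial
since complexification is injective on polynomials, and algebraicity is transitive. -/
lemma isAlgebraic_complexify {f : Series n} (hf : IsAlgebraic (MvPolynomial (Fin n) ℚ) f) :
    IsAlgebraic (MvPolynomial (Fin (2 * n)) ℚ) (complexify f) := by
  set S := Subalgebra.algebraicClosure (MvPolynomial (Fin (2 * n)) ℚ)
    (MvPowerSeries (Fin (2 * n)) ℂ) with hS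
  set φ := (complexifyHom n).comp (algebraMap (MvPolynomial (Fin n) ℚ) (Series n)) with hφ
  have hφv : ∀ p, φ p = complexify (MvPolynomial.map (algebraMap ℚ ℝ) p : Series n) := fun p => by
    rw [hφ, RingHom.comp_apply, complexifyHom_apply, algebraMap_eq_coe_map]
  have hmem : ∀ p, φ p ∈ S := fun p => by
    induction p using MvPolynomial.induction_on with
    | C q =>
      rw [hφv, MvPolynomial.map_C, MvPolynomial.coe_C, complexify_C]
      exact isAlgebraic_C_ratCast q
    | add p q hp hq => rw [map_add]; exact S.add_mem hp hq
    | mul_X p i hp =>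
      rw [map_mul]
      refine S.mul_mem hp ?_
      rw [hφv, MvPolynomial.map_X, MvPolynomial.coe_X, complexify_X]
      exact (isAlgebraic_X _).add (isAlgebraic_C_I.mul (isAlgebraic_X _))
  have hinj : Function.Injective (φ.codRestrict S hmem) := by
    rw [injective_iff_map_eq_zero]
    intro p hp
    have h1 : φ p = 0 := congrArg Subtype.val hp
    rw [hφv, complexify_eq_zero_iff (conv_coe _)] at h1
    refine MvPolynomial.map_injective _ (algebraMap ℚ ℝ).injective ?_
    rw [map_zero]
    exact MvPolynomial.coe_injective _ _ (by rw [h1, MvPolynomial.coe_zero])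
  have := IsAlgebraic.ringHom_of_comp_eq (φ.codRestrict S hmem) (complexifyHom n) hf hinj rfl
  rw [complexifyHom_apply] at this
  exact this.restrictScalars (MvPolynomial (Fin (2 * n)) ℚ)

lemma isAlgebraic_of_toC {σ : Type*} {g : MvPowerSeries σ ℝ}
    (h : IsAlgebraic (MvPolynomial σ ℚ) (toC g)) : IsAlgebraic (MvPolynomial σ ℚ) g := by
  let φ : MvPowerSeries σ ℝ →ₐ[MvPolynomial σ ℚ] MvPowerSeries σ ℂ :=
    { MvPowerSeries.map Complex.ofRealHom with
      commutes' := fun p => by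
        change MvPowerSeries.map Complex.ofRealHom _ = _
        rw [MvPowerSeries.algebraMap_apply', MvPowerSeries.algebraMap_apply']
        ext α
        simp }
  refine (isAlgebraic_algHom_iff φ fun a b hab => ?_).1 h
  have := congrArg reS (show toC a = toC b from hab)
  rwa [reS_toC, reS_toC] at this

/-- Conjugating coefficients fixes rational polynomials, so F and its conjugate are both algebraic;
the two parts are combinations of these with coefficients 1/2 and i. -/
lemma isAlgebraic_reS_imS {σ : Type*} {F : MvPowerSeries σ ℂ}
    (h : IsAlgebraic (MvPolynomial σ ℚ) F) :
    IsAlgebraic (MvPolynomial σ ℚ) (reS F) ∧ IsAlgebraic (MvPolynomial σ ℚ) (imS F) := by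
  let κ : MvPowerSeries σ ℂ →ₐ[MvPolynomial σ ℚ] MvPowerSeries σ ℂ :=
    { MvPowerSeries.map (starRingEnd ℂ) with
      commutes' := fun p => by
        change MvPowerSeries.map (starRingEnd ℂ) _ = _
        rw [MvPowerSeries.algebraMap_apply']
        ext α
        simp }
  have hκ : ∀ α, coeff α (κ F) = (starRingEnd ℂ) (coeff α F) := fun α => coeff_map _ _ _
  have hconj := h.algHom κ
  have h2 := isAlgebraic_C_ratCast (σ := σ) (1 / 2)
  constructor
  · refine isAlgebraic_of_toC ?_
    have : toC (reS F) = C ((1 / 2 : ℚ) : ℂ) * (F + κ F) := by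
      ext α
      rw [coeff_map, coeff_reS, coeff_C_mul, map_add, hκ, Complex.add_conj]
      push_cast
      simp
    rw [this]
    exact h2.mul (h.add hconj)
  · refine isAlgebraic_of_toC ?_
    have : toC (imS F) = C ((1 / 2 : ℚ) : ℂ) * (C Complex.I * (κ F - F)) := by
      ext α
      rw [coeff_map, coeff_imS, coeff_C_mul, coeff_C_mul, map_sub, hκ, ← neg_sub, Complex.sub_conj]
      apply Complex.ext <;> simp
    rw [this]
    exact h2.mul (isAlgebraic_C_I.mul (hconj.sub h))

end AlgebraicParts

/-! ### Real and imaginary parts stay in ℐ𝒜 -/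

section Closure

variable {n : ℕ}

lemma complexify_inv {f : Series n} (h0 : constantCoeff f ≠ 0) :
    constantCoeff (complexify f) ≠ 0 ∧ complexify f⁻¹ = (complexify f)⁻¹ := by
  have h1 : complexify f⁻¹ * complexify f = 1 := by
    rw [← complexify_mul, MvPowerSeries.inv_mul_cancel f h0, ← complexifyHom_apply, map_one]
  have h2 : constantCoeff (complexify f) ≠ 0 := fun h => by
    have := congrArg constantCoeff h1
    rw [map_mul, h, mul_zero, map_one] at this
    exact zero_ne_one this
  exact ⟨h2, (MvPowerSeries.eq_inv_iff_mul_eq_one h2).2 h1⟩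

lemma exists_complexify_map_eq (p : MvPolynomial (Fin n) ℚ) :
    ∃ u v : MvPolynomial (Fin (2 * n)) ℚ,
      complexify (MvPolynomial.map (algebraMap ℚ ℝ) p : Series n) =
        toC (MvPolynomial.map (algebraMap ℚ ℝ) u : Series (2 * n)) +
          C Complex.I * toC (MvPolynomial.map (algebraMap ℚ ℝ) v : Series (2 * n)) := by
  induction p using MvPolynomial.induction_on with
  | C q => exact ⟨MvPolynomial.C q, 0, by simp [complexify_C]⟩
  | add p q hp hq =>
    obtain ⟨u, v, h1⟩ := hp
    obtain ⟨u', v', h2⟩ := hq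
    refine ⟨u + u', v + v', ?_⟩
    simp only [map_add, MvPolynomial.coe_add, complexify_add, h1, h2, mul_add]
    ring
  | mul_X p i hp =>
    obtain ⟨u, v, h1⟩ := hp
    refine ⟨u * MvPolynomial.X (reIdx i) - v * MvPolynomial.X (imIdx i),
      u * MvPolynomial.X (imIdx i) + v * MvPolynomial.X (reIdx i), ?_⟩
    have hs : ∀ a b : MvPolynomial (Fin (2 * n)) ℝ, ((a - b : MvPolynomial (Fin (2 * n)) ℝ) :
        Series (2 * n)) = (a : Series (2 * n)) - (b : Series (2 * n)) := fun a b =>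
      map_sub (MvPolynomial.coeToMvPowerSeries.ringHom (R := ℝ)) a b
    simp only [map_add, map_sub, map_mul, MvPolynomial.map_X, MvPolynomial.coe_add, hs,
      MvPolynomial.coe_mul, MvPolynomial.coe_X, complexify_mul, h1, complexify_X, map_X]
    linear_combination (toC (MvPolynomial.map (algebraMap ℚ ℝ) v : Series (2 * n)) *
      X (imIdx i)) * C_I_mul_C_I (σ := Fin (2 * n))

/-- If g has complexification u + iv, then f(g) complexifies to f_ℂ evaluated at the real pairs
(u_j, v_j). Thus both parts of f(g) arise from those of f by a real substitution in 2n variables. -/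
lemma complexify_subst (f : Series n) {g : Fin n → Series n} (hg : ∀ i, constantCoeff (g i) = 0)
    {u v : Fin n → Series (2 * n)} (hu : ∀ i, constantCoeff (u i) = 0)
    (hv : ∀ i, constantCoeff (v i) = 0)
    (huv : ∀ i, complexify (g i) = toC (u i) + C Complex.I * toC (v i)) :
    complexify (f.subst g) = toC ((reS (complexify f)).subst (interleave u v)) +
      C Complex.I * toC ((imS (complexify f)).subst (interleave u v)) := by
  have hH : ∀ k, constantCoeff (interleave u v k) = 0 := by
    rw [forall_fin_two_mul_iff]; simpa using ⟨hu, hv⟩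
  have sH := hasSubst_of_constantCoeff_zero hH
  have sg := hasSubst_of_constantCoeff_zero hg
  have sHC : HasSubst fun k => toC (interleave u v k) := sH.map _
  have sgC : HasSubst fun i => toC (g i) := sg.map _
  have e1 : complexify (f.subst g) = (toC f).subst fun i => complexify (g i) := by
    rw [complexify, MvPowerSeries.map_subst sg, subst_comp_subst_apply sgC (hasSubst_complexPoint n)]
    rfl
  have e2 : (complexify f).subst (fun k => toC (interleave u v k)) =
      (toC f).subst fun i => complexify (g i) := by
    rw [complexify, subst_comp_subst_apply (hasSubst_complexPoint n) sHC]
    congr 1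
    ext1 i
    rw [huv, subst_add sHC, subst_mul sHC, subst_X sHC, subst_X sHC, subst_C, interleave_reIdx,
      interleave_imIdx]
  rw [e1, ← e2]
  conv_lhs => rw [eq_toC_add (complexify f)]
  rw [subst_add sHC, subst_mul sHC, subst_C]
  rw [toC, toC, toC, toC, MvPowerSeries.map_subst sH, MvPowerSeries.map_subst sH]

lemma toC_transl (a : Fin n → ℝ) (f : Series n) :
    toC (transl a f) = transl (fun i => (a i : ℂ)) (toC f) := by
  ext α
  change ((∑' β : Fin n →₀ ℕ, (∏ i, ((β i + α i).choose (α i) : ℝ)) * coeff (β + α) f *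
    mon a β : ℝ) : ℂ) = ∑' β : Fin n →₀ ℕ, (∏ i, ((β i + α i).choose (α i) : ℂ)) *
      coeff (β + α) (toC f) * mon (fun i => (a i : ℂ)) β
  rw [Complex.ofReal_tsum]
  refine tsum_congr fun β => ?_
  rw [coeff_map, mon, mon]
  push_cast
  rfl

lemma memC_complexify_transl {W : Collection} (hW : IsRatSystem W) {f : Series n}
    (hf : MemC W (complexify f)) {a : Fin n → ℝ} (ha : a ∈ domain f)
    (hq : ∀ i, ∃ q : ℚ, (q : ℝ) = a i) : MemC W (complexify (transl a f)) := by
  obtain ⟨r, har, hfr⟩ := exists_wnorm_ne_top_of_mem_domain ha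
  have hδ : ∀ i, 0 < (r i - ‖a i‖₊) / 2 := fun i => half_pos (tsub_pos_of_lt (har i))
  -- Unequal radii: the X-radius must exceed |a_i|, the Y-radius only has to be positive, and their
  -- sum must not exceed r_i. Equal halves of r might fail to contain a.
  set t : Fin (2 * n) → ℝ≥0 := interleave (fun i => ‖a i‖₊ + (r i - ‖a i‖₊) / 2)
    (fun i => (r i - ‖a i‖₊) / 2) with ht
  have htr : ∀ j, t (reIdx j) + t (imIdx j) ≤ r j := fun j => by
    rw [ht, interleave_reIdx, interleave_imIdx, add_assoc, add_halves,
      add_tsub_cancel_of_le (har j).le]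
  set c : Fin (2 * n) → ℝ := interleave a 0 with hc
  have hct : ∀ k, ‖c k‖₊ < t k := by
    rw [forall_fin_two_mul_iff]
    simp only [hc, ht, interleave_reIdx, interleave_imIdx]
    exact ⟨fun j => lt_add_of_pos_right _ (hδ j), fun j => by simpa using hδ j⟩
  have hct' : ∀ k, (t k - ‖c k‖₊) + ‖((c k : ℝ) : ℂ)‖₊ ≤ t k := fun k => by
    rw [Complex.nnnorm_real]; exact (tsub_add_cancel_of_le (hct k).le).le
  have hcn : wnorm (complexify f) t ≠ ⊤ := ne_top_of_le_ne_top hfr (wnorm_complexify_le f htr)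
  have hM := MemC.transl hW hf hcn hct (by
    rw [forall_fin_two_mul_iff]
    simp only [hc, interleave_reIdx, interleave_imIdx]
    exact ⟨hq, fun _ => ⟨0, by simp⟩⟩)
  have hr' : ∀ j, 0 < r j - ‖a j‖₊ := fun j => tsub_pos_of_lt (har j)
  have har' : ∀ j, (r j - ‖a j‖₊) + ‖a j‖₊ ≤ r j := fun j => (tsub_add_cancel_of_le (har j).le).le
  have hTn : wnorm (transl a f) (fun j => r j - ‖a j‖₊) ≠ ⊤ :=
    ne_top_of_le_ne_top hfr (wnorm_transl_le a f har')
  refine MemC.of_eventually hW.toIsPresystem (Conv.complexify (conv_transl ha)) hM ?_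
  filter_upwards [eventually_nnnorm_le (𝕜 := ℝ) (halfRadius_pos hr'),
    eventually_nnnorm_le (𝕜 := ℝ) (r := fun k => t k - ‖c k‖₊) fun k => tsub_pos_of_lt (hct k)]
    with x hx1 hx2
  have hx1' : ∀ i, ‖((x i : ℝ) : ℂ)‖₊ ≤ halfRadius (fun j => r j - ‖a j‖₊) i := by simpa using hx1
  have hx2' : ∀ i, ‖((x i : ℝ) : ℂ)‖₊ ≤ t i - ‖c i‖₊ := by simpa using hx2
  rw [ev_complexify_of_le hTn hx1', toC_transl, ev_transl _ (r := r) (by rwa [wnorm_toC])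
    (s := fun j => r j - ‖a j‖₊) (fun j => by rw [Complex.nnnorm_real]; exact har' j)
    (nnnorm_complexPoint_le hx1'), ev_transl _ hcn hct' hx2', ev_complexify hfr htr fun i =>
      (nnnorm_add_le _ _).trans ((add_le_add_left (hx2' i) _).trans (hct' i))]
  congr 1
  ext j
  simp [complexPoint, hc]
  ring

lemma memC_atZero_integratedAlgebraic (k : Fin n) {g : MvPowerSeries (Fin n) ℂ}
    (hg : MemC integratedAlgebraic g) : MemC integratedAlgebraic (atZero k g) := by
  constructor
  · convert atZero_mem_integratedAlgebraic k hg.1 using 1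
    ext α
    rw [coeff_reS, coeff_atZero, coeff_atZero, coeff_reS]
    split_ifs <;> simp
  · convert atZero_mem_integratedAlgebraic k hg.2 using 1
    ext α
    rw [coeff_imS, coeff_atZero, coeff_atZero, coeff_imS]
    split_ifs <;> simp

lemma memC_rename_iff {W : Collection} (hW : IsPresystem W) {m : ℕ} {e : Fin n → Fin m}
    (he : Function.Injective e) {g : MvPowerSeries (Fin n) ℂ} (hg : Conv g) :
    MemC W (rename e g) ↔ MemC W g := by
  have h1 : rename e g = toC (rename e (reS g)) + C Complex.I * toC (rename e (imS g)) := by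
    conv_lhs => rw [eq_toC_add g]
    rw [map_add, map_mul, rename_C, rename_map, rename_map]
  rw [h1, MemC, reS_toC_add, imS_toC_add]
  exact ⟨fun h => ⟨hW.mem_of_rename_mem he hg.reS h.1, hW.mem_of_rename_mem he hg.imS h.2⟩,
    fun h => ⟨hW.rename_mem he h.1, hW.rename_mem he h.2⟩⟩

/-- The integrated algebraic series whose real and imaginary parts are integrated algebraic. -/
def realImagClosed : Collection := fun n =>
  {f | f ∈ integratedAlgebraic n ∧ MemC integratedAlgebraic (complexify f)}

lemma isPresystem_realImagClosed : IsPresystem realImagClosed where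
  convergent n f hf := isPresystem_integratedAlgebraic.convergent n f hf.1
  subring n := by
    have hP := isPresystem_integratedAlgebraic
    refine ⟨⟨⟨⟨⟨realImagClosed n, ?_⟩, ?_⟩, ?_, ?_⟩, ?_⟩, rfl⟩
    · exact fun hf hg => ⟨hP.mul_mem hf.1 hg.1, complexify_mul _ _ ▸ hf.2.mul hP hg.2⟩
    · refine ⟨isRatSystem_integratedAlgebraic.one_mem n, ?_⟩
      rw [← complexifyHom_apply, map_one, ← map_one (MvPowerSeries.map Complex.ofRealHom)]
      exact MemC.toC hP (isRatSystem_integratedAlgebraic.one_mem _)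
    · exact fun hf hg => ⟨hP.add_mem hf.1 hg.1, complexify_add _ _ ▸ hf.2.add hP hg.2⟩
    · refine ⟨hP.zero_mem n, ?_⟩
      rw [← complexifyHom_apply, map_zero, ← map_zero (MvPowerSeries.map Complex.ofRealHom)]
      exact MemC.toC hP (hP.zero_mem _)
    · exact fun hf => ⟨hP.neg_mem hf.1, complexify_neg _ ▸ hf.2.neg hP⟩
  inter n f hf := by
    have hc : Conv f := isConvergent_iff.1 hf
    have hi := Fin.castSucc_injective n
    refine and_congr (isPresystem_integratedAlgebraic.inter n f hf) ?_
    rw [complexify_rename hc hi, memC_rename_iff isPresystem_integratedAlgebraic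
      (doubleMap_injective hi) hc.complexify]
  perm n f hf π := by
    have hc := conv_of_mem_integratedAlgebraic hf.1
    refine ⟨isPresystem_integratedAlgebraic.perm n f hf.1 π, ?_⟩
    rw [complexify_rename hc π.injective, memC_rename_iff isPresystem_integratedAlgebraic
      (doubleMap_injective π.injective) hc.complexify]
    exact hf.2

/-- Each operation on f becomes the corresponding operation on the complexification. For
substitutions, a rational polynomial complexifies to u + iv with u and v again rational polynomials,
without constant terms. -/
lemma isIntegrationClosed_realImagClosed : IsIntegrationClosed realImagClosed where
  algebraic_mem n f hf := by
    have h1 := isAlgebraic_reS_imS (isAlgebraic_complexify hf.2)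
    have hc := Conv.complexify (isConvergent_iff.1 hf.1)
    exact ⟨isIntegrationClosed_integratedAlgebraic.algebraic_mem n f hf,
      isIntegrationClosed_integratedAlgebraic.algebraic_mem _ _ ⟨isConvergent_iff.2 hc.reS, h1.1⟩,
      isIntegrationClosed_integratedAlgebraic.algebraic_mem _ _ ⟨isConvergent_iff.2 hc.imS, h1.2⟩⟩
  inv_mem n f hf h0 := by
    obtain ⟨h1, h2⟩ := complexify_inv h0
    exact ⟨isIntegrationClosed_integratedAlgebraic.inv_mem n f hf.1 h0,
      h2 ▸ hf.2.inv isRatSystem_integratedAlgebraic h1⟩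
  subst_mem n f hf h h0 := by
    have hI := isIntegrationClosed_integratedAlgebraic
    choose u v huv using fun i => exists_complexify_map_eq (h i)
    have hg0 : ∀ i, constantCoeff (MvPolynomial.map (algebraMap ℚ ℝ) (h i) : Series n) = 0 :=
      fun i => by rw [constantCoeff_coe_map, h0, Rat.cast_zero]
    have huv0 : ∀ i, MvPolynomial.constantCoeff (u i) = 0 ∧ MvPolynomial.constantCoeff (v i) = 0 :=
      fun i => by
      have h1 := congrArg constantCoeff (huv i)
      have h2 : constantCoeff (complexify
          (MvPolynomial.map (algebraMap ℚ ℝ) (h i) : Series n)) = 0 := by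
        obtain ⟨r, hr, hfr⟩ := conv_coe (MvPolynomial.map (algebraMap ℚ ℝ) (h i))
        rw [← ev_at_zero, ev_complexify_of_le hfr (by simp)]
        have : complexPoint (0 : Fin (2 * n) → ℂ) = 0 := by ext; simp [complexPoint]
        rw [this, ev_at_zero, constantCoeff_map, hg0, map_zero]
      rw [h2, map_add, map_mul, constantCoeff_map, constantCoeff_map, constantCoeff_coe_map,
        constantCoeff_coe_map, constantCoeff_C] at h1
      have h3 := congrArg Complex.re h1
      have h4 := congrArg Complex.im h1
      simp at h3 h4
      exact ⟨by exact_mod_cast h3.symm, by exact_mod_cast h4.symm⟩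
    have hH : ∀ k, MvPolynomial.constantCoeff (interleave u v k) = 0 := by
      rw [forall_fin_two_mul_iff]
      simpa using ⟨fun j => (huv0 j).1, fun j => (huv0 j).2⟩
    have key := complexify_subst f hg0 (u := fun i => MvPolynomial.map (algebraMap ℚ ℝ) (u i))
      (v := fun i => MvPolynomial.map (algebraMap ℚ ℝ) (v i))
      (fun i => by rw [constantCoeff_coe_map, (huv0 i).1, Rat.cast_zero])
      (fun i => by rw [constantCoeff_coe_map, (huv0 i).2, Rat.cast_zero]) huv
    have hint : interleave (fun i => (MvPolynomial.map (algebraMap ℚ ℝ) (u i) : Series (2 * n)))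
        (fun i => (MvPolynomial.map (algebraMap ℚ ℝ) (v i) : Series (2 * n))) =
        fun k => (MvPolynomial.map (algebraMap ℚ ℝ) (interleave u v k) : Series (2 * n)) := by
      ext1 k
      revert k
      rw [forall_fin_two_mul_iff]
      simp
    rw [hint] at key
    refine ⟨hI.subst_mem n f hf.1 h h0, ?_⟩
    rw [key, MemC, reS_toC_add, imS_toC_add]
    exact ⟨hI.subst_mem _ _ hf.2.1 _ hH, hI.subst_mem _ _ hf.2.2 _ hH⟩
  translation_mem n f hf a ha :=
    ⟨isIntegrationClosed_integratedAlgebraic.translation_mem n f hf.1 a ha,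
      memC_complexify_transl isRatSystem_integratedAlgebraic hf.2 ha fun i => ⟨a i, rfl⟩⟩
  antideriv_mem n f hf := by
    have hW := isRatSystem_integratedAlgebraic
    have hP := isPresystem_integratedAlgebraic
    refine ⟨isIntegrationClosed_integratedAlgebraic.antideriv_mem n f hf.1, ?_⟩
    change MemC _ (complexify (antid (Fin.last n) f))
    rw [complexify_antid (conv_of_mem_integratedAlgebraic hf.1)]
    exact (hf.2.antid hW _).add hP
      (((MemC.C_I hW).mul hP (memC_atZero_integratedAlgebraic _ hf.2)).antid hW _)

/-- Minimality of ℐ𝒜 against `realImagClosed`, which is contained in ℐ𝒜 by construction. -/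
lemma isRatAnalysisSystem_integratedAlgebraic : IsRatAnalysisSystem integratedAlgebraic where
  toIsRatSystem := isRatSystem_integratedAlgebraic
  rePart_mem n _ hf := (integratedAlgebraic_le isPresystem_realImagClosed
    isIntegrationClosed_realImagClosed (n + 1) hf).2.1
  imPart_mem n _ hf := (integratedAlgebraic_le isPresystem_realImagClosed
    isIntegrationClosed_realImagClosed (n + 1) hf).2.2

end Closure

/-! ### Division by variables, coefficients, derivatives, and the comparison of systems -/

section Division

variable {W : Collection} {n : ℕ}

/-- The quotient of `f - f(X_i = 0)` by `X_i`. -/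
def divX {σ 𝕜 : Type*} [RCLike 𝕜] (i : σ) (f : MvPowerSeries σ 𝕜) : MvPowerSeries σ 𝕜 :=
  fun α => coeff (α + Finsupp.single i 1) f

lemma coeff_divX {σ 𝕜 : Type*} [RCLike 𝕜] (i : σ) (f : MvPowerSeries σ 𝕜) (α : σ →₀ ℕ) :
    coeff α (divX i f) = coeff (α + Finsupp.single i 1) f := rfl

lemma X_mul_divX {σ 𝕜 : Type*} [RCLike 𝕜] (i : σ) (f : MvPowerSeries σ 𝕜) :
    X i * divX i f = f - atZero i f := by
  classical
  ext α
  rw [map_sub, coeff_atZero]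
  by_cases h : α i = 0
  · rw [if_pos h, sub_self, X_def, coeff_monomial_mul, if_neg]
    rw [Finsupp.single_le_iff]; omega
  · obtain ⟨β, rfl⟩ : ∃ β, Finsupp.single i 1 + β = α :=
      ⟨α - Finsupp.single i 1, add_tsub_cancel_of_le (by rw [Finsupp.single_le_iff]; omega)⟩
    rw [if_neg h, sub_zero, X_def, coeff_add_monomial_mul, one_mul, coeff_divX, add_comm]

lemma Conv.divX {σ 𝕜 : Type*} [Fintype σ] [RCLike 𝕜] {f : MvPowerSeries σ 𝕜} (hf : Conv f)
    (i : σ) : Conv (divX i f) := by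
  obtain ⟨r, hr, hfr⟩ := hf
  refine ⟨r, hr, fun htop => hfr (top_le_iff.1 ?_)⟩
  have h1 : wnorm (ConvergentSeries.divX i f) r * r i ≤ wnorm f r := by
    rw [wnorm, ← ENNReal.tsum_mul_right]
    refine le_trans (ENNReal.tsum_le_tsum fun β => ?_)
      (ENNReal.tsum_comp_le_tsum_of_injective (add_single_injective i)
        fun α => ((‖coeff α f‖₊ * mon r α : ℝ≥0) : ℝ≥0∞))
    rw [coeff_divX, mon_add, mon_single, pow_one, ← ENNReal.coe_mul, mul_assoc]
  rwa [htop, ENNReal.top_mul (by exact_mod_cast (hr i).ne')] at h1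

/-- X_i is not invertible at the origin, but its translate X_i + q is. Divide at a nearby rational
point and translate the quotient back. -/
lemma IsRatSystem.mem_of_X_mul_mem (hW : IsRatSystem W) {g : Series n} (hg : Conv g) (i : Fin n)
    (h : X i * g ∈ W n) : g ∈ W n := by
  classical
  obtain ⟨r, hr, hgr⟩ := hg
  obtain ⟨q, hq0, hq⟩ := exists_rat_btwn (show (0 : ℝ) < (r i : ℝ) / 2 by
    have : (0 : ℝ) < r i := hr i
    positivity)
  set c : Fin n → ℝ := Pi.single i (q : ℝ) with hc
  have hcr : ∀ j, 2 * ‖c j‖₊ < r j := fun j => by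
    by_cases hj : j = i
    · subst hj
      rw [hc, Pi.single_eq_same, ← NNReal.coe_lt_coe]
      push_cast
      rw [Real.norm_eq_abs, abs_of_pos hq0]
      linarith
    · rw [hc, Pi.single_eq_of_ne hj]
      simpa using hr j
  have hcr' : ∀ j, ‖c j‖₊ < r j := fun j =>
    lt_of_le_of_lt (by rw [two_mul]; exact le_self_add) (hcr j)
  have hcq : ∀ j, ∃ p : ℚ, (p : ℝ) = c j := fun j => by
    by_cases hj : j = i
    · exact ⟨q, by rw [hj, hc, Pi.single_eq_same]⟩
    · exact ⟨0, by rw [hc, Pi.single_eq_of_ne hj, Rat.cast_zero]⟩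
  refine hW.mem_of_transl_mem hgr hcr hcq ?_
  have hXr : wnorm (X i : Series n) r ≠ ⊤ := by rw [wnorm_X]; simp
  have hT := hW.transl_mem h (wnorm_mul_ne_top hXr hgr) hcr' hcq
  set s : Fin n → ℝ≥0 := fun j => r j - ‖c j‖₊ with hs_def
  have hs : ∀ j, 0 < s j := fun j => tsub_pos_of_lt (hcr' j)
  have hsr : ∀ j, s j + ‖c j‖₊ ≤ r j := fun j => (tsub_add_cancel_of_le (hcr' j).le).le
  have hL : (X i + C (q : ℝ) : Series n) ∈ W n := hW.add_mem (hW.X_mem n i) (hW.ratCast_mem n q)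
  have hL0 : constantCoeff (X i + C (q : ℝ) : Series n) ≠ 0 := by simpa using hq0.ne'
  have hLs : wnorm (X i + C (q : ℝ) : Series n) s ≠ ⊤ :=
    wnorm_add_ne_top (by rw [wnorm_X]; simp) (by rw [wnorm_C]; simp)
  have hgs : wnorm (transl c g) s ≠ ⊤ := ne_top_of_le_ne_top hgr (wnorm_transl_le c g hsr)
  have hmul : transl c (X i * g) = (X i + C (q : ℝ)) * transl c g := by
    refine Conv.eq_of_eventually_real ⟨s, hs, ne_top_of_le_ne_top (wnorm_mul_ne_top hXr hgr)
      (wnorm_transl_le c _ hsr)⟩ ⟨s, hs, wnorm_mul_ne_top hLs hgs⟩ ?_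
    filter_upwards [eventually_nnnorm_le (𝕜 := ℝ) hs] with x hx
    have hx' : ∀ j, ‖x j + c j‖₊ ≤ r j := fun j =>
      (nnnorm_add_le _ _).trans ((add_le_add_left (hx j) _).trans (hsr j))
    rw [ev_transl c (wnorm_mul_ne_top hXr hgr) hsr hx, ev_mul hXr hgr hx', ev_mul hLs hgs hx,
      ev_transl c hgr hsr hx, ev_X, ev_add (r := s) (by rw [wnorm_X]; simp)
      (by rw [wnorm_C]; simp) hx, ev_X, ev_C, hc, Pi.single_eq_same]
  have := hW.mul_mem (hW.inv_mem n _ hL hL0) hT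
  rwa [hmul, ← mul_assoc, MvPowerSeries.inv_mul_cancel _ hL0, one_mul] at this

namespace IsRatAnalysisSystem

lemma atZero_mem (hW : IsRatAnalysisSystem W) (i : Fin n) {f : Series n} (hf : f ∈ W n) :
    atZero i f ∈ W n := by
  rw [atZero_eq_subst i (hW.conv hf)]
  refine hW.subst_mem hf (fun j => ?_) (constantCoeff_update_X i)
  by_cases hj : j = i
  · rw [hj, Function.update_self]; exact hW.zero_mem n
  · rw [Function.update_of_ne hj]; exact hW.X_mem n j

lemma divX_mem (hW : IsRatAnalysisSystem W) (i : Fin n) {f : Series n} (hf : f ∈ W n) :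
    divX i f ∈ W n := by
  refine hW.mem_of_X_mul_mem ((hW.conv hf).divX i) i ?_
  rw [X_mul_divX]
  exact hW.sub_mem hf (hW.atZero_mem i hf)

/-- Each division by a variable lowers the exponent of the wanted coefficient by one; the constant
term is the restriction to no variables. -/
lemma coeff_mem (hW : IsRatAnalysisSystem W) {f : Series n} (hf : f ∈ W n) (α : Fin n →₀ ℕ) :
    coeff α f ∈ coeffField W := by
  induction hN : ∑ i, α i using Nat.strong_induction_on generalizing α f with
  | _ N ih =>
    by_cases h : α = 0
    · rw [h]
      have h1 := hW.killCompl_mem (⟨Fin.elim0, fun i => i.elim0⟩ : Fin 0 ↪ Fin n) hf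
      change C _ ∈ W 0
      convert h1 using 1
      refine MvPowerSeries.ext fun β => ?_
      rw [Subsingleton.elim β 0, coeff_killCompl, coeff_zero_C]
      rfl
    · obtain ⟨i, hi⟩ := Finsupp.ne_iff.1 h
      obtain ⟨β, rfl⟩ : ∃ β, β + Finsupp.single i 1 = α :=
        ⟨α - Finsupp.single i 1, tsub_add_cancel_of_le (by
          rw [Finsupp.single_le_iff]
          exact Nat.one_le_iff_ne_zero.2 hi)⟩
      rw [← coeff_divX]
      refine ih _ ?_ (hW.divX_mem i hf) β rfl
      rw [← hN]
      simp only [Finsupp.add_apply, Finset.sum_add_distrib]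
      have : ∑ j, (Finsupp.single i 1 : Fin n →₀ ℕ) j = 1 := by
        simp [Finsupp.single_apply]
      omega

/-- Difference quotients: form f(X', X_n + Y), subtract its value at Y = 0, divide by Y and put Y =
0. -/
lemma pderiv_mem (hW : IsRatAnalysisSystem W) {f : Series (n + 1)} (hf : f ∈ W (n + 1)) :
    pderiv ℝ (Fin.last n) f ∈ W (n + 1) := by
  set g : Fin (n + 1) → Series (n + 2) := vsnoc (fun j => X j.castSucc.castSucc)
    (X (Fin.last n).castSucc + X (Fin.last (n + 1))) with hg
  have hg0 : ∀ i, constantCoeff (g i) = 0 := by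
    rw [forall_fin_succ_iff]; simp [hg]
  have hgW : ∀ i, g i ∈ W (n + 2) := by
    rw [forall_fin_succ_iff]
    simp only [hg, vsnoc_castSucc, vsnoc_last]
    exact ⟨fun j => hW.X_mem _ _, hW.add_mem (hW.X_mem _ _) (hW.X_mem _ _)⟩
  have hF := hW.subst_mem hf hgW hg0
  set F := f.subst g with hF_def
  have hFt : F = tsubst f g := subst_eq_tsubst f (hasSubst_of_constantCoeff_zero hg0)
  have hres : killCompl (Fin.castSuccEmb : Fin (n + 1) ↪ Fin (n + 2))
      (pderiv ℝ (Fin.last (n + 1)) F) = killCompl Fin.castSuccEmb (divX (Fin.last (n + 1)) F) := by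
    ext α
    rw [coeff_killCompl, coeff_killCompl, coeff_pderiv, coeff_divX]
    have : (α.embDomain Fin.castSuccEmb) (Fin.last (n + 1)) = 0 :=
      Finsupp.embDomain_of_notMem_range _ _ _ (by
        rintro ⟨j, hj⟩
        exact Fin.castSucc_ne_last j hj)
    rw [this]
    simp
  have hmem : killCompl (Fin.castSuccEmb : Fin (n + 1) ↪ Fin (n + 2))
      (divX (Fin.last (n + 1)) F) ∈ W (n + 1) :=
    hW.restrict_mem _ _ (hW.divX_mem _ hF)
  rw [← hres] at hmem
  refine hW.mem_of_eventually ((hW.conv hf).pderiv _) hmem ?_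
  obtain ⟨r, hr, hfr⟩ := hW.conv hf
  have hr2 : ∀ i, 0 < r i / 2 := fun i => half_pos (hr i)
  set t : ℝ≥0 := r (Fin.last n) / 2 with ht
  have ht0 : 0 < t := hr2 (Fin.last n)
  have hgr : ∀ i, wnorm (g i) (vsnoc (fun i => r i / 2) t) ≤ r i := by
    rw [forall_fin_succ_iff]
    simp only [hg, vsnoc_castSucc, vsnoc_last, wnorm_X]
    refine ⟨fun j => ?_, (wnorm_add_le _ _ _).trans ?_⟩
    · exact_mod_cast half_le_self (zero_le)
    · rw [wnorm_X, wnorm_X, vsnoc_castSucc, vsnoc_last, ht]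
      exact_mod_cast (add_halves _).le
  have hFn : wnorm F (vsnoc (fun i => r i / 2) t) ≠ ⊤ := by
    rw [hFt]; exact ne_top_of_le_ne_top hfr (wnorm_tsubst_le f hgr)
  filter_upwards [eventually_nnnorm_le (𝕜 := ℝ) hr2] with x hx
  have hxr : ∀ i, ‖x i‖₊ < r i := fun i => (hx i).trans_lt (half_lt_self (hr i))
  have e1 := ev_killCompl Fin.castSuccEmb (pderiv ℝ (Fin.last (n + 1)) F) (vsnoc x 0)
    (by simp [forall_fin_succ_iff])
  simp only [Fin.coe_castSuccEmb, vsnoc_castSucc] at e1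
  have d1 := hasDerivAt_ev_update hFn (Fin.last (n + 1)) (x := vsnoc x 0) (t := 0) (by
    rw [forall_fin_succ_iff]; simpa using hx) (by simpa using ht0)
  simp only [update_vsnoc_last] at d1
  have d2 := hasDerivAt_ev_update hfr (Fin.last n) (x := x) (t := x (Fin.last n) + 0)
    (fun i _ => (hxr i).le) (by simpa using hxr (Fin.last n))
  have d3 := HasDerivAt.comp_const_add (x (Fin.last n)) 0 d2
  have heq : (fun y => ev F (vsnoc x y)) =ᶠ[𝓝 0]
      fun y => ev f (Function.update x (Fin.last n) (x (Fin.last n) + y)) := by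
    have : ∀ᶠ y : ℝ in 𝓝 0, ‖y‖₊ < t :=
      continuous_nnnorm.continuousAt.eventually (gt_mem_nhds (by simpa using ht0))
    filter_upwards [this] with y hy
    have hxy : ∀ i, ‖vsnoc x y i‖₊ ≤ vsnoc (fun i => r i / 2) t i := by
      rw [forall_fin_succ_iff]; simpa using ⟨hx, hy.le⟩
    rw [hFt, ev_tsubst hfr hgr hxy]
    congr 1
    ext i
    induction i using Fin.lastCases with
    | last =>
      simp only [hg, vsnoc_last, Function.update_self]
      rw [ev_add (r := vsnoc (fun i => r i / 2) t) (by rw [wnorm_X]; exact ENNReal.coe_ne_top)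
        (by rw [wnorm_X]; exact ENNReal.coe_ne_top) hxy, ev_X, ev_X]
      simp
    | cast j => simp [hg, ev_X, Fin.castSucc_ne_last]
  have := d1.unique (d3.congr_of_eventuallyEq heq)
  rw [add_zero, Function.update_eq_self] at this
  rw [e1, this]

lemma exists_subfield (hW : IsRatAnalysisSystem W) :
    ∃ k : Subfield ℝ, (k : Set ℝ) = coeffField W := by
  refine ⟨⟨⟨⟨⟨⟨coeffField W, ?_⟩, ?_⟩, ?_, ?_⟩, ?_⟩, ?_⟩, rfl⟩
  · intro a b ha hb
    change C _ ∈ W 0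
    rw [map_mul]; exact hW.mul_mem ha hb
  · change C _ ∈ W 0
    rw [map_one]; exact hW.one_mem 0
  · intro a b ha hb
    change C _ ∈ W 0
    rw [map_add]; exact hW.add_mem ha hb
  · change C _ ∈ W 0
    rw [map_zero]; exact hW.zero_mem 0
  · intro a ha
    change C _ ∈ W 0
    rw [map_neg]; exact hW.neg_mem ha
  · intro a ha
    change C _ ∈ W 0
    by_cases h0 : a = 0
    · rw [h0, inv_zero, map_zero]; exact hW.zero_mem 0
    · rw [← MvPowerSeries.C_inv]
      exact hW.inv_mem 0 _ ha (by simpa using h0)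

lemma polynomial_mem (hW : IsRatAnalysisSystem W) (p : MvPolynomial (Fin n) ℝ)
    (hp : ∀ α, MvPolynomial.coeff α p ∈ coeffField W) : (p : Series n) ∈ W n := by
  obtain ⟨A, hA⟩ := hW.subring n
  have hC : ∀ α, (C (MvPolynomial.coeff α p) : Series n) ∈ A := fun α => by
    rw [← SetLike.mem_coe, hA]; exact hW.C_mem (hp α) n
  have hX : ∀ i, (X i : Series n) ∈ A := fun i => by
    rw [← SetLike.mem_coe, hA]; exact hW.X_mem n i
  have h1 : (p : Series n) = ∑ α ∈ p.support,
      C (MvPolynomial.coeff α p) * ∏ i, (X i : Series n) ^ α i := by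
    conv_lhs => rw [MvPolynomial.as_sum p]
    have h2 : ∀ s : Finset (Fin n →₀ ℕ), ∀ u : (Fin n →₀ ℕ) → MvPolynomial (Fin n) ℝ,
        ((∑ α ∈ s, u α : MvPolynomial (Fin n) ℝ) : Series n) = ∑ α ∈ s, (u α : Series n) :=
      fun s u => map_sum (MvPolynomial.coeToMvPowerSeries.ringHom (R := ℝ)) u s
    rw [h2]
    refine Finset.sum_congr rfl fun α _ => ?_
    have h3 : ((∏ i, MvPolynomial.X i ^ α i : MvPolynomial (Fin n) ℝ) : Series n) =
        ∏ i, (X i : Series n) ^ α i := by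
      refine (map_prod (MvPolynomial.coeToMvPowerSeries.ringHom (R := ℝ))
        (fun i => (MvPolynomial.X i : MvPolynomial (Fin n) ℝ) ^ α i) Finset.univ).trans ?_
      refine Finset.prod_congr rfl fun i _ => ?_
      rw [map_pow, MvPolynomial.coeToMvPowerSeries.ringHom_apply, MvPolynomial.coe_X]
    rw [MvPolynomial.monomial_eq, MvPolynomial.coe_mul, MvPolynomial.coe_C, ← h3,
      Finsupp.prod_fintype _ _ fun i => pow_zero _]
  rw [← hA, SetLike.mem_coe, h1]
  exact A.sum_mem fun α _ => A.mul_mem (hC α) (A.prod_mem fun i _ => A.pow_mem (hX i) _)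

lemma isConvergentAnalysisSystem (hW : IsRatAnalysisSystem W) : IsConvergentAnalysisSystem W where
  toIsPresystem := hW.toIsPresystem
  subfield := hW.exists_subfield
  polynomial_mem _ _ p hp := hW.polynomial_mem p hp
  coeff_mem _ _ _ hf α := hW.coeff_mem hf α
  translation_mem _ _ hf _ ha hk := hW.translation_mem hf ha hk
  inv_mem n _ f hf h0 := hW.inv_mem n f hf h0
  restrict_mem := hW.restrict_mem
  pderiv_mem _ _ hf := hW.pderiv_mem hf
  rePart_mem n hn f hf := by
    obtain ⟨m, rfl⟩ := Nat.exists_eq_add_of_le' hn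
    exact hW.rePart_mem m f hf
  imPart_mem n hn f hf := by
    obtain ⟨m, rfl⟩ := Nat.exists_eq_add_of_le' hn
    exact hW.imPart_mem m f hf
  antideriv_mem := hW.antideriv_mem

lemma isIntegrationClosed (hW : IsRatAnalysisSystem W) : IsIntegrationClosed W where
  algebraic_mem _ _ hf := algebraic_mem hW hf
  inv_mem := hW.inv_mem
  subst_mem _ _ hf h h0 := hW.subst_mem hf (fun i => hW.map_mem (h i)) fun i => by
    rw [constantCoeff_coe_map, h0, Rat.cast_zero]
  translation_mem := hW.ratTranslation_mem
  antideriv_mem := hW.antideriv_mem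

end IsRatAnalysisSystem

/-- Rational translations are allowed because the coefficient field contains ℚ. Inverses in zero
variables are not part of the hypotheses on inverses and come from the field structure of S_0. -/
lemma IsConvergentAnalysisSystem.isRatAnalysisSystem (hS : IsConvergentAnalysisSystem W) :
    IsRatAnalysisSystem W where
  toIsPresystem := hS.toIsPresystem
  X_mem n i := by
    obtain ⟨k, hk⟩ := hS.subfield
    have := hS.polynomial_mem n (Nat.one_le_iff_ne_zero.2 fun h => by subst h; exact i.elim0)
      (MvPolynomial.X i) fun α => by
        rw [← hk, SetLike.mem_coe, MvPolynomial.coeff_X]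
        split_ifs
        exacts [k.one_mem, k.zero_mem]
    rwa [MvPolynomial.coe_X] at this
  inv_mem n f hf h0 := by
    cases n with
    | zero =>
      obtain ⟨k, hk⟩ := hS.subfield
      have hfC : f = C (constantCoeff f) := by
        refine MvPowerSeries.ext fun β => ?_
        rw [Subsingleton.elim β 0, coeff_zero_C, coeff_zero_eq_constantCoeff_apply]
      have h1 : constantCoeff f ∈ coeffField W := by
        change C _ ∈ W 0
        rwa [← hfC]
      rw [← hk, SetLike.mem_coe] at h1
      have h2 := k.inv_mem h1
      rw [← SetLike.mem_coe, hk] at h2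
      change C _ ∈ W 0 at h2
      rwa [← MvPowerSeries.C_inv, ← hfC] at h2
    | succ n => exact hS.inv_mem (n + 1) (Nat.le_add_left 1 n) f hf h0
  ratTranslation_mem n f hf a ha := by
    obtain ⟨k, hk⟩ := hS.subfield
    exact hS.translation_mem n f hf _ ha fun i => by
      rw [← hk]; exact SubfieldClass.ratCast_mem k (a i)
  restrict_mem := hS.restrict_mem
  antideriv_mem := hS.antideriv_mem
  rePart_mem n f hf := hS.rePart_mem (n + 1) (Nat.le_add_left 1 n) f hf
  imPart_mem n f hf := hS.imPart_mem (n + 1) (Nat.le_add_left 1 n) f hf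

end Division

end ConvergentSeries

end

theorem corollary2p12 :
    IsLeast {S : ConvergentSeries.Collection | ConvergentSeries.IsConvergentAnalysisSystem S}
      ConvergentSeries.integratedAlgebraic := by
  refine ⟨ConvergentSeries.isRatAnalysisSystem_integratedAlgebraic.isConvergentAnalysisSystem,
    fun S hS => ?_⟩
  exact ConvergentSeries.integratedAlgebraic_le hS.toIsPresystem
    (ConvergentSeries.IsConvergentAnalysisSystem.isRatAnalysisSystem hS).isIntegrationClosed
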